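/- Let $k$ be a field, and let $X$ be an irreducible normal $k$-scheme, locally of finite type over $k$, with function field $K(X)$. Let $L/K(X)$ be a finite Galois extension with group $G$, and let $\pi\colon W\to X$ be the normalization of $X$ in $L$. Assume that $L/K(X)$ is tamely ramified over $X$: for every point $w\in W$ lying over a point $x$ of codimension one of $X$, one has $\mathfrak m_x\mathcal O_{W,w}=\mathfrak m_w^{e}$ with an integer $e$ that is nonzero in the residue field $\kappa(w)$, and $\kappa(w)/\kappa(x)$ is separable. The group $G$ acts on $W$ over $X$. Let $p\ge 0$ be an integer, let $\Omega^p_X$ and $\Omega^p_W$ be the sheaves of $p$-forms over $k$, and let $(\Omega^p_X)^{**}$ (respectively $(\Omega^p_W)^{**}$) be the bidual of $\Omega^p_X$ as an $\mathcal O_X$-module (respectively of $\Omega^p_W$ as an $\mathcal O_W$-module), where $M^*=\mathcal Hom(M,\mathcal O)$. Then there is a unique morphism of $\mathcal O_X$-modules $$\alpha\colon(\Omega^p_X)^{**}\to\pi_*(\Omega^p_W)^{**}$$ that is compatible, through the canonical morphisms $\Omega^p_X\to(\Omega^p_X)^{**}$ and $\Omega^p_W\to(\Omega^p_W)^{**}$,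 with the pullback of forms $\Omega^p_X\to\pi_*\Omega^p_W$. On global sections the natural map $$(\Omega^p_X)^{**}(X)\to(\Omega^p_W)^{**}(W)$$ given by $\alpha$ is injective and its image is the set of $G$-invariants, so that it induces an isomorphism $$(\Omega^p_X)^{**}(X)\simeq\big((\Omega^p_W)^{**}(W)\big)^G .$$ -/

import Mathlib

open CategoryTheory Opposite AlgebraicGeometry TopologicalSpace
universe u
namespace ZariskiForms

section ExteriorPower
variable {A B C : Type*} [CommRing A] [CommRing B] [CommRing C]
  {M N P : Type*} [AddCommGroup M] [Module A M] [AddCommGroup N] [Module B N]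
  [AddCommGroup P] [Module C P]

/-- The map `⋀^n M → ⋀^n N` induced by a semilinear map `M → N` along a ring homomorphism. -/
noncomputable def extMap (n : ℕ) {φ : A →+* B} (f : M →ₛₗ[φ] N) :
    ⋀[A]^n M →ₛₗ[φ] ⋀[B]^n N :=
  letI : Module A (⋀[B]^n N) := Module.compHom _ φ
  letI h : M [⋀^Fin n]→ₗ[A] (⋀[B]^n N) :=
    { toFun := fun m ↦ exteriorPower.ιMulti B n (fun i ↦ f (m i))
      map_update_add' := fun m i x y ↦ by
        have key : ∀ z : M, (fun j ↦ f (Function.update m i z j)) =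
            Function.update (fun j ↦ f (m j)) i (f z) := fun z ↦ by
          funext j; by_cases hj : j = i <;> grind
        simp only [key, map_add, AlternatingMap.map_update_add]
      map_update_smul' := fun m i a x ↦ by
        have key : ∀ z : M, (fun j ↦ f (Function.update m i z j)) =
            Function.update (fun j ↦ f (m j)) i (f z) := fun z ↦ by
          funext j; by_cases hj : j = i <;> grind
        simp only [key, map_smulₛₗ, AlternatingMap.map_update_smul]
        rfl
      map_eq_zero_of_eq' := fun m i j hm hij ↦
        AlternatingMap.map_eq_zero_of_eq _ _ (congrArg f hm) hij }
  letI g : ⋀[A]^n M →ₗ[A] ⋀[B]^n N := exteriorPower.alternatingMapLinearEquiv h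
  { toFun := g, map_add' := g.map_add, map_smul' := fun a m ↦ g.map_smul a m }

lemma extMap_ιMulti (n : ℕ) {φ : A →+* B} (f : M →ₛₗ[φ] N) (m : Fin n → M) :
    extMap n f (exteriorPower.ιMulti A n m) = exteriorPower.ιMulti B n (fun i ↦ f (m i)) := by
  let : Module A (⋀[B]^n N) := Module.compHom _ φ
  exact exteriorPower.alternatingMapLinearEquiv_apply_ιMulti _ m

/-- Semilinear maps out of `⋀^n M` are determined by their values on pure wedges. -/
lemma ext_of_ιMulti {n : ℕ} {φ : A →+* B} {f g : ⋀[A]^n M →ₛₗ[φ] N}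
    (h : ∀ m : Fin n → M, f (exteriorPower.ιMulti A n m) = g (exteriorPower.ιMulti A n m)) :
    f = g := by
  apply LinearMap.ext_on_range (exteriorPower.ιMulti_span A n M) h

lemma extMap_comp (n : ℕ) {φ : A →+* B} {ψ : B →+* C} {χ : A →+* C} [RingHomCompTriple φ ψ χ]
    (f : M →ₛₗ[φ] N) (g : N →ₛₗ[ψ] P) (x : ⋀[A]^n M) :
    extMap n (g.comp f : M →ₛₗ[χ] P) x = extMap n g (extMap n f x) := by
  have : extMap n (g.comp f : M →ₛₗ[χ] P) = (extMap n g).comp (extMap n f) :=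
    ext_of_ιMulti fun m ↦ by simp [extMap_ιMulti]
  rw [this]; rfl

lemma extMap_id (n : ℕ) (x : ⋀[A]^n M) : extMap n (LinearMap.id : M →ₗ[A] M) x = x := by
  have : extMap n (LinearMap.id : M →ₗ[A] M) = LinearMap.id :=
    ext_of_ιMulti fun m ↦ by simp [extMap_ιMulti]
  rw [this]; rfl
end ExteriorPower

section Presheaves

variable {X : Scheme.{u}} (M : X.Opens → Type u) [∀ U, AddCommGroup (M U)]
  [∀ U, Module Γ(X, U) (M U)]
  (res : ∀ (U V : X.Opens) (h : V ≤ U), M U →ₛₗ[(X.presheaf.map (homOfLE h).op).hom] M V)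
  (res_id : ∀ U (x : M U), res U U le_rfl x = x)
  (res_comp : ∀ (U V W : X.Opens) (h : V ≤ U) (h' : W ≤ V) (x : M U),
    res U W (h'.trans h) x = res V W h' (res U V h x))

/-- The presheaf of abelian groups underlying `presheafMk`. -/
noncomputable def abPresheafMk : (Opens X)ᵒᵖ ⥤ Ab.{u} where
  obj U := AddCommGrpCat.of (M U.unop)
  map {U V} i := AddCommGrpCat.ofHom (res U.unop V.unop i.unop.le).toAddMonoidHom
  map_id U := by ext x; exact res_id _ x
  map_comp {U V W} i j := by ext x; exact res_comp _ _ _ i.unop.le j.unop.le x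

noncomputable instance instModuleAbPresheafMk (U : (Opens X)ᵒᵖ) :
    Module (X.ringCatSheaf.obj.obj U) ((abPresheafMk M res res_id res_comp).obj U) :=
  (inferInstance : Module Γ(X, U.unop) (M U.unop))

/-- The presheaf of modules on a scheme given by a module `M U` over `Γ(X, U)` for each open `U`
and functorial semilinear restriction maps. -/
noncomputable def presheafMk : X.PresheafOfModules :=
  PresheafOfModules.ofPresheaf (abPresheafMk M res res_id res_comp)
    (fun U V i r m ↦ (res U.unop V.unop i.unop.le).map_smulₛₗ r m)

end Presheaves

section Dual

variable {X : Scheme.{u}} (M : X.Modules)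

/-- Sections over `U` of the dual `𝓗om(M, 𝒪_X)`: morphisms of sheaves of modules `M|_U → 𝒪_U`,
i.e. families of `Γ(X, V)`-linear maps `Γ(M, V) → Γ(X, V)`, for `V ⊆ U` open, that commute with
restriction. -/
def dualSections (U : X.Opens) :
    AddSubgroup (∀ V : {V : X.Opens // V ≤ U}, Γ(M, V.1) →ₗ[Γ(X, V.1)] Γ(X, V.1)) where
  carrier := {φ | ∀ (V W : X.Opens) (hV : V ≤ U) (h : W ≤ V) (s : Γ(M, V)),
    φ ⟨W, h.trans hV⟩ (M.presheaf.map (homOfLE h).op s) =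
      X.presheaf.map (homOfLE h).op (φ ⟨V, hV⟩ s)}
  add_mem' {φ ψ} hφ hψ V W hV h s := by simp [hφ V W hV h s, hψ V W hV h s]
  zero_mem' V W hV h s := by simp
  neg_mem' {φ} hφ V W hV h s := by simp [hφ V W hV h s]

variable {M} in
/-- The value of a section of the dual over `U` on a section of `M` over `V ⊆ U`. -/
noncomputable def dualEval {U : X.Opens} (φ : dualSections M U) {V : X.Opens} (h : V ≤ U) :
    Γ(M, V) →ₗ[Γ(X, V)] Γ(X, V) := φ.1 ⟨V, h⟩

lemma dualEval_map {U : X.Opens} (φ : dualSections M U) {V W : X.Opens} (hV : V ≤ U) (h : W ≤ V)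
    (s : Γ(M, V)) : dualEval φ (h.trans hV) (M.presheaf.map (homOfLE h).op s) =
      X.presheaf.map (homOfLE h).op (dualEval φ hV s) :=
  φ.2 V W hV h s

variable {M} in
lemma dual_ext {U : X.Opens} {φ ψ : dualSections M U}
    (h : ∀ (V : X.Opens) (hV : V ≤ U) (s : Γ(M, V)), dualEval φ hV s = dualEval ψ hV s) : φ = ψ :=
  Subtype.ext <| funext fun V ↦ LinearMap.ext fun s ↦ h V.1 V.2 s

/-- Constructor for sections of the dual. -/
noncomputable def dualMk {U : X.Opens} (f : ∀ V : X.Opens, V ≤ U → Γ(M, V) → Γ(X, V))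
    (f_add : ∀ V hV s t, f V hV (s + t) = f V hV s + f V hV t)
    (f_smul : ∀ V hV (r : Γ(X, V)) (s : Γ(M, V)), f V hV (r • s) = r * f V hV s)
    (f_map : ∀ (V W : X.Opens) (hV : V ≤ U) (h : W ≤ V) (s : Γ(M, V)),
      f W (h.trans hV) (M.presheaf.map (homOfLE h).op s) =
        X.presheaf.map (homOfLE h).op (f V hV s)) : dualSections M U :=
  ⟨fun V ↦ { toFun := f V.1 V.2, map_add' := f_add V.1 V.2, map_smul' := f_smul V.1 V.2 }, f_map⟩

noncomputable instance instSMulDualSections (U : X.Opens) : SMul Γ(X, U) (dualSections M U) where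
  smul r φ := dualMk M (fun V hV s ↦ X.presheaf.map (homOfLE hV).op r * dualEval φ hV s)
    (fun V hV s t ↦ by simp [mul_add])
    (fun V hV a s ↦ by rw [map_smul, smul_eq_mul, mul_left_comm])
    (fun V W hV h s ↦ by
      rw [dualEval_map, map_mul, ← CategoryTheory.comp_apply, ← Functor.map_comp]; rfl)

variable {M} in
lemma dualEval_smul {U : X.Opens} (r : Γ(X, U)) (φ : dualSections M U) {V : X.Opens} (h : V ≤ U)
    (s : Γ(M, V)) :
    dualEval (r • φ) h s = X.presheaf.map (homOfLE h).op r * dualEval φ h s := rfl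

variable {M} in
lemma dualEval_add {U : X.Opens} (φ ψ : dualSections M U) {V : X.Opens} (h : V ≤ U)
    (s : Γ(M, V)) : dualEval (φ + ψ) h s = dualEval φ h s + dualEval ψ h s := rfl

noncomputable instance instModuleDualSections (U : X.Opens) :
    Module Γ(X, U) (dualSections M U) where
  one_smul φ := dual_ext fun V hV s ↦ by simp [dualEval_smul]
  mul_smul r r' φ := dual_ext fun V hV s ↦ by simp [dualEval_smul, mul_assoc]
  smul_zero r := dual_ext fun V hV s ↦ by
    rw [dualEval_smul]; exact mul_zero _
  smul_add r φ ψ := dual_ext fun V hV s ↦ by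
    simp only [dualEval_smul, dualEval_add, mul_add]
  add_smul r r' φ := dual_ext fun V hV s ↦ by
    simp only [dualEval_smul, dualEval_add, map_add, add_mul]
  zero_smul φ := dual_ext fun V hV s ↦ by
    rw [dualEval_smul, map_zero, zero_mul]; rfl

/-- Restriction of sections of the dual. -/
noncomputable def dualRes (U V : X.Opens) (h : V ≤ U) :
    dualSections M U →ₛₗ[(X.presheaf.map (homOfLE h).op).hom] dualSections M V where
  toFun φ := ⟨fun W ↦ φ.1 ⟨W.1, W.2.trans h⟩, fun W W' hW h' s ↦ φ.2 W W' (hW.trans h) h' s⟩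
  map_add' φ ψ := rfl
  map_smul' r φ := dual_ext fun W hW s ↦ by
    rw [dualEval_smul]
    change X.presheaf.map (homOfLE _).op r * dualEval φ _ s = _
    congr 1
    exact congr($(X.presheaf.map_comp (homOfLE h).op (homOfLE hW).op) r)

/-- The dual of a sheaf of modules, as a presheaf of modules. -/
noncomputable def dualPresheaf : X.PresheafOfModules :=
  presheafMk (fun U ↦ dualSections M U) (dualRes M) (fun _ _ ↦ rfl) (fun _ _ _ _ _ _ ↦ rfl)

variable {M} in
lemma map_map_mod {U V W : X.Opens} (h : V ≤ U) (h' : W ≤ V) (s : Γ(M, U)) :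
    M.presheaf.map (homOfLE h').op (M.presheaf.map (homOfLE h).op s) =
      M.presheaf.map (homOfLE (h'.trans h)).op s :=
  congr($(M.presheaf.map_comp (homOfLE h).op (homOfLE h').op) s).symm

lemma map_map_fun {U V W : X.Opens} (h : V ≤ U) (h' : W ≤ V) (s : Γ(X, U)) :
    X.presheaf.map (homOfLE h').op (X.presheaf.map (homOfLE h).op s) =
      X.presheaf.map (homOfLE (h'.trans h)).op s :=
  congr($(X.presheaf.map_comp (homOfLE h).op (homOfLE h').op) s).symm

lemma eq_of_cover {ι : Type u} (U : ι → X.Opens) {V : X.Opens} (hV : V ≤ iSup U)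
    (s t : Γ(X, V)) (h : ∀ i, X.presheaf.map (homOfLE (inf_le_left : V ⊓ U i ≤ V)).op s =
      X.presheaf.map (homOfLE (inf_le_left : V ⊓ U i ≤ V)).op t) : s = t :=
  TopCat.Sheaf.eq_of_locally_eq' X.sheaf (fun i ↦ V ⊓ U i) V (fun i ↦ homOfLE inf_le_left)
    (by rw [← inf_iSup_eq]; exact le_inf le_rfl hV) s t h

lemma dualPresheaf_isSheaf : TopCat.Presheaf.IsSheaf (X := X) (dualPresheaf M).presheaf := by
  rw [TopCat.Presheaf.isSheaf_iff_isSheafUniqueGluing]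
  intro ι U φ hφ
  replace hφ : ∀ (i j : ι) (W : X.Opens) (hi : W ≤ U i) (hj : W ≤ U j) (s : Γ(M, W)),
      dualEval (M := M) (φ i) hi s = dualEval (M := M) (φ j) hj s := fun i j W hi hj s ↦
    congr(dualEval (M := M) $(hφ i j) (le_inf hi hj) s)
  change ∀ i, dualSections M (U i) at φ
  have key : ∀ (V : X.Opens) (hV : V ≤ iSup U) (s : Γ(M, V)), ∃ r : Γ(X, V), ∀ i,
      X.presheaf.map (homOfLE (inf_le_left : V ⊓ U i ≤ V)).op r =
        dualEval (φ i) inf_le_right (M.presheaf.map (homOfLE inf_le_left).op s) := by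
    intro V hV s
    refine (TopCat.Sheaf.existsUnique_gluing' X.sheaf (fun i ↦ V ⊓ U i) V
      (fun i ↦ homOfLE inf_le_left) (by rw [← inf_iSup_eq]; exact le_inf le_rfl hV)
      (fun i ↦ dualEval (φ i) inf_le_right (M.presheaf.map (homOfLE inf_le_left).op s))
      ?_).exists
    intro i j
    have hi := dualEval_map M (φ i) (V := V ⊓ U i) (W := (V ⊓ U i) ⊓ (V ⊓ U j)) inf_le_right
      inf_le_left (M.presheaf.map (homOfLE inf_le_left).op s)
    have hj := dualEval_map M (φ j) (V := V ⊓ U j) (W := (V ⊓ U i) ⊓ (V ⊓ U j)) inf_le_right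
      inf_le_right (M.presheaf.map (homOfLE inf_le_left).op s)
    rw [map_map_mod] at hi hj
    exact hi.symm.trans ((hφ i j _ _ _ _).trans hj)
  choose g hg using key
  have hg' : ∀ (V : X.Opens) (hV : V ≤ iSup U) (s : Γ(M, V)) (i : ι) (W : X.Opens) (h : W ≤ V)
      (hW : W ≤ U i), X.presheaf.map (homOfLE h).op (g V hV s) =
        dualEval (φ i) hW (M.presheaf.map (homOfLE h).op s) := by
    intro V hV s i W h hW
    have h1 := congrArg (X.presheaf.map (homOfLE (le_inf h hW)).op) (hg V hV s i)
    rw [map_map_fun, ← dualEval_map, map_map_mod] at h1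
    exact h1
  refine ⟨(dualMk M g ?_ ?_ ?_ : dualSections M (iSup U)), ?_, ?_⟩
  · intro V hV s t
    refine eq_of_cover U hV _ _ fun i ↦ ?_
    rw [map_add, hg, hg, hg, map_add, map_add]
  · intro V hV r s
    refine eq_of_cover U hV _ _ fun i ↦ ?_
    rw [map_mul, hg, hg, Scheme.Modules.map_smul, map_smul, smul_eq_mul]
  · intro V W hV h s
    refine eq_of_cover U (h.trans hV) _ _ fun i ↦ ?_
    rw [hg, map_map_fun, hg' V hV s i _ _ inf_le_right, map_map_mod]
  · intro i
    refine dual_ext (M := M) fun V hV s ↦ ?_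
    have := hg' V (hV.trans (le_iSup U i)) s i V le_rfl hV
    have e1 : X.presheaf.map (homOfLE (le_refl V)).op = 𝟙 _ := X.presheaf.map_id _
    have e2 : M.presheaf.map (homOfLE (le_refl V)).op = 𝟙 _ := M.presheaf.map_id _
    rw [e1, e2] at this
    exact this
  · intro ψ hψ
    refine dual_ext (M := M) fun V hV s ↦ ?_
    refine eq_of_cover U hV _ _ fun i ↦ ?_
    refine Eq.trans ?_ (hg V hV s i).symm
    refine (dualEval_map M ψ hV inf_le_left s).symm.trans ?_
    exact congr(dualEval (M := M) $(hψ i) inf_le_right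
      (M.presheaf.map (homOfLE (inf_le_left : V ⊓ U i ≤ V)).op s))

/-- The dual `M^* = 𝓗om(M, 𝒪_X)` of a sheaf of modules `M`. -/
noncomputable def dual : X.Modules := ⟨dualPresheaf M, dualPresheaf_isSheaf M⟩

/-- Constructor for morphisms of sheaves of modules. -/
noncomputable def homMk {M N : X.Modules} (f : ∀ U : X.Opens, Γ(M, U) →ₗ[Γ(X, U)] Γ(N, U))
    (hf : ∀ (U V : X.Opens) (h : V ≤ U) (s : Γ(M, U)),
      f V (M.presheaf.map (homOfLE h).op s) = N.presheaf.map (homOfLE h).op (f U s)) : M ⟶ N :=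
  ⟨PresheafOfModules.homMk
    { app := fun U ↦ AddCommGrpCat.ofHom (f U.unop).toAddMonoidHom
      naturality := fun U V i ↦ by ext s; exact hf U.unop V.unop i.unop.le s }
    (fun U r m ↦ (f U.unop).map_smul r m)⟩

/-- The canonical morphism `M → M^{**}`, sending `s` to evaluation at `s`. -/
noncomputable def toBidual : M ⟶ dual (dual M) :=
  homMk (fun U ↦
    { toFun := fun s ↦ (dualMk (dual M) (fun V hV (φ : dualSections M V) ↦
        dualEval φ le_rfl (M.presheaf.map (homOfLE hV).op s))
        (fun V hV φ ψ ↦ rfl)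
        (fun V hV r φ ↦ by
          have e : X.presheaf.map (homOfLE (le_refl V)).op = 𝟙 _ := X.presheaf.map_id _
          refine (dualEval_smul (M := M) r φ le_rfl _).trans ?_
          rw [e]; rfl)
        (fun V W hV h φ ↦ by
          refine Eq.trans ?_ (dualEval_map M φ le_rfl h _)
          rw [map_map_mod]; rfl) : dualSections (dual M) U)
      map_add' := fun s t ↦ dual_ext (M := dual M) fun V hV φ ↦ by
        refine (congrArg (dualEval (M := M) φ le_rfl) (map_add _ s t)).trans (map_add _ _ _)
      map_smul' := fun r s ↦ dual_ext (M := dual M) fun V hV φ ↦ by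
        refine (congrArg (dualEval (M := M) φ le_rfl)
          (Scheme.Modules.map_smul M (homOfLE hV) r s)).trans (map_smul _ _ _) })
    (fun U V h s ↦ dual_ext (M := dual M) fun W hW φ ↦
      congrArg (dualEval (M := M) φ le_rfl) (map_map_mod h hW s))

lemma toBidual_eval {U V : X.Opens} (h : V ≤ U) (s : Γ(M, U)) (φ : Γ(dual M, V)) :
    dualEval (M := dual M) ((toBidual M).app U s) h φ =
      dualEval (M := M) φ le_rfl (M.presheaf.map (homOfLE h).op s) := rfl

end Dual

section Transport

variable {X Y : Scheme.{u}}

/-- For an isomorphism of schemes `f : X → Y` and a morphism `a : N → f_* M`, the map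
`f_* M^* → N^*` sending `φ` to `s ↦ (f^♯)⁻¹ (φ (a s))`. -/
noncomputable def dualTransport (f : X ⟶ Y) [IsIso f] {M : X.Modules} {N : Y.Modules}
    (a : N ⟶ (Scheme.Modules.pushforward f).obj M) :
    (Scheme.Modules.pushforward f).obj (dual M) ⟶ dual N :=
  homMk (fun U ↦
    { toFun := fun (φ : dualSections M (f ⁻¹ᵁ U)) ↦ (dualMk N (fun V hV s ↦
        inv (f.app V) (dualEval φ (f.preimage_mono hV) (a.app V s)))
        (fun V hV s t ↦ by
          rw [map_add]
          refine (congrArg (inv (f.app V)) (map_add (dualEval φ (f.preimage_mono hV)) _ _)).trans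
            (map_add _ _ _))
        (fun V hV r s ↦ by
          rw [Scheme.Modules.Hom.app_smul]
          refine (congrArg (inv (f.app V))
            ((dualEval φ (f.preimage_mono hV)).map_smul (f.app V r) _)).trans ?_
          rw [smul_eq_mul, map_mul]
          congr 1
          exact congr($(IsIso.hom_inv_id (f.app V)) r))
        (fun V W hV h s ↦ by
          have h1 : a.app W (N.presheaf.map (homOfLE h).op s) =
            M.presheaf.map (homOfLE (f.preimage_mono h)).op (a.app V s) :=
              congr($(a.mapPresheaf.naturality (homOfLE h).op) s)
          rw [h1]
          refine (congrArg (inv (f.app W)) (dualEval_map M φ (f.preimage_mono hV)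
            (f.preimage_mono h) _)).trans ?_
          have h2 : inv (f.app V) ≫ Y.presheaf.map (homOfLE h).op =
              X.presheaf.map (homOfLE (f.preimage_mono h)).op ≫ inv (f.app W) := by
            rw [IsIso.inv_comp_eq, ← Category.assoc, IsIso.eq_comp_inv]
            exact f.naturality _
          exact congr($h2 _).symm) : dualSections N U)
      map_add' := fun φ ψ ↦ dual_ext (M := N) fun V hV s ↦
        map_add (inv (f.app V)).hom _ _
      map_smul' := fun r φ ↦ dual_ext (M := N) fun V hV s ↦ by
        refine (congrArg (inv (f.app V)) (dualEval_smul (M := M) (f.app U r) φ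
          (f.preimage_mono hV) (a.app V s))).trans ?_
        rw [map_mul]
        refine congrArg₂ (· * ·) ?_ rfl
        have h2 : Y.presheaf.map (homOfLE hV).op ≫ f.app V =
            f.app U ≫ X.presheaf.map (homOfLE (f.preimage_mono hV)).op := f.naturality _
        rw [← IsIso.eq_comp_inv, Category.assoc] at h2
        exact congr($h2 r).symm })
    (fun U V h s ↦ rfl)

lemma dualTransport_eval (f : X ⟶ Y) [IsIso f] {M : X.Modules} {N : Y.Modules}
    (a : N ⟶ (Scheme.Modules.pushforward f).obj M) {U V : Y.Opens} (h : V ≤ U)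
    (φ : dualSections M (f ⁻¹ᵁ U)) (s : Γ(N, V)) :
    dualEval (M := N) ((dualTransport f a).app U φ) h s =
      inv (f.app V) (dualEval φ (f.preimage_mono h) (a.app V s)) := rfl

/-- For an isomorphism of schemes `e : X ≅ Y` and an isomorphism `a : N → e_* M`, the pullback map
`e^* : Γ(Y, N^{**}) → Γ(X, M^{**})`. -/
noncomputable def bidualPullback (e : X ≅ Y) {M : X.Modules} {N : Y.Modules}
    (a : N ⟶ (Scheme.Modules.pushforward e.hom).obj M) :
    Γ(dual (dual N), ⊤) ⟶ Γ(dual (dual M), ⊤) :=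
  letI b : dual M ⟶ (Scheme.Modules.pushforward e.inv).obj (dual N) :=
    (Scheme.Modules.pushforwardId X).inv.app (dual M) ≫
      (Scheme.Modules.pushforwardCongr e.hom_inv_id.symm).hom.app (dual M) ≫
      (Scheme.Modules.pushforwardComp e.hom e.inv).inv.app (dual M) ≫
      (Scheme.Modules.pushforward e.inv).map (dualTransport e.hom a)
  (dualTransport e.inv b).app ⊤


end Transport

section Dual

end Dual

section Forms

variable {k : Type u} [Field k]

/-- The structure map `k → Γ(X, U)` of a `k`-scheme. -/
noncomputable def structureMap {X : Scheme.{u}} (a : X ⟶ Spec (.of k)) (U : X.Opens) :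
    CommRingCat.of k ⟶ Γ(X, U) :=
  (Scheme.ΓSpecIso (.of k)).inv ≫ a.appTop ≫ X.presheaf.map (homOfLE le_top).op

lemma structureMap_map {X : Scheme.{u}} (a : X ⟶ Spec (.of k)) {U V : X.Opens} (h : V ≤ U) :
    structureMap a U ≫ X.presheaf.map (homOfLE h).op = structureMap a V := by
  simp only [structureMap, Category.assoc, ← Functor.map_comp]; rfl

lemma structureMap_app {X Y : Scheme.{u}} {a : X ⟶ Spec (.of k)} {b : Y ⟶ Spec (.of k)}
    (f : Y ⟶ X) (h : f ≫ a = b) (U : X.Opens) :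
    structureMap a U ≫ f.app U = structureMap b (f ⁻¹ᵁ U) := by
  subst h
  simp only [structureMap, Category.assoc, Scheme.Hom.comp_appTop]
  erw [f.naturality]
  rfl

/-- For a commutative triangle `k → A → B`, the map `Ω_{A/k} → Ω_{B/k}`, `d x ↦ d (φ x)`. -/
noncomputable def kaehlerMap {A B : CommRingCat.{u}} {i : CommRingCat.of k ⟶ A}
    {j : CommRingCat.of k ⟶ B} (φ : A ⟶ B) (h : i ≫ φ = j) :
    CommRingCat.KaehlerDifferential i →ₛₗ[φ.hom] CommRingCat.KaehlerDifferential j :=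
  letI F := CommRingCat.KaehlerDifferential.map (f := i) (f' := j) (g := 𝟙 _) (g' := φ)
    (by simp [h])
  { toFun := fun x ↦ F x
    map_add' := map_add F.hom
    map_smul' := F.hom.map_smul }

lemma kaehlerMap_d {A B : CommRingCat.{u}} {i : CommRingCat.of k ⟶ A}
    {j : CommRingCat.of k ⟶ B} (φ : A ⟶ B) (h : i ≫ φ = j) (x : A) :
    kaehlerMap φ h (CommRingCat.KaehlerDifferential.d x) =
      CommRingCat.KaehlerDifferential.d (φ x) :=
  CommRingCat.KaehlerDifferential.map_d (f := i) (f' := j) (g := 𝟙 _) (g' := φ)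
    (by simp [h]) x

lemma kaehler_ext {A : CommRingCat.{u}} {i : CommRingCat.of k ⟶ A} {C N : Type*} [CommRing C]
    [AddCommGroup N] [Module C N] {σ : A →+* C}
    {f g : CommRingCat.KaehlerDifferential i →ₛₗ[σ] N}
    (h : ∀ x, f (CommRingCat.KaehlerDifferential.d x) =
      g (CommRingCat.KaehlerDifferential.d x)) : f = g := by
  let := i.hom.toAlgebra
  refine LinearMap.ext_on_range (v := fun x ↦ CommRingCat.KaehlerDifferential.d x) ?_ h
  exact KaehlerDifferential.span_range_derivation k A

/-- For a commutative triangle `k → A → B`, the map `Ω^p_{A/k} → Ω^p_{B/k}`. -/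
noncomputable def formsMap (p : ℕ) {A B : CommRingCat.{u}} {i : CommRingCat.of k ⟶ A}
    {j : CommRingCat.of k ⟶ B} (φ : A ⟶ B) (h : i ≫ φ = j) :
    ⋀[A]^p (CommRingCat.KaehlerDifferential i) →ₛₗ[φ.hom]
      ⋀[B]^p (CommRingCat.KaehlerDifferential j) :=
  extMap p (kaehlerMap φ h)

lemma formsMap_id (p : ℕ) {A : CommRingCat.{u}} {i : CommRingCat.of k ⟶ A} (φ : A ⟶ A)
    (h : i ≫ φ = i) (hφ : φ = 𝟙 A) (x) : formsMap p φ h x = x := by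
  subst hφ
  have : kaehlerMap (𝟙 A) h = LinearMap.id := kaehler_ext fun x ↦ by rw [kaehlerMap_d]; rfl
  rw [formsMap, this]
  exact extMap_id p x

lemma formsMap_comp (p : ℕ) {A B C : CommRingCat.{u}} {i : CommRingCat.of k ⟶ A}
    {j : CommRingCat.of k ⟶ B} {l : CommRingCat.of k ⟶ C} (φ : A ⟶ B) (h : i ≫ φ = j)
    (ψ : B ⟶ C) (h' : j ≫ ψ = l) (χ : A ⟶ C) (h'' : i ≫ χ = l) (e : φ ≫ ψ = χ) (x) :
    formsMap p χ h'' x = formsMap p ψ h' (formsMap p φ h x) := by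
  subst e
  have : RingHomCompTriple φ.hom ψ.hom (φ ≫ ψ).hom := ⟨rfl⟩
  have e : kaehlerMap (φ ≫ ψ) h'' = (kaehlerMap ψ h').comp (kaehlerMap φ h) :=
    kaehler_ext fun x ↦ by
      rw [kaehlerMap_d, LinearMap.comp_apply, kaehlerMap_d, kaehlerMap_d]; rfl
  rw [formsMap, e]
  exact extMap_comp p (kaehlerMap φ h) (kaehlerMap ψ h') x

/-- The presheaf of modules `U ↦ ⋀^p Ω_{Γ(X, U)/k}` on a `k`-scheme `X`. -/
noncomputable def formsPresheaf {X : Scheme.{u}} (a : X ⟶ Spec (.of k)) (p : ℕ) :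
    X.PresheafOfModules :=
  presheafMk (fun U ↦ ⋀[Γ(X, U)]^p (CommRingCat.KaehlerDifferential (structureMap a U)))
    (fun _ _ h ↦ formsMap p (X.presheaf.map (homOfLE h).op) (structureMap_map a h))
    (fun U x ↦ formsMap_id p _ _ (X.presheaf.map_id (op U)) x)
    (fun _ _ _ h h' x ↦ formsMap_comp p _ _ _ _ _ _
      (X.presheaf.map_comp (homOfLE h).op (homOfLE h').op).symm x)

/-- The sheaf of modules associated with a presheaf of modules. -/
noncomputable def sheafify {X : Scheme.{u}} (P : X.PresheafOfModules) : X.Modules :=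
  (PresheafOfModules.sheafification (𝟙 X.ringCatSheaf.obj)).obj P

/-- The canonical map from a presheaf of modules to its associated sheaf, on sections. -/
noncomputable def toSheafify {X : Scheme.{u}} (P : X.PresheafOfModules) :
    P ⟶ (sheafify P).val :=
  (PresheafOfModules.sheafificationAdjunction (𝟙 X.ringCatSheaf.obj)).unit.app P

/-- The sheaf `Ω^p_X` of `p`-forms on a `k`-scheme `X`. -/
noncomputable def forms {X : Scheme.{u}} (a : X ⟶ Spec (.of k)) (p : ℕ) : X.Modules :=
  sheafify (formsPresheaf a p)

/-- A morphism from a presheaf of modules to a sheaf of modules factors through the sheafification.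
-/
noncomputable def sheafifyDesc {X : Scheme.{u}} {P : X.PresheafOfModules} {M : X.Modules}
    (f : P ⟶ M.val) : sheafify P ⟶ M :=
  ((PresheafOfModules.sheafificationAdjunction (𝟙 X.ringCatSheaf.obj)).homEquiv P M).symm f

/-- The pullback of differential forms `Ω^p_X → f_* Ω^p_Y` along a morphism of `k`-schemes
`f : Y → X`, induced by the maps `Ω^p_{Γ(X, U)/k} → Ω^p_{Γ(Y, f⁻¹ U)/k}`. -/
noncomputable def formsPullback {X Y : Scheme.{u}} {a : X ⟶ Spec (.of k)} {b : Y ⟶ Spec (.of k)}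
    (f : Y ⟶ X) (h : f ≫ a = b) (p : ℕ) :
    forms a p ⟶ (Scheme.Modules.pushforward f).obj (forms b p) :=
  sheafifyDesc (PresheafOfModules.homMk
    { app := fun U ↦ AddCommGrpCat.ofHom (AddMonoidHom.mk'
        (fun x ↦ (toSheafify (formsPresheaf b p)).app (op (f ⁻¹ᵁ U.unop))
          (formsMap p (f.app U.unop) (structureMap_app f h U.unop) x))
        (fun x y ↦ (congrArg ((toSheafify (formsPresheaf b p)).app (op (f ⁻¹ᵁ U.unop)))
          (map_add (formsMap p (f.app U.unop) (structureMap_app f h U.unop)) x y)).trans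
          (map_add ((toSheafify (formsPresheaf b p)).app (op (f ⁻¹ᵁ U.unop))).hom _ _)))
      naturality := fun U V i ↦ by
        ext x
        refine Eq.trans ?_ (PresheafOfModules.naturality_apply (toSheafify (formsPresheaf b p))
          (homOfLE (f.preimage_mono i.unop.le)).op
          (formsMap p (f.app U.unop) (structureMap_app f h U.unop) x))
        refine congrArg ((toSheafify (formsPresheaf b p)).app (op (f ⁻¹ᵁ V.unop))) ?_
        exact (formsMap_comp p _ (structureMap_map a i.unop.le) _ (structureMap_app f h V.unop)
          (X.presheaf.map i ≫ f.app V.unop)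
          (by rw [← Category.assoc]; erw [structureMap_map a i.unop.le]
              exact structureMap_app f h V.unop) rfl x).symm.trans
          (formsMap_comp p _ (structureMap_app f h U.unop) _
            (structureMap_map b (f.preimage_mono i.unop.le))
            (X.presheaf.map i ≫ f.app V.unop) _ (f.naturality i).symm x) }
    (fun U r m ↦ by
      refine (congrArg ((toSheafify (formsPresheaf b p)).app (op (f ⁻¹ᵁ U.unop)))
        ((formsMap p (f.app U.unop) (structureMap_app f h U.unop)).map_smulₛₗ r m)).trans ?_
      exact ((toSheafify (formsPresheaf b p)).app (op (f ⁻¹ᵁ U.unop))).hom.map_smul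
        (f.app U.unop r) _))

end Forms

section Normalization

/-- A scheme is normal if all its local rings are integrally closed domains. -/
class IsNormalScheme (X : Scheme.{u}) : Prop where
  isDomain_stalk (x : X) : IsDomain (X.presheaf.stalk x)
  isIntegrallyClosed_stalk (x : X) : IsIntegrallyClosed (X.presheaf.stalk x)

variable (X : Scheme.{u}) [IsIntegral X] (L : Type u) [Field L] [Algebra X.functionField L]

/-- The morphism `Spec L → X` given by an extension `L` of the function field of `X`. -/
noncomputable def fromSpecExt : Spec (.of L) ⟶ X :=
  Spec.map (CommRingCat.ofHom (algebraMap X.functionField L)) ≫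
    X.fromSpecStalk (genericPoint X)

instance quasiCompact_fromSpecExt : QuasiCompact (fromSpecExt X L) where
  isCompact_preimage U _ _ := by
    have : Subsingleton (Spec (.of L)) :=
      inferInstanceAs (Subsingleton (PrimeSpectrum L))
    exact (Set.toFinite _).isCompact

instance quasiSeparated_fromSpecExt : QuasiSeparated (fromSpecExt X L) := inferInstance

/-- The normalization of `X` in the extension `L` of its function field. -/
noncomputable abbrev normalizationIn : Scheme.{u} := (fromSpecExt X L).normalization

/-- The normalization morphism. -/
noncomputable abbrev normalizationInHom : normalizationIn X L ⟶ X :=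
  (fromSpecExt X L).fromNormalization

/-- The morphism `Spec L → X_L`. -/
noncomputable abbrev toNormalizationIn : Spec (.of L) ⟶ normalizationIn X L :=
  (fromSpecExt X L).toNormalization

variable {L} in
lemma specMap_fromSpecExt (g : L ≃ₐ[X.functionField] L) :
    Spec.map (CommRingCat.ofHom (g : L →+* L)) ≫ fromSpecExt X L = fromSpecExt X L := by
  rw [fromSpecExt, ← Spec.map_comp_assoc, ← CommRingCat.ofHom_comp]
  congr 3
  ext x
  exact g.commutes x

variable {L} in
/-- The endomorphism of the normalization of `X` in `L` induced by an automorphism of `L` over the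
function field of `X`. -/
noncomputable def galoisHom (g : L ≃ₐ[X.functionField] L) :
    normalizationIn X L ⟶ normalizationIn X L :=
  (fromSpecExt X L).normalizationDesc
    (Spec.map (CommRingCat.ofHom (g : L →+* L)) ≫ (fromSpecExt X L).toNormalization)
    (fromSpecExt X L).fromNormalization
    (by rw [Category.assoc, Scheme.Hom.toNormalization_fromNormalization, specMap_fromSpecExt])

lemma galoisHom_comp_hom (g : L ≃ₐ[X.functionField] L) :
    galoisHom X g ≫ normalizationInHom X L = normalizationInHom X L :=
  Scheme.Hom.normalizationDesc_comp ..

lemma toNormalizationIn_galoisHom (g : L ≃ₐ[X.functionField] L) :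
    toNormalizationIn X L ≫ galoisHom X g =
      Spec.map (CommRingCat.ofHom (g : L →+* L)) ≫ toNormalizationIn X L :=
  Scheme.Hom.toNormalization_normalizationDesc ..

lemma galoisHom_comp_symm (g : L ≃ₐ[X.functionField] L) :
    galoisHom X g ≫ galoisHom X g.symm = 𝟙 _ := by
  refine Scheme.Hom.normalization.hom_ext (fromSpecExt X L) _ _ (normalizationInHom X L) ?_ ?_ ?_
  · change toNormalizationIn X L ≫ _ = toNormalizationIn X L ≫ 𝟙 _
    rw [← Category.assoc, toNormalizationIn_galoisHom, Category.assoc, toNormalizationIn_galoisHom,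
      ← Spec.map_comp_assoc, ← CommRingCat.ofHom_comp, Category.comp_id]
    have : (g : L →+* L).comp (g.symm : L →+* L) = RingHom.id L := by
      ext x; exact g.apply_symm_apply x
    rw [this]
    erw [Spec.map_id, Category.id_comp]
  · rw [Category.assoc, galoisHom_comp_hom, galoisHom_comp_hom]
  · exact Category.id_comp _

variable {L} in
/-- The automorphism of the normalization of `X` in `L` induced by an automorphism of `L` over the
function field of `X`. -/
noncomputable def galoisIso (g : L ≃ₐ[X.functionField] L) :
    normalizationIn X L ≅ normalizationIn X L where
  hom := galoisHom X g
  inv := galoisHom X g.symm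
  hom_inv_id := galoisHom_comp_symm X L g
  inv_hom_id := galoisHom_comp_symm X L g.symm

end Normalization

/-- A morphism `π : W → X` is tamely ramified in codimension one if, for every point `w` of `W` above
a point `x` of codimension one of `X`, the maximal ideal of `𝒪_{X,x}` generates a power `𝔪_w ^ e` of
the maximal ideal of `𝒪_{W,w}` whose exponent `e` is invertible in the residue field of `w`, and the
extension of residue fields at `w` is separable. -/
def IsTamelyRamified {X W : Scheme.{u}} (π : W ⟶ X) : Prop :=
  ∀ w : W, ringKrullDim (X.presheaf.stalk (π w)) = 1 →
    (∃ e : ℕ, (e : W.residueField w) ≠ 0 ∧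
      (IsLocalRing.maximalIdeal (X.presheaf.stalk (π w))).map (π.stalkMap w).hom =
        IsLocalRing.maximalIdeal (W.presheaf.stalk w) ^ e) ∧
    letI := (π.residueFieldMap w).hom.toAlgebra
    Algebra.IsSeparable (X.residueField (π w)) (W.residueField w)

section Zariski

variable {k : Type u} [Field k]

/-- The bidual `(Ω^p_X)^{**}` of the sheaf of `p`-forms on a `k`-scheme. -/
noncomputable def formsBidual {X : Scheme.{u}} (a : X ⟶ Spec (.of k)) (p : ℕ) : X.Modules :=
  dual (dual (forms a p))

/-- A morphism `(Ω^p_X)^{**} → f_* (Ω^p_Y)^{**}` extends the pullback of forms if it makes the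
square with the canonical maps to the biduals commute. -/
def ExtendsPullback {X Y : Scheme.{u}} {a : X ⟶ Spec (.of k)} {b : Y ⟶ Spec (.of k)}
    (f : Y ⟶ X) (h : f ≫ a = b) (p : ℕ)
    (α : formsBidual a p ⟶ (Scheme.Modules.pushforward f).obj (formsBidual b p)) : Prop :=
  toBidual (forms a p) ≫ α =
    formsPullback f h p ≫ (Scheme.Modules.pushforward f).map (toBidual (forms b p))

variable {X : Scheme.{u}} [IsIntegral X] (a : X ⟶ Spec (.of k))
  {L : Type u} [Field L] [Algebra X.functionField L]

/-- The action `g^*` of an automorphism `g` of `L` over the function field of `X` on the global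
sections of `(Ω^p_W)^{**}`, where `W` is the normalization of `X` in `L`. -/
noncomputable def galoisPullback (p : ℕ) (g : L ≃ₐ[X.functionField] L) :
    Γ(formsBidual (normalizationInHom X L ≫ a) p, ⊤) ⟶
      Γ(formsBidual (normalizationInHom X L ≫ a) p, ⊤) :=
  bidualPullback (galoisIso X g) (formsPullback (galoisHom X g)
    (by rw [← Category.assoc, galoisHom_comp_hom]) p)

end Zariski

end ZariskiForms

open ZariskiForms

/-! Everything takes place inside finite-dimensional spaces of rational forms. Let `X` be integral
and locally of finite type over `k`, with function field `K`. A section of the bidual over a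
nonempty open has a generic value in `⋀^p Ω_K`, and this value determines it (`bidualEv_injective`).
If `X` is normal, the values that occur over `U` are the rational forms that lie, at every point `x
∈ U` of codimension one, in the lattice spanned over `𝒪_x` by the forms `dx₁ ∧ ⋯ ∧ dxₚ` with `xᵢ ∈
𝒪_x` (`mem_range_bidualEv`). Two facts give this: `𝒪_x` is a discrete valuation ring, over which a
finitely generated spanning lattice equals its double dual (`mem_of_forall_dual`); and a rational
function regular in codimension one is regular (`mem_stalkSubring_of_codimOne`).

The morphism `π` is integral and `X` is normal, so a point of `W` has codimension one exactly when
its image has (`isCodimOne_iff`). Pullback of rational forms therefore preserves regularity in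
codimension one, which gives `α`. It is unique because every section of the bidual is an honest form
on some nonempty open. As `L/K` is finite separable, a `K`-basis of the rational forms on `X`
becomes an `L`-basis of those on `W`. This gives injectivity, and also Galois descent by
coordinates: an invariant rational form on `W` comes from a rational form `v` on `X`
(`exists_of_fixed`).

What remains is that `v` is regular at `x` when its pullback is regular at a point `w` above `x`;
this is where tameness enters. Let `A = 𝒪_x`, `B = 𝒪_w` have uniformizers `s`, `t`, with `s = t^e u`
and `u` a unit. By separability of the residue extension and Nakayama, the differentials of `B` are
generated by those of `A` and by `dt` (`span_derivation_le`). Since `e` is a unit, the expansion of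
`ds` shows that `t^(e-1) dt` is a `B`-combination of differentials of `A` (`tame_uniformizer`). A
wedge contains `dt` at most once, so the same power `t^(e-1)` carries the `p`-forms of `B` into the
`B`-span of those of `A`, for every `p` (`smul_ιMulti_mem`). Hence, in a basis of the lattice of
`A`, each coordinate `c` of `v` satisfies `t^(e-1) c ∈ B`. If `c` were not in `A`, it would have a
pole of order at least one in `s`, so at least `e` in `t`, a contradiction (`tame_descent`). -/

namespace ZariskiForms

/-! ### Lattices of differential forms over a subring of a field -/

section Lattice

/-- Multilinear expansion, one argument at a time: the induction runs over the set `J` of positions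
whose entries are not yet known to lie in `S` itself. -/
lemma MultilinearMap_mem_span {ι R M N : Type*} [Finite ι] [CommRing R]
    [AddCommGroup M] [Module R M] [AddCommGroup N] [Module R N]
    (f : MultilinearMap R (fun _ : ι ↦ M) N) (S : Set M) (y : ι → M)
    (hy : ∀ i, y i ∈ Submodule.span R S) :
    f y ∈ Submodule.span R (f '' {s | ∀ i, s i ∈ S}) := by
  classical
  have := Fintype.ofFinite ι
  suffices H : ∀ (J : Finset ι) (y : ι → M), (∀ i ∈ J, y i ∈ Submodule.span R S) →
      (∀ i ∉ J, y i ∈ S) → f y ∈ Submodule.span R (f '' {s | ∀ i, s i ∈ S}) from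
    H Finset.univ y (fun i _ ↦ hy i) (by simp)
  intro J
  induction J using Finset.induction_on with
  | empty => exact fun y _ hy ↦ Submodule.subset_span ⟨y, fun i ↦ hy i (by simp), rfl⟩
  | insert a J ha ih =>
    intro y h1 h2
    rw [← Function.update_eq_self a y]
    have := h1 a (by simp)
    generalize y a = z at this
    induction this using Submodule.span_induction with
    | mem z hz =>
      refine ih _ (fun i hi ↦ ?_) (fun i hi ↦ ?_)
      · have : i ≠ a := by rintro rfl; exact ha hi
        rw [Function.update_of_ne this]
        exact h1 i (by simp [hi])
      · by_cases h : i = a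
        · subst h; simpa
        · rw [Function.update_of_ne h]
          exact h2 i (by simp [h, hi])
    | zero => simp [MultilinearMap.map_update_zero]
    | add x z _ _ hx hz => rw [MultilinearMap.map_update_add]; exact add_mem hx hz
    | smul r x _ hx => rw [MultilinearMap.map_update_smul]; exact Submodule.smul_mem _ _ hx

variable {K Ω : Type*} [Field K] [AddCommGroup Ω] [Module K Ω]

lemma ιMulti_mem_span (p : ℕ) (O : Subring K) (S : Set Ω) (y : Fin p → Ω)
    (hy : ∀ i, y i ∈ Submodule.span O S) :
    exteriorPower.ιMulti K p y ∈
      Submodule.span O (exteriorPower.ιMulti K p '' {s | ∀ i, s i ∈ S}) :=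
  MultilinearMap_mem_span
    ((exteriorPower.ιMulti K p (M := Ω)).toMultilinearMap.restrictScalars O) S y hy

variable (D : Derivation ℤ K Ω)

/-- The lattice of `p`-forms of a subring `O` of `K`: the `O`-span of the forms
`D x₁ ∧ ⋯ ∧ D xₚ` with `xᵢ ∈ O`. -/
def formsLattice (p : ℕ) (O : Subring K) : Submodule O (⋀[K]^p Ω) :=
  Submodule.span O (exteriorPower.ιMulti K p '' {s | ∀ i, s i ∈ D '' O})

lemma ιMulti_mem_formsLattice {p : ℕ} {O : Subring K} {x : Fin p → K} (hx : ∀ i, x i ∈ O) :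
    exteriorPower.ιMulti K p (fun i ↦ D (x i)) ∈ formsLattice D p O :=
  Submodule.subset_span ⟨_, fun i ↦ ⟨x i, hx i, rfl⟩, rfl⟩

/-- Replaces the infinitely many generators by wedges of the differentials of `T`. A finite `T`
gives finite generation, and one `T` that works for all points near `x` lets regularity spread from
`x` to a neighbourhood. -/
lemma formsLattice_eq_span (p : ℕ) (O : Subring K) (T : Set K) (hT : T ⊆ O)
    (h : ∀ x ∈ O, D x ∈ Submodule.span O (D '' T)) :
    formsLattice D p O =
      Submodule.span O (exteriorPower.ιMulti K p '' {s | ∀ i, s i ∈ D '' T}) := by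
  apply le_antisymm
  · rw [formsLattice, Submodule.span_le]
    rintro _ ⟨s, hs, rfl⟩
    refine ιMulti_mem_span p O _ s fun i ↦ ?_
    obtain ⟨x, hx, hx'⟩ := hs i
    exact hx' ▸ h x hx
  · exact Submodule.span_mono (Set.image_mono fun s hs i ↦ Set.image_mono hT (hs i))

lemma formsLattice_fg (p : ℕ) (O : Subring K) (T : Set K) (hT : T ⊆ O) (hfin : T.Finite)
    (h : ∀ x ∈ O, D x ∈ Submodule.span O (D '' T)) : (formsLattice D p O).FG := by
  rw [formsLattice_eq_span D p O T hT h]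
  refine Submodule.fg_span (Set.Finite.image _ ?_)
  exact Set.Finite.pi' fun _ ↦ hfin.image _

lemma derivation_div (a b : K) : D (a / b) = (b ^ 2)⁻¹ • (b • D a - a • D b) := by
  by_cases hb : b = 0
  -- For `b = 0` both sides vanish under the convention `a / 0 = 0`, so the quotient rule needs no
  -- hypothesis.
  · simp [hb]
  have h : D a = b • D (a / b) + (a / b) • D b := by
    rw [← D.leibniz, mul_div_cancel₀ _ hb]
  rw [h, smul_add, smul_smul, smul_smul, mul_div_cancel₀ _ hb, add_sub_cancel_right, smul_smul,
    ← sq, inv_mul_cancel₀ (pow_ne_zero 2 hb), one_smul]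

/-- The differentials of a localization `O` of a ring generated by `C` and `T`, where `D` vanishes
on `C`, are generated by the differentials of the elements of `T`. -/
lemma derivation_mem_span (O : Subring K) (C T : Set K) (hT : T ⊆ O) (hC : C ⊆ O)
    (hDC : ∀ c ∈ C, D c = 0)
    (hloc : ∀ x ∈ O, ∃ a ∈ Subring.closure (C ∪ T), ∃ b ∈ Subring.closure (C ∪ T),
      b⁻¹ ∈ O ∧ x = a / b) (x : K) (hx : x ∈ O) : D x ∈ Submodule.span O (D '' T) := by
  have hle : Subring.closure (C ∪ T) ≤ O := Subring.closure_le.2 (Set.union_subset hC hT)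
  have hsm : ∀ a ∈ O, ∀ m ∈ Submodule.span O (D '' T), a • m ∈ Submodule.span O (D '' T) :=
    fun a ha m hm ↦ Submodule.smul_mem _ (⟨a, ha⟩ : O) hm
  have key : ∀ a ∈ Subring.closure (C ∪ T), D a ∈ Submodule.span O (D '' T) := by
    intro a ha
    induction ha using Subring.closure_induction with
    | mem a ha =>
      rcases ha with ha | ha
      · rw [hDC a ha]; exact zero_mem _
      · exact Submodule.subset_span ⟨a, ha, rfl⟩
    | zero => simp
    | one => simp
    | add a b _ _ ha hb => rw [map_add]; exact add_mem ha hb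
    | neg a _ ha => rw [map_neg]; exact neg_mem ha
    | mul a b ha' hb' ha hb =>
      rw [D.leibniz]
      exact add_mem (hsm _ (hle ha') _ hb) (hsm _ (hle hb') _ ha)
  obtain ⟨a, ha, b, hb, hbO, rfl⟩ := hloc x hx
  -- The denominator in the quotient rule is harmless because `b⁻¹` lies in `O`.
  rw [derivation_div, ← inv_pow]
  exact hsm _ (pow_mem hbO 2) _ (sub_mem (hsm _ (hle hb) _ (key a ha)) (hsm _ (hle ha) _ (key b hb)))

/-- By the quotient rule, the differential of a fraction is a `K`-combination of differentials of
elements of `O`; wedges of a spanning set span the exterior power. -/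
lemma span_formsLattice (p : ℕ) (O : Subring K) (hO : ∀ x : K, ∃ a ∈ O, ∃ b ∈ O, x = a / b)
    (hD : Submodule.span K (Set.range D) = ⊤) :
    Submodule.span K (formsLattice D p O : Set (⋀[K]^p Ω)) = ⊤ := by
  have h1 : Submodule.span K (D '' O) = ⊤ := by
    rw [eq_top_iff, ← hD, Submodule.span_le]
    rintro _ ⟨x, rfl⟩
    obtain ⟨a, ha, b, hb, rfl⟩ := hO x
    rw [derivation_div]
    have h : ∀ a ∈ O, D a ∈ Submodule.span K (D '' O) := fun a ha ↦
      Submodule.subset_span ⟨a, ha, rfl⟩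
    exact Submodule.smul_mem _ _ (sub_mem (Submodule.smul_mem _ _ (h a ha))
      (Submodule.smul_mem _ _ (h b hb)))
  rw [eq_top_iff, ← exteriorPower.ιMulti_span_of_span K p Ω h1, Submodule.span_le]
  rintro _ ⟨s, hs, rfl⟩
  exact Submodule.subset_span (Submodule.subset_span ⟨s, fun i ↦ hs ⟨i, rfl⟩, rfl⟩)

end Lattice

/-! ### Lattices over a principal ideal domain are reflexive -/

section Reflexive

variable {K V : Type*} [Field K] [AddCommGroup V] [Module K V]

/-- A finitely generated spanning lattice over a principal ideal domain has a basis. -/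
lemma exists_lattice_basis (O : Subring K) [IsPrincipalIdealRing O] [IsFractionRing O K]
    (M : Submodule O V) (hM : M.FG) (hspan : Submodule.span K (M : Set V) = ⊤) :
    ∃ (n : ℕ) (b : Module.Basis (Fin n) K V), M = Submodule.span O (Set.range b) := by
  have : Module.Finite O M := Module.Finite.iff_fg.2 hM
  have : Module.IsTorsionFree O V := .of_smul_eq_zero fun r v h ↦
    (smul_eq_zero.1 (show (r : K) • v = 0 from h)).imp_left Subtype.ext
  obtain ⟨n, c⟩ := Module.basisOfFiniteTypeTorsionFree' (R := O) (M := M)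
  have hM' : M = Submodule.span O (Set.range fun i ↦ (c i : V)) := by
    have := congr(Submodule.map M.subtype $(c.span_eq))
    rw [Submodule.map_span, Submodule.map_top, Submodule.range_subtype, ← Set.range_comp] at this
    exact this.symm
  -- Clearing denominators, independence over `O` is the same as independence over its fraction
  -- field.
  have hli : LinearIndependent K fun i ↦ (c i : V) := by
    rw [← LinearIndependent.iff_fractionRing O K]
    exact c.linearIndependent.map' M.subtype (Submodule.ker_subtype M)
  refine ⟨n, Module.Basis.mk hli ?_, by rw [Module.Basis.coe_mk]; exact hM'⟩
  rw [← hspan, Submodule.span_le]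
  exact (SetLike.coe_subset_coe.2 hM'.le).trans (Submodule.span_le_restrictScalars O K _)

/-- The coordinate functionals of a basis of `M` map `M` into `O`. Testing against them shows that
the coordinates of `v` lie in `O`. -/
lemma mem_of_forall_dual (O : Subring K) [IsPrincipalIdealRing O] [IsFractionRing O K]
    (M : Submodule O V) (hM : M.FG) (hspan : Submodule.span K (M : Set V) = ⊤) (v : V)
    (hv : ∀ f : V →ₗ[K] K, (∀ m ∈ M, f m ∈ O) → f v ∈ O) : v ∈ M := by
  obtain ⟨n, b, rfl⟩ := exists_lattice_basis O M hM hspan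
  rw [← b.sum_repr v]
  refine sum_mem fun i _ ↦ ?_
  refine Submodule.smul_mem _ (⟨b.repr v i, hv (b.coord i) fun m hm ↦ ?_⟩ : O)
    (Submodule.subset_span ⟨i, rfl⟩)
  induction hm using Submodule.span_induction with
  | mem x hx =>
    obtain ⟨j, rfl⟩ := hx
    rw [Module.Basis.coord_apply, Module.Basis.repr_self, Finsupp.single_apply]
    split_ifs
    exacts [one_mem _, zero_mem _]
  | zero => simp
  | add x y _ _ hx hy => rw [map_add]; exact add_mem hx hy
  | smul r x _ hx =>
    have : r • x = (r : K) • x := rfl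
    rw [this, map_smul]
    exact mul_mem r.2 hx

end Reflexive

end ZariskiForms

namespace ZariskiForms

/-! ### Wedges in which one extra vector may occur -/

section Wedge

variable {K Ω : Type*} [Field K] [AddCommGroup Ω] [Module K Ω]

/-- If `c • z` lies in the `O`-module `N`, then `c` multiplies the `p`-fold wedges of elements of
`N + O z` into the `p`-fold wedges of elements of `N`. -/
lemma smul_ιMulti_mem (p : ℕ) (O : Subring K) (S : Set Ω) (z : Ω) (c : K) (hc : c ∈ O)
    (hz : c • z ∈ Submodule.span O S) (y : Fin p → Ω)
    (hy : ∀ i, y i ∈ Submodule.span O S ⊔ Submodule.span O {z}) :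
    c • exteriorPower.ιMulti K p y ∈
      Submodule.span O (exteriorPower.ιMulti K p '' {s | ∀ i, s i ∈ S}) := by
  classical
  choose n hn m hm hnm using fun i ↦ Submodule.mem_sup.1 (hy i)
  choose a ha using fun i ↦ Submodule.mem_span_singleton.1 (hm i)
  have hy' : y = n + fun i ↦ (a i : K) • z := by
    funext i
    rw [← hnm i, ← ha i]; rfl
  have e := (exteriorPower.ιMulti K p (M := Ω)).toMultilinearMap.map_add_univ n
    (fun i ↦ (a i : K) • z)
  simp only [AlternatingMap.coe_multilinearMap] at e
  rw [hy', e, Finset.smul_sum]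
  -- The set `s` consists of the positions filled from `N`; the others carry multiples of `z`. Two
  -- or more of these make the wedge vanish, a single one absorbs `c`, and with none the factor `c ∈
  -- O` is harmless. So one factor `c` suffices for every `p`.
  refine sum_mem fun s _ ↦ ?_
  by_cases hs : s = Finset.univ
  · subst hs
    rw [Finset.piecewise_univ]
    exact Submodule.smul_mem _ (⟨c, hc⟩ : O) (ιMulti_mem_span p O S n hn)
  obtain ⟨i, hi⟩ : ∃ i, i ∉ s := by
    by_contra! h
    exact hs (Finset.eq_univ_iff_forall.2 h)
  by_cases h2 : ∃ j, j ∉ s ∧ j ≠ i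
  · obtain ⟨j, hj, hij⟩ := h2
    have : exteriorPower.ιMulti K p (s.piecewise n fun i ↦ (a i : K) • z) = 0 := by
      set x := s.piecewise n fun i ↦ (a i : K) • z
      have hx : x = Function.update (Function.update x i ((a i : K) • z)) j ((a j : K) • z) := by
        funext l
        by_cases hl : l = j
        · subst hl; simp [x, hj]
        · by_cases hl' : l = i
          · subst hl'; simp [x, hi, hl]
          · simp [hl, hl']
      rw [hx, AlternatingMap.map_update_smul, Function.update_comm hij.symm,
        AlternatingMap.map_update_smul, (exteriorPower.ιMulti K p).map_eq_zero_of_eq _ _ hij,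
        smul_zero, smul_zero]
      simp [hij]
    rw [this, smul_zero]
    exact zero_mem _
  · push Not at h2
    have e1 : c • exteriorPower.ιMulti K p (s.piecewise n fun i ↦ (a i : K) • z) =
        exteriorPower.ιMulti K p (Function.update n i ((a i : K) • c • z)) := by
      have : (s.piecewise n fun i ↦ (a i : K) • z) = Function.update n i ((a i : K) • z) := by
        funext j
        by_cases hj : j = i
        · subst hj; simp [hi]
        · have : j ∈ s := by by_contra h; exact hj (h2 j h)
          simp [hj, this]
      rw [this, ← AlternatingMap.map_update_smul, smul_comm]
    rw [e1]
    refine ιMulti_mem_span p O S _ fun j ↦ ?_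
    by_cases hj : j = i
    · subst hj
      rw [Function.update_self]
      exact Submodule.smul_mem _ (a j) hz
    · rw [Function.update_of_ne hj]; exact hn j

end Wedge

/-! ### Differential forms in a tamely ramified extension of local rings -/

section Tame

variable {K L Ω Ω' : Type*} [Field K] [Field L] (φ : K →+* L)
  [AddCommGroup Ω] [Module K Ω] [AddCommGroup Ω'] [Module L Ω']
  (D : Derivation ℤ K Ω) (D' : Derivation ℤ L Ω') (j : Ω →ₛₗ[φ] Ω')

/-- The chain rule: apart from `f'(b) D' b`, only the derivatives of the coefficients appear,
multiplied by powers of `b`. -/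
lemma derivation_eval₂_sub_mem (A : Subring K) (B : Subring L) (f : Polynomial A) (b : L) (hb : b ∈ B) :
    D' (f.eval₂ (φ.comp A.subtype) b) - f.derivative.eval₂ (φ.comp A.subtype) b • D' b ∈
      Submodule.span B (D' '' (φ '' A)) := by
  induction f using Polynomial.induction_on with
  | C a =>
    simp only [Polynomial.eval₂_C, Polynomial.derivative_C, Polynomial.eval₂_zero, zero_smul,
      sub_zero]
    exact Submodule.subset_span ⟨_, ⟨a, a.2, rfl⟩, rfl⟩
  | add f g hf hg =>
    simp only [Polynomial.eval₂_add, map_add, add_smul]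
    convert add_mem hf hg using 1
    abel
  | monomial n a _ =>
    simp only [Polynomial.eval₂_mul, Polynomial.eval₂_C, Polynomial.eval₂_pow, Polynomial.eval₂_X,
      Polynomial.derivative_C_mul_X_pow, D'.leibniz, D'.leibniz_pow]
    have : b ^ (n + 1) • D' (φ a) ∈ Submodule.span B (D' '' (φ '' A)) :=
      Submodule.smul_mem _ ((⟨b, hb⟩ : B) ^ (n + 1)) (Submodule.subset_span ⟨_, ⟨a, a.2, rfl⟩, rfl⟩)
    convert this using 1
    simp only [RingHom.comp_apply, Subring.subtype_apply, map_mul, map_natCast, Nat.add_sub_cancel]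
    rw [← Nat.cast_smul_eq_nsmul L, smul_smul, smul_smul]
    rw [add_comm, add_sub_assoc]
    convert add_zero _ using 2
    rw [sub_eq_zero]

/-- The differentials of a discrete valuation ring `B` that is residually separable over a subring
`A` are generated by the differentials of `A` and of a uniformizer `t`. -/
lemma span_derivation_le (A : Subring K) (B : Subring L) [IsLocalRing B] (t : L) (ht : t ∈ B) (htu : t⁻¹ ∉ B)
    (hsep : ∀ b ∈ B, ∃ f : Polynomial A, (∃ c ∈ B, f.eval₂ (φ.comp A.subtype) b = t * c) ∧
      f.derivative.eval₂ (φ.comp A.subtype) b ≠ 0 ∧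
      (f.derivative.eval₂ (φ.comp A.subtype) b)⁻¹ ∈ B)
    (hfg : (Submodule.span B (D' '' B)).FG) :
    Submodule.span B (D' '' B) ≤
      Submodule.span B (D' '' (φ '' A)) ⊔ Submodule.span B {D' t} := by
  have htm : (⟨t, ht⟩ : B) ∈ IsLocalRing.maximalIdeal B := by
    rw [IsLocalRing.mem_maximalIdeal, mem_nonunits_iff]
    rintro ⟨u, hu⟩
    have h1 : (u : L) * ((u⁻¹ : Bˣ) : B) = 1 := by
      norm_cast; simp
    rw [hu] at h1
    exact htu (eq_inv_of_mul_eq_one_right h1 ▸ ((u⁻¹ : Bˣ) : B).2)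
  -- Nakayama: it suffices to generate modulo `𝔪 · Ω_B`. For `b ∈ B` take `f` with `f(b) = t c` and
  -- `f'(b)` a unit. Then `f'(b) D' b` agrees, up to derivatives of coefficients, with `t D' c + c
  -- D' t`, and the first term lies in `𝔪 · Ω_B`.
  refine Submodule.le_of_le_smul_of_le_jacobson_bot hfg
    (IsLocalRing.maximalIdeal_le_jacobson _) ?_
  rw [Submodule.span_le]
  rintro _ ⟨b, hb, rfl⟩
  obtain ⟨f, ⟨c, hc, hfc⟩, hf0, hf⟩ := hsep b hb
  have key := derivation_eval₂_sub_mem φ D' A B f b hb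
  set w := f.derivative.eval₂ (φ.comp A.subtype) b
  set N := Submodule.span B (D' '' (φ '' A)) ⊔ Submodule.span B {D' t} ⊔
    IsLocalRing.maximalIdeal B • Submodule.span B (D' '' B)
  have h2 : D' (f.eval₂ (φ.comp A.subtype) b) ∈ N := by
    rw [hfc, D'.leibniz]
    refine add_mem ?_ ?_
    · exact Submodule.mem_sup_right (Submodule.smul_mem_smul (r := (⟨t, ht⟩ : B)) htm
        (Submodule.subset_span ⟨c, hc, rfl⟩))
    · exact Submodule.mem_sup_left (Submodule.mem_sup_right
        (Submodule.smul_mem _ (⟨c, hc⟩ : B) (Submodule.mem_span_singleton_self _)))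
  have h3 : w • D' b ∈ N := by
    have := sub_mem h2 (Submodule.mem_sup_left (Submodule.mem_sup_left key) : _ ∈ N)
    rwa [sub_sub_cancel] at this
  have h4 := Submodule.smul_mem N (⟨w⁻¹, hf⟩ : B) h3
  change w⁻¹ • w • D' b ∈ N at h4
  rwa [smul_smul, inv_mul_cancel₀ hf0, one_smul] at h4

/-- Write `D' u = n + c D' t` with `n` in the span of the differentials of `A`. Differentiating `φ s
= t^e u` gives `D' (φ s) - t^e n = e u (1 + t e⁻¹ u⁻¹ c) t^(e-1) D' t`, and the coefficient `e u (1
+ t e⁻¹ u⁻¹ c)` is a unit of `B` because `e` is one. -/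
lemma tame_uniformizer (A : Subring K) (B : Subring L)
    (t : L) (ht : t ∈ B) (htB : ∀ b ∈ B, (1 + t * b) ≠ 0 ∧ (1 + t * b)⁻¹ ∈ B) (ht0 : t ≠ 0)
    (hB : Submodule.span B (D' '' B) ≤
      Submodule.span B (D' '' (φ '' A)) ⊔ Submodule.span B {D' t})
    (e : ℕ) (he0 : (e : L) ≠ 0) (he : (e : L)⁻¹ ∈ B)
    (s : K) (hs : s ∈ A) (u : L) (hu0 : u ≠ 0) (hu : u ∈ B) (hu' : u⁻¹ ∈ B)
    (hst : φ s = t ^ e * u) :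
    t ^ (e - 1) • D' t ∈ Submodule.span B (D' '' (φ '' A)) := by
  obtain ⟨n, hn, m, hm, hnm⟩ := Submodule.mem_sup.1 (hB (Submodule.subset_span ⟨u, hu, rfl⟩))
  obtain ⟨c, rfl⟩ := Submodule.mem_span_singleton.1 hm
  -- The exponent is positive because its image in `L` is nonzero, so the truncated subtraction `e -
  -- 1` is the true one.
  have he1 : e = e - 1 + 1 := by
    rcases e with _ | e
    · simp at he0
    · simp
  have h1 : D' (φ s) ∈ Submodule.span B (D' '' (φ '' A)) :=
    Submodule.subset_span ⟨_, ⟨s, hs, rfl⟩, rfl⟩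
  have h2 : (e * u * (1 + t * ((e : L)⁻¹ * u⁻¹ * c))) • t ^ (e - 1) • D' t ∈
      Submodule.span B (D' '' (φ '' A)) := by
    have h3 := sub_mem h1 (Submodule.smul_mem _ ((⟨t, ht⟩ : B) ^ e) hn)
    change D' (φ s) - t ^ e • n ∈ _ at h3
    convert h3 using 1
    rw [hst, D'.leibniz, D'.leibniz_pow, ← hnm]
    change _ = t ^ e • (n + (c : L) • D' t) + u • e • t ^ (e - 1) • D' t - t ^ e • n
    rw [smul_add, ← Nat.cast_smul_eq_nsmul L e, add_assoc, add_sub_cancel_left]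
    simp only [smul_smul, ← add_smul]
    congr 1
    have : t ^ e = t ^ (e - 1) * t := by rw [← pow_succ, ← he1]
    rw [this]
    field_simp
    ring
  obtain ⟨h4, h5⟩ := htB _ (mul_mem (mul_mem he hu') c.2)
  have h6 := Submodule.smul_mem _ (⟨_, mul_mem (mul_mem h5 hu') he⟩ : B) h2
  change ((1 + t * ((e : L)⁻¹ * u⁻¹ * c))⁻¹ * u⁻¹ * (e : L)⁻¹) •
    (e * u * (1 + t * ((e : L)⁻¹ * u⁻¹ * c))) • t ^ (e - 1) • D' t ∈ _ at h6
  rw [smul_smul] at h6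
  convert h6 using 1
  have : (1 + t * ((e : L)⁻¹ * u⁻¹ * c))⁻¹ * u⁻¹ * (e : L)⁻¹ *
    (e * u * (1 + t * ((e : L)⁻¹ * u⁻¹ * c))) = 1 := by
    generalize 1 + t * ((e : L)⁻¹ * u⁻¹ * c) = x at *
    field_simp
  rw [this, one_smul]

/-- A semilinear map that sends some finite basis to a basis sends every basis to a basis. -/
lemma exists_basis_image {V V' : Type*} [AddCommGroup V] [Module K V] [AddCommGroup V'] [Module L V']
    (T : V →ₛₗ[φ] V') {ι ι' : Type*} [Finite ι] [Finite ι'] (b : Module.Basis ι K V)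
    (b' : Module.Basis ι L V') (hb : ∀ i, T (b i) = b' i) (c : Module.Basis ι' K V) :
    ∃ c' : Module.Basis ι' L V', ∀ i, T (c i) = c' i := by
  have := Fintype.ofFinite ι'
  have := Fintype.ofFinite ι
  -- The vectors `T (c i)` span the image of `T`, which contains the basis `b'`; since their number
  -- is the dimension, they form a basis.
  have hspan : ∀ v, T v ∈ Submodule.span L (Set.range fun i ↦ T (c i)) := by
    intro v
    rw [← c.sum_repr v, map_sum]
    refine sum_mem fun i _ ↦ ?_
    rw [map_smulₛₗ]
    exact Submodule.smul_mem _ _ (Submodule.subset_span ⟨i, rfl⟩)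
  refine ⟨basisOfTopLeSpanOfCardEqFinrank (fun i ↦ T (c i)) ?_ ?_,
    fun i ↦ by rw [coe_basisOfTopLeSpanOfCardEqFinrank]⟩
  · rw [← b'.span_eq, Submodule.span_le]
    rintro _ ⟨i, rfl⟩
    rw [← hb]
    exact hspan _
  · rw [Module.finrank_eq_card_basis b', ← Module.finrank_eq_card_basis b,
      Module.finrank_eq_card_basis c]

lemma extMap_basis {R S M N : Type*} [CommRing R] [CommRing S] [AddCommGroup M] [Module R M]
    [AddCommGroup N] [Module S N] {φ : R →+* S} (j : M →ₛₗ[φ] N) (p : ℕ) {ι : Type*} [LinearOrder ι]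
    (b : Module.Basis ι R M) (b' : Module.Basis ι S N) (hb : ∀ i, j (b i) = b' i)
    (s : Set.powersetCard ι p) :
    extMap p j (b.exteriorPower p s) = b'.exteriorPower p s := by
  rw [exteriorPower.basis_apply, exteriorPower.basis_apply]
  refine (extMap_ιMulti p j _).trans ?_
  simp only [exteriorPower.ιMulti_family, hb, Function.comp_def]

/-- Descent of regular differential forms along a tamely ramified extension `A ⊆ B` of discrete
valuation rings. -/
lemma tame_descent (hj : ∀ a, j (D a) = D' (φ a)) {ι : Type*} [Finite ι] [LinearOrder ι]
    (b : Module.Basis ι K Ω) (b' : Module.Basis ι L Ω') (hb : ∀ i, j (b i) = b' i)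
    (hD : Submodule.span K (Set.range D) = ⊤)
    (A : Subring K) [IsPrincipalIdealRing A] [IsFractionRing A K]
    (B : Subring L) [IsLocalRing B] (hAB : ∀ a ∈ A, φ a ∈ B)
    (s : K) (hs : s ∈ A) (hA : ∀ a : K, a ∉ A → ∃ c ∈ A, a⁻¹ = s * c)
    (t : L) (ht : t ∈ B) (htu : t⁻¹ ∉ B) (ht0 : t ≠ 0)
    (e : ℕ) (he0 : (e : L) ≠ 0) (he : (e : L)⁻¹ ∈ B)
    (u : L) (hu0 : u ≠ 0) (hu : u ∈ B) (hu' : u⁻¹ ∈ B) (hst : φ s = t ^ e * u)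
    (hsep : ∀ b ∈ B, ∃ f : Polynomial A, (∃ c ∈ B, f.eval₂ (φ.comp A.subtype) b = t * c) ∧
      f.derivative.eval₂ (φ.comp A.subtype) b ≠ 0 ∧
      (f.derivative.eval₂ (φ.comp A.subtype) b)⁻¹ ∈ B)
    (hfg : (Submodule.span B (D' '' B)).FG) (p : ℕ) (hfgA : (formsLattice D p A).FG)
    (v : ⋀[K]^p Ω) (hv : extMap p j v ∈ formsLattice D' p B) : v ∈ formsLattice D p A := by
  have he1 : e = e - 1 + 1 := by
    rcases e with _ | e
    · simp at he0
    · simp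
  have hle := span_derivation_le φ D' A B t ht htu hsep hfg
  -- As `t` is a non-unit of a local ring, every element `1 + t b` is a unit.
  have htB : ∀ b ∈ B, (1 + t * b) ≠ 0 ∧ (1 + t * b)⁻¹ ∈ B := by
    intro b hb
    have h1 : ¬ IsUnit (⟨t * -b, mul_mem ht (neg_mem hb)⟩ : B) := by
      rintro ⟨w, hw⟩
      have h1 : (w : L) * ((w⁻¹ : Bˣ) : B) = 1 := by
        norm_cast; simp
      rw [hw] at h1
      change t * -b * _ = 1 at h1
      rw [mul_assoc] at h1
      exact htu (eq_inv_of_mul_eq_one_right h1 ▸ mul_mem (neg_mem hb) ((w⁻¹ : Bˣ) : B).2)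
    obtain ⟨w, hw⟩ := IsLocalRing.isUnit_one_sub_self_of_mem_nonunits _ h1
    have h1 : (w : L) * ((w⁻¹ : Bˣ) : B) = 1 := by
      norm_cast; simp
    have hw' : (w : L) = 1 + t * b := by
      rw [hw]; simp [sub_eq_add_neg]
    rw [hw'] at h1
    exact ⟨left_ne_zero_of_mul_eq_one h1, eq_inv_of_mul_eq_one_right h1 ▸ ((w⁻¹ : Bˣ) : B).2⟩
  have hun := tame_uniformizer φ D' A B t ht htB ht0 hle e he0 he s hs u hu0 hu hu' hst
  obtain ⟨n, c, hc⟩ := exists_lattice_basis A (formsLattice D p A) hfgA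
    (span_formsLattice D p A (fun x ↦ by
      obtain ⟨x, y, hy, rfl⟩ := IsFractionRing.div_surjective (A := A) x
      exact ⟨x, x.2, y, y.2, rfl⟩) hD)
  obtain ⟨c', hc'⟩ := exists_basis_image φ (extMap p j) (b.exteriorPower p) (b'.exteriorPower p)
    (extMap_basis j p b b' hb) c
  -- The bound on the denominators: `t^(e-1)` carries the forms of `B` into the `B`-span of the
  -- forms of `A`, of which `c'` is a basis.
  have h1 : ∀ m ∈ formsLattice D' p B, t ^ (e - 1) • m ∈ Submodule.span B (Set.range c') := by
    intro m hm
    induction hm using Submodule.span_induction with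
    | zero => simp
    | add x y _ _ hx hy => rw [smul_add]; exact add_mem hx hy
    | smul r x _ hx => rw [smul_comm]; exact Submodule.smul_mem _ _ hx
    | mem m hm =>
      obtain ⟨y, hy, rfl⟩ := hm
      have h2 := smul_ιMulti_mem p B (D' '' (φ '' A)) (D' t) (t ^ (e - 1)) (pow_mem ht _) hun y
        (fun i ↦ hle (Submodule.subset_span (hy i)))
      refine Submodule.span_le.2 ?_ h2
      rintro _ ⟨z, hz, rfl⟩
      choose a ha ha' using hz
      choose a' ha1 ha2 using ha
      have h3 : exteriorPower.ιMulti L p z =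
          extMap p j (exteriorPower.ιMulti K p fun i ↦ D (a' i)) := by
        rw [extMap_ιMulti]
        congr 1
        funext i
        rw [hj, ha2, ha']
      rw [h3]
      have h4 := ιMulti_mem_formsLattice D ha1
      rw [hc] at h4
      generalize exteriorPower.ιMulti K p (fun i ↦ D (a' i)) = w at h4
      change _ ∈ Submodule.span B (Set.range c')
      induction h4 using Submodule.span_induction with
      | mem x hx =>
        obtain ⟨i, rfl⟩ := hx
        rw [hc']
        exact Submodule.subset_span ⟨i, rfl⟩
      | zero => simp
      | add x y _ _ hx hy => rw [map_add]; exact add_mem hx hy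
      | smul r x _ hx =>
        change extMap p j ((r : K) • x) ∈ _
        rw [map_smulₛₗ]
        exact Submodule.smul_mem _ (⟨φ r, hAB _ r.2⟩ : B) hx
  have h2 : ∀ m ∈ Submodule.span B (Set.range c'), ∀ i, c'.repr m i ∈ B := by
    intro m hm i
    induction hm using Submodule.span_induction with
    | mem x hx =>
      obtain ⟨l, rfl⟩ := hx
      rw [Module.Basis.repr_self, Finsupp.single_apply]
      split_ifs
      exacts [one_mem _, zero_mem _]
    | zero => simp
    | add x y _ _ hx hy => rw [map_add]; exact add_mem hx hy
    | smul r x _ hx =>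
      change c'.repr ((r : L) • x) i ∈ B
      rw [map_smul]
      exact mul_mem r.2 hx
  rw [hc, ← c.sum_repr v]
  refine sum_mem fun i _ ↦ Submodule.smul_mem _ (⟨c.repr v i, ?_⟩ : A)
    (Submodule.subset_span ⟨i, rfl⟩)
  have h3 : c'.repr (extMap p j v) i = φ (c.repr v i) := by
    conv_lhs => rw [← c.sum_repr v, map_sum]
    simp only [map_smulₛₗ, hc', map_sum, Finsupp.finsetSum_apply]
    simp [Finsupp.single_apply]
  have h4 := h2 _ (h1 _ hv) i
  rw [map_smul, Finsupp.smul_apply, h3, smul_eq_mul] at h4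
  -- If the coordinate were outside `A`, its inverse would be `s w` with `w ∈ A`, hence equal to
  -- `t^e u φ(w)` in `L`. Multiplying the integral element `t^(e-1) φ(c)` by `u φ(w)` then gives
  -- `t⁻¹ ∈ B`.
  by_contra hcon
  obtain ⟨w, hw, hw'⟩ := hA _ hcon
  have hne : c.repr v i ≠ 0 := fun h ↦ hcon (h ▸ zero_mem A)
  apply htu
  have h5 : t ^ (e - 1) * φ (c.repr v i) * (u * φ w) ∈ B := mul_mem h4 (mul_mem hu (hAB _ hw))
  convert h5 using 1
  have h6 : φ (c.repr v i) * (t ^ e * u * φ w) = 1 := by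
    rw [← hst, ← map_mul, ← map_mul, ← hw', mul_inv_cancel₀ hne, map_one]
  rw [he1, pow_succ] at h6
  refine inv_eq_of_mul_eq_one_right ?_
  rw [← h6]; ring

end Tame
end ZariskiForms

namespace ZariskiForms

/-! ### Torsion in exterior powers -/

section GenericWedge

/-- Passing to exterior powers preserves the property that the kernel of a localization map to a
vector space consists of torsion elements. -/
lemma exists_smul_eq_zero_of_extMap {A K M N : Type*} [CommRing A] [IsDomain A] [Field K]
    {φ : A →+* K} [AddCommGroup M] [Module A M] [AddCommGroup N] [Module K N]
    (hφ : ∀ x : K, ∃ a b, b ≠ 0 ∧ φ b * x = φ a) (hφi : Function.Injective φ)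
    (j : M →ₛₗ[φ] N) (hspan : Submodule.span K (Set.range j) = ⊤)
    (hker : ∀ m, j m = 0 → ∃ r : A, r ≠ 0 ∧ r • m = 0) (p : ℕ) (w : ⋀[A]^p M)
    (hw : extMap p j w = 0) : ∃ r : A, r ≠ 0 ∧ r • w = 0 := by
  classical
  -- Pick a basis of `N` among the values of `j` and lift it to `M`. The resulting map `F` from a
  -- free module is an isomorphism up to torsion, which reduces the claim to free modules.
  obtain ⟨S, hS, hS1, hS2⟩ := exists_linearIndependent K (Set.range j)
  choose m hm using fun s : S ↦ hS s.2
  let b : Module.Basis S K N := Module.Basis.mk hS2 (by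
    rw [Subtype.range_coe_subtype, Set.ofPred_mem_eq, hS1, hspan])
  have hb : ∀ s, b s = j (m s) := fun s ↦ by rw [Module.Basis.mk_apply, hm]
  let F : (S →₀ A) →ₗ[A] M := Finsupp.linearCombination A m
  have hF : ∀ x : M, ∃ r : A, r ≠ 0 ∧ ∃ y, r • x = F y := by
    intro x
    have h1 : ∀ v : N, ∃ r : A, r ≠ 0 ∧ ∃ y, φ r • v = j (F y) := by
      intro v
      have hv : v ∈ Submodule.span K (Set.range b) := by rw [b.span_eq]; trivial
      induction hv using Submodule.span_induction with
      | mem v hv =>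
        obtain ⟨s, rfl⟩ := hv
        exact ⟨1, one_ne_zero, Finsupp.single s 1, by simp [F, hb]⟩
      | zero => exact ⟨1, one_ne_zero, 0, by simp⟩
      | add v w _ _ hv hw =>
        obtain ⟨r, hr, y, hy⟩ := hv
        obtain ⟨r', hr', y', hy'⟩ := hw
        refine ⟨r * r', mul_ne_zero hr hr', r' • y + r • y', ?_⟩
        simp only [map_add, map_smul, map_smulₛₗ, ← hy, ← hy', map_mul, smul_add, smul_smul]
        rw [mul_comm (φ r')]
      | smul c v _ hv =>
        obtain ⟨r, hr, y, hy⟩ := hv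
        obtain ⟨a, d, hd, hc⟩ := hφ c
        refine ⟨d * r, mul_ne_zero hd hr, a • y, ?_⟩
        rw [map_smul, map_smulₛₗ, ← hy, ← hc, map_mul, smul_smul, smul_smul]
        congr 1; ring
    obtain ⟨r, hr, y, hy⟩ := h1 (j x)
    -- A multiple of `x` and the vector `F y` have the same image in `N`; the difference is torsion,
    -- so one more factor makes them equal.
    obtain ⟨r', hr', h'⟩ := hker (r • x - F y) (by rw [map_sub, map_smulₛₗ, hy, sub_self])
    refine ⟨r' * r, mul_ne_zero hr' hr, r' • y, ?_⟩
    rw [map_smul, mul_smul]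
    rwa [smul_sub, sub_eq_zero] at h'
  have hw' : ∃ r : A, r ≠ 0 ∧ ∃ y, r • w = exteriorPower.map p F y := by
    have : w ∈ Submodule.span A (Set.range (exteriorPower.ιMulti A p (M := M))) := by
      rw [exteriorPower.ιMulti_span]; trivial
    clear hw
    induction this using Submodule.span_induction with
    | mem w hw =>
      obtain ⟨x, rfl⟩ := hw
      choose r hr y hy using fun i ↦ hF (x i)
      refine ⟨∏ i, r i, Finset.prod_ne_zero_iff.2 fun i _ ↦ hr i, exteriorPower.ιMulti A p y, ?_⟩
      rw [exteriorPower.map_apply_ιMulti]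
      have := (exteriorPower.ιMulti A p (M := M)).toMultilinearMap.map_smul_univ r x
      simp only [hy] at this
      exact this.symm
    | zero => exact ⟨1, one_ne_zero, 0, by simp⟩
    | add v w _ _ hv hw =>
      obtain ⟨r, hr, y, hy⟩ := hv
      obtain ⟨r', hr', y', hy'⟩ := hw
      refine ⟨r * r', mul_ne_zero hr hr', r' • y + r • y', ?_⟩
      simp only [map_add, map_smul, ← hy, ← hy', smul_add, smul_smul]
      rw [mul_comm r']
    | smul c v _ hv =>
      obtain ⟨r, hr, y, hy⟩ := hv
      exact ⟨r, hr, c • y, by rw [map_smul, ← hy, smul_comm]⟩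
  obtain ⟨r, hr, y, hy⟩ := hw'
  refine ⟨r, hr, ?_⟩
  -- Some linear order on the index set is needed to speak of the standard basis of the exterior
  -- power; which one is irrelevant.
  let : LinearOrder S := linearOrderOfSTO (WellOrderingRel (α := S))
  let e : Module.Basis S A (S →₀ A) := Finsupp.basisSingleOne
  have hy0 : extMap p (j.comp F) y = 0 := by
    have h1 : extMap p (j.comp F) y = extMap p j (exteriorPower.map p F y) := by
      have : extMap p F = exteriorPower.map p F := ext_of_ιMulti fun x ↦ by
        rw [extMap_ιMulti, exteriorPower.map_apply_ιMulti]; rfl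
      rw [extMap_comp, this]
    rw [h1, ← hy, map_smulₛₗ, hw, smul_zero]
  -- On the free module the map carries a basis to a basis, so it is injective and `y = 0`.
  have hb' : ∀ s, extMap p (j.comp F) (e.exteriorPower p s) = b.exteriorPower p s :=
    extMap_basis (j.comp F) p e b fun i ↦ by simp [e, F, hb]
  rw [← (e.exteriorPower p).linearCombination_repr y, Finsupp.linearCombination_apply,
    Finsupp.sum, map_sum] at hy0
  simp only [map_smulₛₗ, hb'] at hy0
  have h2 := linearIndependent_iff'.1 (b.exteriorPower p).linearIndependent _ _ hy0
  have h3 : y = 0 := by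
    apply (e.exteriorPower p).repr.injective
    ext s
    rw [map_zero, Finsupp.zero_apply]
    by_cases hs : s ∈ ((e.exteriorPower p).repr y).support
    · exact hφi ((h2 s hs).trans (map_zero φ).symm)
    · simpa using hs
  rw [hy, h3, map_zero]

end GenericWedge

/-! ### Galois descent for vectors -/

section Descent

variable {K L V V' : Type*} [Field K] [Field L] {φ : K →+* L}
  [AddCommGroup V] [Module K V] [AddCommGroup V'] [Module L V']

lemma injective_of_basis_image (T : V →ₛₗ[φ] V') {ι : Type*} [Finite ι] (b : Module.Basis ι K V)
    (b' : Module.Basis ι L V') (hb : ∀ i, T (b i) = b' i) : Function.Injective T := by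
  have := Fintype.ofFinite ι
  rw [injective_iff_map_eq_zero]
  intro v hv
  rw [← b.sum_repr v, map_sum] at hv
  simp only [map_smulₛₗ, hb] at hv
  have h := Fintype.linearIndependent_iff.1 b'.linearIndependent _ hv
  apply b.repr.injective
  ext i
  simpa using φ.injective ((h i).trans (map_zero φ).symm)

/-- Galois descent for vectors. -/
lemma exists_of_fixed (T : V →ₛₗ[φ] V') {ι : Type*} [Finite ι] (b : Module.Basis ι K V)
    (b' : Module.Basis ι L V') (hb : ∀ i, T (b i) = b' i) {G : Type*} (σ : G → L →+* L)
    (S : ∀ g, V' →ₛₗ[σ g] V') (hS : ∀ g v, S g (T v) = T v)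
    (hfix : ∀ c, (∀ g, σ g c = c) → ∃ a, φ a = c) (v' : V') (hv' : ∀ g, S g v' = v') :
    ∃ v, T v = v' := by
  have := Fintype.ofFinite ι
  -- Each `S g` fixes the vectors `b' i = T (b i)`, hence acts on coordinates through `σ g`; an
  -- invariant vector has invariant coordinates.
  have h : ∀ i, ∃ a, φ a = b'.repr v' i := by
    refine fun i ↦ hfix _ fun g ↦ ?_
    have h1 : b'.repr (S g v') i = σ g (b'.repr v' i) := by
      conv_lhs => rw [← b'.sum_repr v', map_sum]
      have : ∀ i, S g (b' i) = b' i := fun i ↦ by rw [← hb, hS]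
      simp only [map_smulₛₗ, this, map_sum, Finsupp.finsetSum_apply,
        Module.Basis.repr_self, Finsupp.smul_apply, smul_eq_mul, RingHom.id_apply]
      rw [Finset.sum_eq_single i (fun l _ hl ↦ by rw [Finsupp.single_eq_of_ne hl.symm, mul_zero])
        (by simp), Finsupp.single_eq_same, mul_one]
    rw [← h1, hv']
  choose a ha using h
  refine ⟨∑ i, a i • b i, ?_⟩
  rw [map_sum, ← b'.sum_repr v']
  simp only [map_smulₛₗ, ha, hb]

end Descent

/-! ### Normal noetherian domains and primes of height one -/

section Hartogs

/-- A noetherian normal domain is the intersection of its localizations at primes of height one. -/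
lemma exists_algebraMap_eq_of_height_one {A K : Type*} [CommRing A] [IsDomain A] [IsNoetherianRing A]
    [IsIntegrallyClosed A] [Field K] [Algebra A K] [IsFractionRing A K] (c : K)
    (h : ∀ P : Ideal A, P.IsPrime → P.height = 1 → ∃ a, ∃ b ∉ P, c * algebraMap A K b = algebraMap A K a) :
    ∃ a, algebraMap A K a = c := by
  obtain ⟨a, b, hb, rfl⟩ := IsFractionRing.div_surjective (A := A) c
  have hb0 : b ≠ 0 := nonZeroDivisors.ne_zero hb
  have hinj := IsFractionRing.injective A K
  have hbK : algebraMap A K b ≠ 0 := fun h ↦ hb0 (hinj (h.trans (map_zero _).symm))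
  by_cases hab : b ∣ a
  · obtain ⟨d, rfl⟩ := hab
    exact ⟨d, by rw [map_mul, mul_div_cancel_left₀ _ hbK]⟩
  exfalso
  -- If `b` does not divide `a`, some associated prime `P = (b : y)` of `A / b` contains the
  -- annihilator of the class of `a`. It turns out to have height one, and then the hypothesis at
  -- `P` is violated.
  obtain ⟨P, hP, hle⟩ := exists_le_isAssociatedPrime_of_isNoetherianRing A
    (Ideal.Quotient.mk (Ideal.span {b}) a) (by
      rwa [Ne, Ideal.Quotient.eq_zero_iff_mem, Ideal.mem_span_singleton])
  obtain ⟨hPp, y, hy⟩ := isAssociatedPrime_iff.1 hP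
  obtain ⟨y, rfl⟩ := Ideal.Quotient.mk_surjective y
  have hP' : ∀ r, r ∈ P ↔ b ∣ r * y := fun r ↦ by
    rw [hy, Submodule.mem_colon_singleton, Submodule.mem_bot, Algebra.smul_def,
      Ideal.Quotient.algebraMap_eq, ← map_mul, Ideal.Quotient.eq_zero_iff_mem,
      Ideal.mem_span_singleton]
  have hbP : b ∈ P := (hP' b).2 (dvd_mul_right b y)
  have hyb : ¬ b ∣ y := fun h ↦ hPp.ne_top ((Ideal.eq_top_iff_one P).2 ((hP' 1).2 (by simpa using h)))
  choose! q hq using fun r (hr : r ∈ P) ↦ (hP' r).1 hr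
  -- Multiplication by `y / b` sends `r ∈ P` to `q r`. If it mapped `P` into itself, `y / b` would
  -- be integral, hence in `A`, and `b` would divide `y`.
  obtain ⟨r, hr, hrP⟩ : ∃ r ∈ P, q r ∉ P := by
    by_contra! hcon
    let N : Submodule A K := Submodule.map (Algebra.linearMap A K) P
    have hint : IsIntegral A (algebraMap A K y / algebraMap A K b) := by
      refine isIntegral_of_smul_mem_submodule N ?_ (Submodule.FG.map _ (IsNoetherian.noetherian P))
        _ ?_
      · intro h
        have : algebraMap A K b ∈ N := ⟨b, hbP, rfl⟩
        rw [h] at this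
        exact hbK this
      · rintro _ ⟨r, hr, rfl⟩
        refine ⟨q r, hcon r hr, ?_⟩
        rw [Algebra.linearMap_apply, Algebra.linearMap_apply, smul_eq_mul, div_mul_eq_mul_div,
          eq_div_iff hbK, ← map_mul, ← map_mul, mul_comm y, hq r hr, mul_comm]
    obtain ⟨d, hd⟩ := IsIntegrallyClosed.isIntegral_iff.1 hint
    rw [eq_div_iff hbK, ← map_mul] at hd
    exact hyb ⟨d, by rw [← hinj hd, mul_comm]⟩
  -- From `s * q r = r * q s` with `q r ∉ P`, a prime inside `P` that contains `r` contains every `s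
  -- ∈ P`. Krull's principal ideal theorem then bounds the height of `P`.
  have hmin : P ∈ (Ideal.span {r}).minimalPrimes := by
    refine ⟨⟨hPp, (Ideal.span_singleton_le_iff_mem P).2 hr⟩, fun Q ⟨hQ, hrQ⟩ hQP s hs ↦ ?_⟩
    have h1 : s * q r = r * q s := by
      apply mul_left_cancel₀ hb0
      linear_combination r * hq s hs - s * hq r hr
    have h2 : s * q r ∈ Q := h1 ▸ Q.mul_mem_right _ (hrQ (Ideal.mem_span_singleton_self r))
    exact (hQ.mem_or_mem h2).resolve_right fun h ↦ hrP (hQP h)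
  have hheight : P.height = 1 := by
    refine le_antisymm (Ideal.height_le_one_of_isPrincipal_of_mem_minimalPrimes _ P hmin) ?_
    rw [Order.one_le_iff_ne_zero, Ne, Ideal.height_eq_zero_iff_eq_bot]
    rintro rfl
    exact hb0 hbP
  obtain ⟨a', b', hb', hab'⟩ := h P hPp hheight
  -- The denominator `b'` provided at `P` annihilates the class of `a`, so it lies in `P`.
  refine hb' (hle ?_)
  rw [Submodule.mem_colon_singleton, Submodule.mem_bot, Algebra.smul_def,
      Ideal.Quotient.algebraMap_eq, ← map_mul, Ideal.Quotient.eq_zero_iff_mem,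
      Ideal.mem_span_singleton]
  rw [div_mul_eq_mul_div, div_eq_iff hbK, ← map_mul, ← map_mul] at hab'
  exact ⟨a', by rw [mul_comm, hinj hab', mul_comm]⟩

end Hartogs

/-! ### Kähler differentials under étale maps and localization -/

section Kaehler

variable {k : Type u} [Field k] {K L : CommRingCat.{u}} {i : CommRingCat.of k ⟶ K}
  {j : CommRingCat.of k ⟶ L}

variable (i) in
/-- The universal derivation over `k`, viewed as a derivation over `ℤ`. -/
noncomputable def kaehlerD : Derivation ℤ K (CommRingCat.KaehlerDifferential i) :=
  Derivation.mk' (AddMonoidHom.toIntLinearMap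
    (AddMonoidHom.mk' (fun x : K ↦ CommRingCat.KaehlerDifferential.d (f := i) x)
      fun a b ↦ (CommRingCat.KaehlerDifferential.D i).d_add a b))
    fun a b ↦ (CommRingCat.KaehlerDifferential.D i).d_mul a b

lemma kaehlerMap_kaehlerD (φ : K ⟶ L) (h : i ≫ φ = j) (x : K) :
    kaehlerMap φ h (kaehlerD i x) = kaehlerD j (φ x) := kaehlerMap_d φ h x

lemma kaehlerD_structure (c : k) : kaehlerD i (i c) = 0 :=
  (CommRingCat.KaehlerDifferential.D i).d_map c

variable (i) in
lemma span_kaehlerD : Submodule.span K (Set.range (kaehlerD i)) = ⊤ := by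
  let := i.hom.toAlgebra
  exact KaehlerDifferential.span_range_derivation k K

/-- For a formally étale map, the differentials of `L` are the base change of those of `K`. -/
lemma exists_basis_kaehlerMap (φ : K ⟶ L) (h : i ≫ φ = j) (hφ : φ.hom.FormallyEtale)
    {ι : Type*} (b : Module.Basis ι K (CommRingCat.KaehlerDifferential i)) :
    ∃ b' : Module.Basis ι L (CommRingCat.KaehlerDifferential j), ∀ l, kaehlerMap φ h (b l) = b' l := by
  subst h
  algebraize [i.hom, φ.hom, (i ≫ φ).hom]
  have : IsScalarTower k K L := .of_algebraMap_eq' rfl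
  have H := KaehlerDifferential.isBaseChange_of_formallyEtale k K L
  let c : Module.Basis ι K Ω[K⁄k] := b
  exact ⟨(c.baseChange L).map H.equiv, fun l ↦ (show KaehlerDifferential.map k k K L (c l) =
    (c.baseChange L).map H.equiv l by
      rw [Module.Basis.map_apply, Module.Basis.baseChange_apply, IsBaseChange.equiv_tmul,
        one_smul])⟩

/-- Differentials commute with localization, so what dies in the fraction field is torsion. -/
lemma exists_smul_eq_zero_of_kaehlerMap (φ : K ⟶ L) (h : i ≫ φ = j)
    (hφ : letI := φ.hom.toAlgebra; IsFractionRing K L) [IsDomain K]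
    (m : CommRingCat.KaehlerDifferential i) (hm : kaehlerMap φ h m = 0) :
    ∃ r : K, r ≠ 0 ∧ r • m = 0 := by
  subst h
  algebraize [i.hom, φ.hom, (i ≫ φ).hom]
  have : IsScalarTower k K L := .of_algebraMap_eq' rfl
  have := KaehlerDifferential.isLocalizedModule_map k K L (nonZeroDivisors K)
  obtain ⟨⟨r, hr⟩, h⟩ := (IsLocalizedModule.eq_zero_iff (nonZeroDivisors K)
    (KaehlerDifferential.map k k K L)).1 hm
  exact ⟨r, nonZeroDivisors.ne_zero hr, h⟩

end Kaehler
end ZariskiForms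

namespace ZariskiForms

/-! ### Local rings as subrings of the function field -/

section StalkSubring

variable {X : Scheme.{u}} [IsIntegral X]

lemma genericPoint_mem {U : X.Opens} {x : X} (hx : x ∈ U) : genericPoint X ∈ U :=
  ((genericPoint_spec X).mem_open_set_iff U.isOpen).2 ⟨x, trivial, hx⟩

lemma genericPoint_specializes' (x : X) : genericPoint X ⤳ x :=
  (genericPoint_spec X).specializes trivial

lemma eq_bot_of_genericPoint_notMem {U : X.Opens} (hU : genericPoint X ∉ U) : U = ⊥ := by
  rw [← SetLike.coe_set_eq, Opens.coe_bot, Set.eq_empty_iff_forall_notMem]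
  exact fun x hx ↦ hU (genericPoint_mem hx)

/-- The germ of a section at the generic point, as an element of the function field. -/
noncomputable abbrev ffGerm (U : X.Opens) (hU : genericPoint X ∈ U) : Γ(X, U) ⟶ X.functionField :=
  X.presheaf.germ U (genericPoint X) hU

lemma ffGerm_injective (U : X.Opens) (hU : genericPoint X ∈ U) :
    Function.Injective (ffGerm U hU) := germ_injective_of_isIntegral X _ hU

lemma ffGerm_map {U V : X.Opens} (hV : genericPoint X ∈ V) (h : V ≤ U) (s : Γ(X, U)) :
    ffGerm V hV (X.presheaf.map (homOfLE h).op s) = ffGerm U (h hV) s :=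
  X.presheaf.germ_res_apply (homOfLE h) _ hV s

/-- The local ring at `x` as a subring of the function field. -/
noncomputable def stalkSubring (x : X) : Subring X.functionField :=
  (X.presheaf.stalkSpecializes (genericPoint_specializes' x)).hom.range

lemma stalkSpecializes_germ {U : X.Opens} {x : X} (hx : x ∈ U) (s : Γ(X, U)) :
    X.presheaf.stalkSpecializes (genericPoint_specializes' x) (X.presheaf.germ U x hx s) =
      ffGerm U (genericPoint_mem hx) s :=
  congr($(X.presheaf.germ_stalkSpecializes hx (genericPoint_specializes' x)) s)

lemma ffGerm_mem_stalkSubring {U : X.Opens} {x : X} (hx : x ∈ U) (s : Γ(X, U)) :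
    ffGerm U (genericPoint_mem hx) s ∈ stalkSubring x :=
  ⟨X.presheaf.germ U x hx s, stalkSpecializes_germ hx s⟩

lemma exists_ffGerm_eq {x : X} {c : X.functionField} (hc : c ∈ stalkSubring x) :
    ∃ (U : X.Opens) (hx : x ∈ U) (s : Γ(X, U)), ffGerm U (genericPoint_mem hx) s = c := by
  obtain ⟨t, rfl⟩ := hc
  obtain ⟨U, hx, s, rfl⟩ := X.presheaf.exists_germ_eq t
  exact ⟨U, hx, s, (stalkSpecializes_germ hx s).symm⟩

/-- Local representatives of `c` have the same germ at the generic point, so they agree on overlaps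
and glue. -/
lemma exists_ffGerm_eq_of_forall_mem {U : X.Opens} (hU : genericPoint X ∈ U) {c : X.functionField}
    (hc : ∀ x ∈ U, c ∈ stalkSubring x) : ∃ s : Γ(X, U), ffGerm U hU s = c := by
  choose V hV s hs using fun x : U ↦ exists_ffGerm_eq (hc x.1 x.2)
  obtain ⟨t, ht, -⟩ := TopCat.Sheaf.existsUnique_gluing' X.sheaf (fun x : U ↦ V x ⊓ U) U
    (fun x ↦ homOfLE inf_le_right) (fun x hx ↦ Opens.mem_iSup.2 ⟨⟨x, hx⟩, hV ⟨x, hx⟩, hx⟩)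
    (fun x ↦ X.presheaf.map (homOfLE inf_le_left).op (s x)) (fun x y ↦ by
      have hm : genericPoint X ∈ (V x ⊓ U) ⊓ (V y ⊓ U) :=
        ⟨⟨genericPoint_mem (hV x), hU⟩, ⟨genericPoint_mem (hV y), hU⟩⟩
      apply ffGerm_injective _ hm
      refine ((ffGerm_map hm inf_le_left _).trans ((ffGerm_map _ inf_le_left _).trans (hs x))).trans
        ((ffGerm_map hm inf_le_right _).trans ((ffGerm_map _ inf_le_left _).trans (hs y))).symm)
  refine ⟨t, ?_⟩
  let x : U := ⟨_, hU⟩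
  have hm : genericPoint X ∈ V x ⊓ U := ⟨hV x, hU⟩
  have := congrArg (ffGerm (V x ⊓ U) hm) (ht x)
  exact (ffGerm_map hm inf_le_right t).symm.trans
    (this.trans ((ffGerm_map _ inf_le_left _).trans (hs x)))

lemma stalkSpecializes_injective (x : X) :
    Function.Injective (X.presheaf.stalkSpecializes (genericPoint_specializes' x)) :=
  IsFractionRing.injective (X.presheaf.stalk x) X.functionField

/-- The stalk at `x` is isomorphic to its image in the function field. -/
noncomputable def stalkEquiv (x : X) : X.presheaf.stalk x ≃+* stalkSubring x :=
  RingEquiv.ofBijective (X.presheaf.stalkSpecializes (genericPoint_specializes' x)).hom.rangeRestrict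
    ⟨fun _ _ h ↦ stalkSpecializes_injective x (congrArg Subtype.val h),
      RingHom.rangeRestrict_surjective _⟩

lemma coe_stalkEquiv (x : X) (c : X.presheaf.stalk x) :
    (stalkEquiv x c : X.functionField) =
      X.presheaf.stalkSpecializes (genericPoint_specializes' x) c := rfl

instance (x : X) : IsLocalRing (stalkSubring x) := (stalkEquiv x).isLocalRing

lemma inv_mem_stalkSubring {x : X} {c : X.presheaf.stalk x} (hc : IsUnit c) :
    (stalkEquiv x c : X.functionField)⁻¹ ∈ stalkSubring x := by
  obtain ⟨u, rfl⟩ := hc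
  have : (stalkEquiv x u : X.functionField) * (stalkEquiv x ((u⁻¹ : (X.presheaf.stalk x)ˣ) :
      X.presheaf.stalk x) : X.functionField) = 1 := by
    rw [← Subring.coe_mul, ← map_mul]; simp
  rw [← eq_inv_of_mul_eq_one_right this]
  exact Subtype.property _

lemma isUnit_of_inv_mem_stalkSubring {x : X} {c : X.presheaf.stalk x} (hc0 : c ≠ 0)
    (hc : (stalkEquiv x c : X.functionField)⁻¹ ∈ stalkSubring x) : IsUnit c := by
  obtain ⟨d, hd⟩ := (stalkEquiv x).surjective ⟨_, hc⟩
  refine IsUnit.of_mul_eq_one d ((stalkEquiv x).injective (Subtype.ext ?_))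
  rw [map_mul, Subring.coe_mul, hd, map_one, Subring.coe_one]
  refine mul_inv_cancel₀ fun h ↦ hc0 ((stalkEquiv x).injective (Subtype.ext ?_))
  rw [h, map_zero]; rfl

instance (x : X) : IsFractionRing (stalkSubring x) X.functionField := by
  refine IsFractionRing.of_field _ _ fun c ↦ ?_
  obtain ⟨a, b, hb, rfl⟩ := IsFractionRing.div_surjective (A := X.presheaf.stalk x) c
  exact ⟨stalkEquiv x a, stalkEquiv x b, rfl⟩

/-- The elements of the local ring at a point of an affine open are fractions of sections. -/
lemma exists_eq_div {U : X.Opens} (hU : IsAffineOpen U) {x : X} (hx : x ∈ U) {c : X.functionField}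
    (hc : c ∈ stalkSubring x) : ∃ a b : Γ(X, U), (ffGerm U (genericPoint_mem hx) b)⁻¹ ∈ stalkSubring x ∧
      b ∉ (hU.primeIdealOf ⟨x, hx⟩).asIdeal ∧
      c = ffGerm U (genericPoint_mem hx) a / ffGerm U (genericPoint_mem hx) b := by
  obtain ⟨t, rfl⟩ := hc
  let := X.presheaf.algebra_section_stalk (⟨x, hx⟩ : U)
  have := hU.isLocalization_stalk ⟨x, hx⟩
  obtain ⟨a, b, rfl⟩ := IsLocalization.exists_mk'_eq (hU.primeIdealOf ⟨x, hx⟩).asIdeal.primeCompl t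
  have hb : IsUnit (X.presheaf.germ U x hx b) :=
    IsLocalization.map_units (X.presheaf.stalk x) b
  have h1 : (stalkEquiv x (X.presheaf.germ U x hx b) : X.functionField) =
    ffGerm U (genericPoint_mem hx) b := stalkSpecializes_germ hx _
  have h0 : ffGerm U (genericPoint_mem hx) b ≠ 0 := by
    rw [← h1]
    intro h
    have : stalkEquiv x (X.presheaf.germ U x hx b) = 0 := Subtype.ext h
    rw [map_eq_zero_iff _ (stalkEquiv x).injective] at this
    exact hb.ne_zero this
  refine ⟨a, b, h1 ▸ inv_mem_stalkSubring hb, b.2, ?_⟩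
  rw [eq_div_iff h0, ← stalkSpecializes_germ hx, ← stalkSpecializes_germ hx]
  refine (map_mul (X.presheaf.stalkSpecializes (genericPoint_specializes' x)).hom _ _).symm.trans ?_
  refine congrArg _ ?_
  exact IsLocalization.mk'_spec (X.presheaf.stalk x) a b

/-- A point has codimension one if its local ring has dimension one. -/
def IsCodimOne {X : Scheme.{u}} (x : X) : Prop := ringKrullDim (X.presheaf.stalk x) = 1

lemma ringKrullDim_stalk_eq_height {X : Scheme.{u}} {U : X.Opens} (hU : IsAffineOpen U) {x : X} (hx : x ∈ U) :
    ringKrullDim (X.presheaf.stalk x) = (hU.primeIdealOf ⟨x, hx⟩).asIdeal.height := by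
  let := X.presheaf.algebra_section_stalk (⟨x, hx⟩ : U)
  have := hU.isLocalization_stalk ⟨x, hx⟩
  exact IsLocalization.AtPrime.ringKrullDim_eq_height (hU.primeIdealOf ⟨x, hx⟩).asIdeal _

/-- A rational function integral over the sections is integral over each local ring, hence lies in
all of them. -/
lemma isIntegrallyClosed_section [IsNormalScheme X] {U : X.Opens} (hU : IsAffineOpen U)
    [Nonempty U] : IsIntegrallyClosed Γ(X, U) := by
  have := functionField_isFractionRing_of_isAffineOpen X U hU
  rw [isIntegrallyClosed_iff X.functionField]
  intro c hc
  obtain ⟨x, hx⟩ := ‹Nonempty U›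
  refine exists_ffGerm_eq_of_forall_mem (genericPoint_mem hx) fun x hx ↦ ?_
  have := IsNormalScheme.isIntegrallyClosed_stalk x
  have := functionField_isScalarTower X U ⟨x, hx⟩
  let := X.presheaf.algebra_section_stalk (⟨x, hx⟩ : U)
  obtain ⟨d, hd⟩ := IsIntegrallyClosed.isIntegral_iff.1 (hc.tower_top (A := X.presheaf.stalk x))
  exact ⟨d, hd⟩

/-- A rational function on a normal locally noetherian scheme that is regular in codimension one is
regular. -/
lemma mem_stalkSubring_of_codimOne [IsNormalScheme X] [IsLocallyNoetherian X] {U : X.Opens}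
    {c : X.functionField} (hc : ∀ x ∈ U, IsCodimOne x → c ∈ stalkSubring x) {x : X} (hx : x ∈ U) :
    c ∈ stalkSubring x := by
  obtain ⟨_, ⟨V, hV, rfl⟩, hxV, hVU⟩ :=
    X.isBasis_affineOpens.exists_subset_of_mem_open hx U.isOpen
  have : Nonempty V := ⟨x, hxV⟩
  have := functionField_isFractionRing_of_isAffineOpen X V hV
  have := isIntegrallyClosed_section hV
  have : IsNoetherianRing Γ(X, V) := IsLocallyNoetherian.component_noetherian ⟨V, hV⟩
  obtain ⟨a, ha⟩ := exists_algebraMap_eq_of_height_one (A := Γ(X, V)) c fun P hP hP1 ↦ by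
    -- Height one primes of the coordinate ring are points `y` of codimension one; membership of `c`
    -- in the local ring at `y` provides a denominator outside `P`.
    let q : PrimeSpectrum Γ(X, V) := ⟨P, hP⟩
    let y : X := hV.fromSpec q
    have hy : y ∈ V := hV.range_fromSpec.le ⟨q, rfl⟩
    have hyq : hV.primeIdealOf ⟨y, hy⟩ = q := by
      have := hV.isOpenImmersion_fromSpec
      apply hV.fromSpec.isOpenEmbedding.injective
      rw [hV.fromSpec_primeIdealOf]
    have hy1 : IsCodimOne y := by
      rw [IsCodimOne, ringKrullDim_stalk_eq_height hV hy, hyq, hP1]; rfl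
    obtain ⟨a, b, -, hb, h⟩ := exists_eq_div hV hy (hc y (hVU hy) hy1)
    refine ⟨a, b, by rwa [hyq] at hb, ?_⟩
    have hb0 : ffGerm V (genericPoint_mem hy) b ≠ 0 := fun h0 ↦ by
      have := ffGerm_injective V (genericPoint_mem hy) (h0.trans (map_zero _).symm)
      exact hb (this ▸ zero_mem _)
    rw [eq_div_iff hb0] at h
    exact h
  rw [← ha]
  exact ffGerm_mem_stalkSubring hxV a

/-- A noetherian normal local domain of dimension one is a Dedekind domain, and a local Dedekind
domain that is not a field is a discrete valuation ring. -/
lemma isDiscreteValuationRing_stalkSubring [IsNormalScheme X] [IsLocallyNoetherian X] {x : X}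
    (hx : IsCodimOne x) : IsDiscreteValuationRing (stalkSubring x) := by
  have := IsNormalScheme.isIntegrallyClosed_stalk x
  have : Ring.KrullDimLE 1 (X.presheaf.stalk x) := by
    rw [Ring.krullDimLE_iff, hx]; rfl
  have hf : ¬ IsField (X.presheaf.stalk x) := fun h ↦ by
    have := ringKrullDim_eq_zero_of_isField h
    rw [hx] at this
    exact one_ne_zero this
  have h1 : IsDedekindDomain (X.presheaf.stalk x) :=
    { __ := (inferInstance : IsDomain (X.presheaf.stalk x)),
      __ := (inferInstance : IsNoetherianRing (X.presheaf.stalk x)),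
      __ := (inferInstance : IsIntegrallyClosed (X.presheaf.stalk x)),
      maximalOfPrime := fun {p} hp hp' ↦ hp'.isMaximal_of_ne_bot hp }
  have h2 : IsDiscreteValuationRing (X.presheaf.stalk x) :=
    ((IsDiscreteValuationRing.TFAE (X.presheaf.stalk x) hf).out 0 2).2 h1
  exact IsDiscreteValuationRing.RingEquivClass.isDiscreteValuationRing (stalkEquiv x)

end StalkSubring
end ZariskiForms

namespace ZariskiForms

/-! ### Function fields and dominant morphisms -/

section FunctionFieldMap

variable {X Y Z : Scheme.{u}} [IsIntegral X] [IsIntegral Y] [IsIntegral Z]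

/-- Only the specialization is recorded, not the equality of the two points: it suffices for a map
of stalks and avoids transport along an equality. -/
lemma specializes_of_isDominant (f : Y ⟶ X) [IsDominant f] :
    f (genericPoint Y) ⤳ genericPoint X := by
  have h := (genericPoint_spec Y).image f.continuous
  rw [Set.image_univ, f.denseRange.closure_range] at h
  exact h.specializes trivial

/-- The map of function fields induced by a dominant morphism. -/
noncomputable def functionFieldMap (f : Y ⟶ X) [IsDominant f] : X.functionField ⟶ Y.functionField :=
  X.presheaf.stalkSpecializes (specializes_of_isDominant f) ≫ f.stalkMap (genericPoint Y)

lemma genericPoint_mem_preimage (f : Y ⟶ X) [IsDominant f] {U : X.Opens} (hU : genericPoint X ∈ U) :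
    genericPoint Y ∈ f ⁻¹ᵁ U :=
  (specializes_of_isDominant f).mem_open U.isOpen hU

lemma functionFieldMap_ffGerm (f : Y ⟶ X) [IsDominant f] {U : X.Opens} (hU : genericPoint X ∈ U)
    (s : Γ(X, U)) : functionFieldMap f (ffGerm U hU s) =
      ffGerm (f ⁻¹ᵁ U) (genericPoint_mem_preimage f hU) (f.app U s) := by
  have h : ffGerm U hU ≫ functionFieldMap f =
      f.app U ≫ ffGerm (f ⁻¹ᵁ U) (genericPoint_mem_preimage f hU) := by
    rw [functionFieldMap, ← Category.assoc, ffGerm, TopCat.Presheaf.germ_stalkSpecializes,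
      Scheme.Hom.germ_stalkMap]
  exact congr($h s)

lemma functionField_hom_ext {R : CommRingCat.{u}} {g h : X.functionField ⟶ R}
    (H : ∀ (U : X.Opens) (hU : genericPoint X ∈ U) (s : Γ(X, U)),
      g (ffGerm U hU s) = h (ffGerm U hU s)) : g = h := by
  ext c
  obtain ⟨U, hU, s, rfl⟩ := X.presheaf.exists_germ_eq c
  exact H U hU s

lemma functionFieldMap_comp (g : Z ⟶ Y) (f : Y ⟶ X) [IsDominant f] [IsDominant g] :
    functionFieldMap (g ≫ f) = functionFieldMap f ≫ functionFieldMap g := by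
  refine functionField_hom_ext fun U hU s ↦ ?_
  rw [functionFieldMap_ffGerm, CommRingCat.comp_apply, functionFieldMap_ffGerm,
    functionFieldMap_ffGerm]
  rfl

lemma functionFieldMap_id : functionFieldMap (𝟙 X) = 𝟙 X.functionField := by
  refine functionField_hom_ext fun U hU s ↦ ?_
  rw [functionFieldMap_ffGerm]
  rfl

lemma functionFieldMap_stalk (f : Y ⟶ X) [IsDominant f] (y : Y) (c : X.presheaf.stalk (f y)) :
    functionFieldMap f (stalkEquiv (f y) c) = stalkEquiv y (f.stalkMap y c) := by
  obtain ⟨U, hU, s, rfl⟩ := X.presheaf.exists_germ_eq c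
  rw [coe_stalkEquiv, coe_stalkEquiv, stalkSpecializes_germ, functionFieldMap_ffGerm]
  rw [Scheme.Hom.germ_stalkMap_apply]
  exact (stalkSpecializes_germ (U := f ⁻¹ᵁ U) hU (f.app U s)).symm

lemma functionFieldMap_mem (f : Y ⟶ X) [IsDominant f] (y : Y) {c : X.functionField}
    (hc : c ∈ stalkSubring (f y)) : functionFieldMap f c ∈ stalkSubring y := by
  obtain ⟨d, hd⟩ := (stalkEquiv (f y)).surjective ⟨c, hc⟩
  have := functionFieldMap_stalk f y d
  rw [hd] at this
  rw [this]
  exact Subtype.property _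

end FunctionFieldMap

/-! ### Finite generation of differentials for schemes locally of finite type -/

section Structure

variable {k : Type u} [Field k] {X Y : Scheme.{u}} [IsIntegral X] [IsIntegral Y]
  (a : X ⟶ Spec (.of k))

/-- The structure map of the function field of a `k`-scheme. -/
noncomputable def ffStructure : CommRingCat.of k ⟶ X.functionField :=
  structureMap a ⊤ ≫ ffGerm ⊤ trivial

lemma structureMap_ffGerm {U : X.Opens} (hU : genericPoint X ∈ U) :
    structureMap a U ≫ ffGerm U hU = ffStructure a := by
  rw [ffStructure, ← structureMap_map a (le_top : U ≤ ⊤), Category.assoc]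
  congr 1
  exact X.presheaf.germ_res (homOfLE le_top) _ hU

lemma ffStructure_comp {a : X ⟶ Spec (.of k)} {b : Y ⟶ Spec (.of k)} (f : Y ⟶ X) [IsDominant f]
    (h : f ≫ a = b) : ffStructure a ≫ functionFieldMap f = ffStructure b := by
  rw [ffStructure, Category.assoc, ← structureMap_ffGerm b (U := f ⁻¹ᵁ ⊤) trivial,
    ← structureMap_app f h ⊤, Category.assoc]
  congr 1
  ext s
  exact functionFieldMap_ffGerm f (U := ⊤) trivial s

/-- Locally, the differentials of all local rings are generated by the differentials of finitely
many sections. -/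
lemma exists_generators [LocallyOfFiniteType a] (x : X) :
    ∃ (U : X.Opens) (_ : x ∈ U) (T : Set X.functionField), T.Finite ∧ ∀ y ∈ U,
      T ⊆ stalkSubring y ∧ ∀ c ∈ stalkSubring y,
        kaehlerD (ffStructure a) c ∈ Submodule.span (stalkSubring y) (kaehlerD (ffStructure a) '' T) := by
  obtain ⟨_, ⟨U, hU, rfl⟩, hxU, -⟩ :=
    X.isBasis_affineOpens.exists_subset_of_mem_open (Set.mem_univ x) isOpen_univ
  have hη := genericPoint_mem hxU
  have hft : (structureMap a U).hom.FiniteType := by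
    have h1 := a.finiteType_appLE (U := ⊤) (isAffineOpen_top _) hU le_top
    exact h1.comp (RingHom.FiniteType.of_surjective _
      (ConcreteCategory.bijective_of_isIso (Scheme.ΓSpecIso (.of k)).inv).2)
  obtain ⟨S, hS⟩ := hft
  refine ⟨U, hxU, ffGerm U hη '' S, S.finite_toSet.image _, fun y hy ↦ ?_⟩
  have hT : ffGerm U hη '' S ⊆ stalkSubring y := by
    rintro _ ⟨s, -, rfl⟩
    exact ffGerm_mem_stalkSubring hy s
  have hC : Set.range (ffStructure a) ⊆ stalkSubring y := by
    rintro _ ⟨c, rfl⟩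
    rw [← structureMap_ffGerm a hη]
    exact ffGerm_mem_stalkSubring hy _
  refine ⟨hT, derivation_mem_span _ _ (Set.range (ffStructure a)) _ hT hC ?_ fun c hc ↦ ?_⟩
  · rintro _ ⟨c, rfl⟩
    exact kaehlerD_structure c
  -- Sections over `U` are polynomials in the generators `S` with coefficients in `k`, and elements
  -- of a local ring are fractions of sections.
  · have hcl : ∀ b : Γ(X, U), ffGerm U hη b ∈ Subring.closure (Set.range (ffStructure a) ∪
        ffGerm U hη '' S) := by
      intro b
      algebraize [(structureMap a U).hom]
      have hb : b ∈ Algebra.adjoin k (S : Set Γ(X, U)) := by rw [hS]; trivial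
      induction hb using Algebra.adjoin_induction with
      | mem b hb => exact Subring.subset_closure (.inr ⟨b, hb, rfl⟩)
      | algebraMap r =>
        refine Subring.subset_closure (.inl ⟨r, ?_⟩)
        rw [← structureMap_ffGerm a hη]; rfl
      | add b c _ _ hb hc => rw [map_add]; exact add_mem hb hc
      | mul b c _ _ hb hc => rw [map_mul]; exact mul_mem hb hc
    obtain ⟨a, b, hb, -, h⟩ := exists_eq_div hU hy hc
    exact ⟨_, hcl a, _, hcl b, hb, h⟩

lemma stalk_lattice_fg [LocallyOfFiniteType a] (p : ℕ) (x : X) :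
    (formsLattice (kaehlerD (ffStructure a)) p (stalkSubring x)).FG := by
  obtain ⟨U, hx, T, hT, h⟩ := exists_generators a x
  exact formsLattice_fg _ p _ T (h x hx).1 hT (h x hx).2

/-- The finiteness that Nakayama requires in `span_derivation_le`. -/
lemma stalk_derivation_fg [LocallyOfFiniteType a] (x : X) :
    (Submodule.span (stalkSubring x) (kaehlerD (ffStructure a) '' stalkSubring x)).FG := by
  obtain ⟨U, hx, T, hT, h⟩ := exists_generators a x
  have : Submodule.span (stalkSubring x) (kaehlerD (ffStructure a) '' stalkSubring x) =
      Submodule.span (stalkSubring x) (kaehlerD (ffStructure a) '' T) := by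
    apply le_antisymm
    · rw [Submodule.span_le]
      rintro _ ⟨c, hc, rfl⟩
      exact (h x hx).2 c hc
    · exact Submodule.span_mono (Set.image_mono (h x hx).1)
  rw [this]
  exact Submodule.fg_span (hT.image _)

lemma exists_eq_div_stalkSubring (x : X) (c : X.functionField) :
    ∃ a ∈ stalkSubring x, ∃ b ∈ stalkSubring x, c = a / b := by
  obtain ⟨a, b, hb, rfl⟩ := IsFractionRing.div_surjective (A := stalkSubring x) c
  exact ⟨a, a.2, b, b.2, rfl⟩

lemma finite_kaehler [LocallyOfFiniteType a] :
    Module.Finite X.functionField (CommRingCat.KaehlerDifferential (ffStructure a)) := by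
  obtain ⟨S, hS⟩ := stalk_derivation_fg a (genericPoint X)
  refine ⟨⟨S, ?_⟩⟩
  rw [eq_top_iff, ← span_kaehlerD, Submodule.span_le]
  have h1 : ∀ c ∈ stalkSubring (genericPoint X), kaehlerD (ffStructure a) c ∈
      Submodule.span X.functionField (S : Set (CommRingCat.KaehlerDifferential (ffStructure a))) := by
    intro c hc
    have : kaehlerD (ffStructure a) c ∈ Submodule.span (stalkSubring (genericPoint X))
        (S : Set (CommRingCat.KaehlerDifferential (ffStructure a))) := by
      rw [hS]; exact Submodule.subset_span ⟨c, hc, rfl⟩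
    exact Submodule.span_le_restrictScalars (stalkSubring (genericPoint X)) X.functionField _ this
  rintro _ ⟨c, rfl⟩
  obtain ⟨a, ha, b, hb, rfl⟩ := exists_eq_div_stalkSubring (genericPoint X) c
  rw [derivation_div]
  exact Submodule.smul_mem _ _ (sub_mem (Submodule.smul_mem _ _ (h1 _ ha))
    (Submodule.smul_mem _ _ (h1 _ hb)))

lemma span_stalk_lattice (p : ℕ) (x : X) :
    Submodule.span X.functionField (formsLattice (kaehlerD (ffStructure a)) p (stalkSubring x) :
      Set (⋀[X.functionField]^p (CommRingCat.KaehlerDifferential (ffStructure a)))) = ⊤ :=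
  span_formsLattice _ p _ (exists_eq_div_stalkSubring x) (span_kaehlerD _)

end Structure
end ZariskiForms

namespace ZariskiForms

/-! ### The function field of the spectrum of a field -/

section SpecField

variable (F : Type u) [Field F]

/-- The function field of the spectrum of a field `F` is `F`. -/
noncomputable def specFieldHom : F →+* (Spec (.of F)).functionField :=
  ((Scheme.ΓSpecIso (.of F)).inv ≫ ffGerm ⊤ trivial).hom

lemma specFieldHom_bijective : Function.Bijective (specFieldHom F) := by
  refine ⟨(specFieldHom F).injective, fun c ↦ ?_⟩
  have : Nonempty (⊤ : (Spec (.of F)).Opens) := ⟨⟨genericPoint _, trivial⟩⟩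
  have := functionField_isFractionRing_of_isAffineOpen (Spec (.of F)) ⊤ (isAffineOpen_top _)
  obtain ⟨a, b, -, rfl⟩ := IsFractionRing.div_surjective (A := Γ(Spec (.of F), ⊤)) c
  have key : ∀ a : Γ(Spec (.of F), ⊤), ∃ x : F, specFieldHom F x =
      algebraMap Γ(Spec (.of F), ⊤) (Spec (.of F)).functionField a := fun a ↦ by
    refine ⟨(Scheme.ΓSpecIso (.of F)).hom a, ?_⟩
    exact congrArg (ffGerm (X := Spec (.of F)) ⊤ trivial)
      congr($((Scheme.ΓSpecIso (.of F)).hom_inv_id) a)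
  obtain ⟨x, hx⟩ := key a
  obtain ⟨y, hy⟩ := key b
  exact ⟨x / y, by rw [map_div₀, hx, hy]⟩

end SpecField

/-! ### Function field and sections of the normalization in `L` -/

section Normalization

variable (X : Scheme.{u}) [IsIntegral X] (L : Type u) [Field L] [Algebra X.functionField L]

instance : IsDominant (X.fromSpecStalk (genericPoint X)) := by
  refine ⟨fun x ↦ ?_⟩
  have h : genericPoint X ∈ Set.range (X.fromSpecStalk (genericPoint X)) := by
    rw [Scheme.range_fromSpecStalk]; exact specializes_rfl
  refine closure_mono (Set.singleton_subset_iff.2 h) ?_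
  rw [genericPoint_closure]
  trivial

instance {F F' : Type u} [Field F] [Field F'] (φ : F →+* F') :
    IsDominant (Spec.map (CommRingCat.ofHom φ)) := by
  have : Subsingleton (Spec (.of F)) := inferInstanceAs (Subsingleton (PrimeSpectrum F))
  have : Nonempty (Spec (.of F')) := inferInstanceAs (Nonempty (PrimeSpectrum F'))
  exact ⟨Function.Surjective.denseRange (Function.surjective_to_subsingleton _)⟩

instance : IsDominant (fromSpecExt X L) := by
  rw [fromSpecExt]
  exact inferInstanceAs (IsDominant (_ ≫ X.fromSpecStalk (genericPoint X)))

instance : IsDominant (normalizationInHom X L) := by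
  have : IsDominant (toNormalizationIn X L ≫ normalizationInHom X L) := by
    rw [Scheme.Hom.toNormalization_fromNormalization]; infer_instance
  exact IsDominant.of_comp (toNormalizationIn X L) _

lemma functionFieldMap_congr {X Y : Scheme.{u}} [IsIntegral X] [IsIntegral Y] {f g : Y ⟶ X}
    [IsDominant f] [IsDominant g] (h : f = g) : functionFieldMap f = functionFieldMap g := by
  subst h; rfl

lemma functionFieldMap_specMap {F F' : Type u} [Field F] [Field F'] (φ : F →+* F') (c : F) :
    functionFieldMap (Spec.map (CommRingCat.ofHom φ)) (specFieldHom F c) =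
      specFieldHom F' (φ c) := by
  refine (functionFieldMap_ffGerm _ (U := ⊤) trivial _).trans ?_
  have := congr($(Scheme.ΓSpecIso_inv_naturality (CommRingCat.ofHom φ)) c)
  exact congrArg (ffGerm ⊤ trivial) this.symm

lemma functionFieldMap_fromSpecStalk (c : X.functionField) :
    functionFieldMap (X.fromSpecStalk (genericPoint X)) c =
      specFieldHom X.functionField c := by
  obtain ⟨U, hU, s, rfl⟩ := X.presheaf.exists_germ_eq c
  rw [functionFieldMap_ffGerm, Scheme.fromSpecStalk_app hU]
  exact ffGerm_map _ _ _

lemma functionFieldMap_fromSpecExt (c : X.functionField) :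
    functionFieldMap (fromSpecExt X L) c = specFieldHom L (algebraMap X.functionField L c) := by
  refine congr($(functionFieldMap_comp (Spec.map (CommRingCat.ofHom
    (algebraMap X.functionField L))) (X.fromSpecStalk (genericPoint X))) c).trans ?_
  rw [CommRingCat.comp_apply, functionFieldMap_fromSpecStalk]
  exact functionFieldMap_specMap _ _

/-- The function field of the normalization of `X` in `L` maps to `L`. -/
noncomputable def normalizationFieldHom : (normalizationIn X L).functionField →+* L :=
  (RingEquiv.ofBijective _ (specFieldHom_bijective L)).symm.toRingHom.comp
    (functionFieldMap (toNormalizationIn X L)).hom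

lemma specFieldHom_normalizationFieldHom (z : (normalizationIn X L).functionField) :
    specFieldHom L (normalizationFieldHom X L z) = functionFieldMap (toNormalizationIn X L) z :=
  (RingEquiv.ofBijective _ (specFieldHom_bijective L)).apply_symm_apply _

lemma normalizationFieldHom_functionFieldMap (c : X.functionField) :
    normalizationFieldHom X L (functionFieldMap (normalizationInHom X L) c) =
      algebraMap X.functionField L c := by
  apply (specFieldHom L).injective
  rw [specFieldHom_normalizationFieldHom, ← functionFieldMap_fromSpecExt,
    ← CommRingCat.comp_apply, ← functionFieldMap_comp]
  rw [functionFieldMap_congr (Scheme.Hom.toNormalization_fromNormalization (fromSpecExt X L))]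

variable {L}

instance (g : L ≃ₐ[X.functionField] L) : IsIso (galoisHom X g) :=
  inferInstanceAs (IsIso (galoisIso X g).hom)

/-- Identifies pullback along the automorphism of `W` attached to `g` with `g` itself, by
restricting the defining square of `galoisHom` to `Spec L`. -/
lemma normalizationFieldHom_galoisHom (g : L ≃ₐ[X.functionField] L)
    (z : (normalizationIn X L).functionField) :
    normalizationFieldHom X L (functionFieldMap (galoisHom X g) z) =
      g (normalizationFieldHom X L z) := by
  apply (specFieldHom L).injective
  rw [specFieldHom_normalizationFieldHom, ← CommRingCat.comp_apply, ← functionFieldMap_comp]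
  rw [functionFieldMap_congr (toNormalizationIn_galoisHom X L g), functionFieldMap_comp,
    CommRingCat.comp_apply, ← specFieldHom_normalizationFieldHom]
  exact functionFieldMap_specMap (g : L →+* L) _

lemma fromSpecExt_app {U : X.Opens} (hU : genericPoint X ∈ U) (s : Γ(X, U)) :
    (fromSpecExt X L).app U s = (Spec (.of L)).presheaf.map (homOfLE le_top).op
      ((Scheme.ΓSpecIso (.of L)).inv (algebraMap X.functionField L (ffGerm U hU s))) := by
  apply ffGerm_injective _ (genericPoint_mem_preimage (fromSpecExt X L) hU)
  rw [← functionFieldMap_ffGerm, functionFieldMap_fromSpecExt, ffGerm_map]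
  rfl

/-- The elements of `L` that are integral over the sections of an affine open are sections of the
normalization over its preimage. -/
lemma exists_normalizationFieldHom_ffGerm {U : X.Opens} (hU : IsAffineOpen U)
    (hη : genericPoint X ∈ U) {l : L}
    (hl : ((algebraMap X.functionField L).comp (ffGerm U hη).hom).IsIntegralElem l) :
    ∃ t : Γ(normalizationIn X L, normalizationInHom X L ⁻¹ᵁ U),
      normalizationFieldHom X L
        (ffGerm _ (genericPoint_mem_preimage (normalizationInHom X L) hη) t) = l := by
  let f := fromSpecExt X L
  let := (f.app U).hom.toAlgebra
  -- The element `l`, regarded as a function on the preimage of `U` in `Spec L`; over an affine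
  -- open, the sections of the normalization are the integral closure in such functions.
  let y : Γ(Spec (.of L), f ⁻¹ᵁ U) := (Spec (.of L)).presheaf.map (homOfLE le_top).op
      ((Scheme.ΓSpecIso (.of L)).inv l)
  have hy : y ∈ integralClosure Γ(X, U) Γ(Spec (.of L), f ⁻¹ᵁ U) := by
    obtain ⟨p, hp, hp'⟩ := hl
    refine ⟨p, hp, ?_⟩
    have h1 : algebraMap Γ(X, U) Γ(Spec (.of L), f ⁻¹ᵁ U) =
        ((Scheme.ΓSpecIso (.of L)).inv ≫
          (Spec (.of L)).presheaf.map (homOfLE le_top).op).hom.comp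
        ((algebraMap X.functionField L).comp (ffGerm U hη).hom) := by
      ext s
      exact fromSpecExt_app X hη s
    rw [h1]
    refine (Polynomial.hom_eval₂ p _ _ l).symm.trans ?_
    rw [hp', map_zero]
  let t := (f.normalizationObjIso hU).inv ⟨y, hy⟩
  refine ⟨t, (specFieldHom L).injective ?_⟩
  have h2 : f.toNormalization.appLE _ _ (by simp [← Scheme.Hom.comp_preimage]) t = y := by
    rw [← f.normalizationObjIso_hom_val hU]
    change ((f.normalizationObjIso hU).hom ((f.normalizationObjIso hU).inv ⟨y, hy⟩)).1 = y
    rw [← CommRingCat.comp_apply, Iso.inv_hom_id]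
    rfl
  rw [specFieldHom_normalizationFieldHom, functionFieldMap_ffGerm]
  have h3 : genericPoint (Spec (.of L)) ∈ f ⁻¹ᵁ U := genericPoint_mem_preimage f hη
  trans ffGerm _ h3 y
  · rw [← h2, Scheme.Hom.appLE]
    exact (ffGerm_map (X := Spec (.of L)) h3 (le_of_eq (by simp [f, ← Scheme.Hom.comp_preimage]))
      ((toNormalizationIn X L).app (normalizationInHom X L ⁻¹ᵁ U) t)).symm
  · exact ffGerm_map (X := Spec (.of L)) h3 _ _

end Normalization
end ZariskiForms

namespace ZariskiForms

/-! ### The function field of the normalization is `L` -/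

section NormalizationField

variable {X : Scheme.{u}} [IsIntegral X] {L : Type u} [Field L] [Algebra X.functionField L]

/-- Every `l ∈ L` is algebraic over the sections of an affine open, so a nonzero multiple `r l` is
integral and comes from a section `t` of the normalization; then `l = t / r`. -/
lemma normalizationFieldHom_bijective [FiniteDimensional X.functionField L] :
    Function.Bijective (normalizationFieldHom X L) := by
  refine ⟨(normalizationFieldHom X L).injective, fun l ↦ ?_⟩
  obtain ⟨_, ⟨U, hU, rfl⟩, hη, -⟩ := X.isBasis_affineOpens.exists_subset_of_mem_open
    (Set.mem_univ (genericPoint X)) isOpen_univ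
  have : Nonempty U := ⟨⟨_, hη⟩⟩
  have := functionField_isFractionRing_of_isAffineOpen X U hU
  let : Algebra Γ(X, U) L := ((algebraMap X.functionField L).comp (ffGerm U hη).hom).toAlgebra
  have : IsScalarTower Γ(X, U) X.functionField L := .of_algebraMap_eq' rfl
  have hl : IsAlgebraic Γ(X, U) l :=
    (IsFractionRing.isAlgebraic_iff Γ(X, U) X.functionField L).2 (Algebra.IsAlgebraic.isAlgebraic l)
  obtain ⟨r, hr, hr'⟩ := hl.exists_integral_multiple
  obtain ⟨t, ht⟩ := exists_normalizationFieldHom_ffGerm X hU hη hr'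
  have h1 : algebraMap X.functionField L (ffGerm U hη r) ≠ 0 := by
    rw [Ne, map_eq_zero, map_eq_zero_iff _ (ffGerm_injective U hη)]
    exact hr
  refine ⟨ffGerm _ (genericPoint_mem_preimage (normalizationInHom X L) hη) t /
    functionFieldMap (normalizationInHom X L) (ffGerm U hη r), ?_⟩
  rw [map_div₀, ht, normalizationFieldHom_functionFieldMap, div_eq_iff h1, mul_comm]
  exact Algebra.smul_def r l

/-- The function field of a scheme `W` over `X` as an algebra over the function field of `X`. -/
noncomputable abbrev functionFieldAlgebra {X W : Scheme.{u}} [IsIntegral X] [IsIntegral W]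
    (π : W ⟶ X) [IsDominant π] : Algebra X.functionField W.functionField :=
  (functionFieldMap π).hom.toAlgebra

variable (X L) in
/-- The function field of the normalization of `X` in `L` is `L`. -/
noncomputable def normalizationFieldEquiv [FiniteDimensional X.functionField L] :
    letI := functionFieldAlgebra (normalizationInHom X L)
    (normalizationIn X L).functionField ≃ₐ[X.functionField] L :=
  letI := functionFieldAlgebra (normalizationInHom X L)
  AlgEquiv.ofBijective (A₁ := (normalizationIn X L).functionField) (A₂ := L)
    { __ := normalizationFieldHom X L
      commutes' := normalizationFieldHom_functionFieldMap X L }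
    normalizationFieldHom_bijective

lemma normalizationFieldEquiv_galoisHom [FiniteDimensional X.functionField L]
    (g : L ≃ₐ[X.functionField] L) (z : (normalizationIn X L).functionField) :
    normalizationFieldEquiv X L (functionFieldMap (galoisHom X g) z) =
      g (normalizationFieldEquiv X L z) :=
  normalizationFieldHom_galoisHom X g z

variable (X L) in
lemma formallyEtale_functionFieldMap [FiniteDimensional X.functionField L]
    [Algebra.IsSeparable X.functionField L] :
    (functionFieldMap (normalizationInHom X L)).hom.FormallyEtale := by
  let := functionFieldAlgebra (normalizationInHom X L)
  let e := normalizationFieldEquiv X L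
  have : FiniteDimensional X.functionField (normalizationIn X L).functionField :=
    e.symm.toLinearEquiv.finiteDimensional
  have : Algebra.IsSeparable X.functionField (normalizationIn X L).functionField :=
    AlgEquiv.Algebra.isSeparable e.symm
  exact (Algebra.FormallyEtale.iff_isSeparable X.functionField
    (normalizationIn X L).functionField).2 this

/-- The fixed field of the Galois group, carried over to the function field of the normalization; it
is the input on coefficients for descent. -/
lemma exists_functionFieldMap_eq [FiniteDimensional X.functionField L]
    [IsGalois X.functionField L] (z : (normalizationIn X L).functionField)
    (hz : ∀ g : L ≃ₐ[X.functionField] L, functionFieldMap (galoisHom X g) z = z) :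
    ∃ c, functionFieldMap (normalizationInHom X L) c = z := by
  let e := normalizationFieldEquiv X L
  have h := (IsGalois.mem_bot_iff_fixed (F := X.functionField) (e z)).2 fun g ↦ by
    rw [← normalizationFieldEquiv_galoisHom, hz]
  obtain ⟨c, hc⟩ := h
  refine ⟨c, (normalizationFieldHom X L).injective ?_⟩
  rw [normalizationFieldHom_functionFieldMap]
  exact hc

lemma isIntegral_normalizationFieldHom {U : X.Opens} (hU : IsAffineOpen U) (hη : genericPoint X ∈ U)
    (t : Γ(normalizationIn X L, normalizationInHom X L ⁻¹ᵁ U)) :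
    ((algebraMap X.functionField L).comp (ffGerm U hη).hom).IsIntegralElem
      (normalizationFieldHom X L
        (ffGerm _ (genericPoint_mem_preimage (normalizationInHom X L) hη) t)) := by
  obtain ⟨p, hp, hp'⟩ := (normalizationInHom X L).isIntegral_app U hU t
  refine ⟨p, hp, ?_⟩
  have h : (algebraMap X.functionField L).comp (ffGerm U hη).hom =
      ((normalizationFieldHom X L).comp
        (ffGerm _ (genericPoint_mem_preimage (normalizationInHom X L) hη)).hom).comp
      ((normalizationInHom X L).app U).hom := by
    ext s
    refine (normalizationFieldHom_functionFieldMap X L _).symm.trans ?_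
    rw [functionFieldMap_ffGerm]; rfl
  rw [h]
  refine (Polynomial.hom_eval₂ p _ ((normalizationFieldHom X L).comp
        (ffGerm _ (genericPoint_mem_preimage (normalizationInHom X L) hη)).hom) t).symm.trans ?_
  rw [hp', map_zero]

end NormalizationField

/-! ### The normalization is finite over `X` and normal -/

section NormalizationProperties

variable (X : Scheme.{u}) [IsIntegral X] (L : Type u) [Field L] [Algebra X.functionField L]

lemma isIntegralClosure_normalization {U : X.Opens} (hU : IsAffineOpen U)
    (hη : genericPoint X ∈ U) :
    let π := normalizationInHom X L
    letI := (functionFieldMap π).hom.toAlgebra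
    letI := ((functionFieldMap π).hom.comp (ffGerm U hη).hom).toAlgebra
    letI := (ffGerm (π ⁻¹ᵁ U) (genericPoint_mem_preimage π hη)).hom.toAlgebra
    IsIntegralClosure Γ(normalizationIn X L, π ⁻¹ᵁ U) Γ(X, U)
      (normalizationIn X L).functionField := by
  intro π
  let := (functionFieldMap π).hom.toAlgebra
  let := ((functionFieldMap π).hom.comp (ffGerm U hη).hom).toAlgebra
  let := (ffGerm (π ⁻¹ᵁ U) (genericPoint_mem_preimage π hη)).hom.toAlgebra
  have h : (algebraMap X.functionField L).comp (ffGerm U hη).hom =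
      (normalizationFieldHom X L).comp (algebraMap Γ(X, U) (normalizationIn X L).functionField) := by
    ext s
    exact (normalizationFieldHom_functionFieldMap X L _).symm
  refine ⟨ffGerm_injective _ _, fun {z} ↦ ⟨fun hz ↦ ?_, ?_⟩⟩
  · obtain ⟨p, hp, hp'⟩ := hz
    obtain ⟨t, ht⟩ := exists_normalizationFieldHom_ffGerm X hU hη
      (l := normalizationFieldHom X L z) ⟨p, hp, by
        rw [h]
        refine (Polynomial.hom_eval₂ p _ _ _).symm.trans ?_
        rw [hp', map_zero]⟩
    exact ⟨t, (normalizationFieldHom X L).injective ht⟩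
  · rintro ⟨t, rfl⟩
    obtain ⟨p, hp, hp'⟩ := isIntegral_normalizationFieldHom hU hη t
    refine ⟨p, hp, (normalizationFieldHom X L).injective ?_⟩
    rw [h] at hp'
    rw [map_zero]
    exact (Polynomial.hom_eval₂ p _ _ _).trans hp'

instance [IsNormalScheme X] [FiniteDimensional X.functionField L]
    [Algebra.IsSeparable X.functionField L] [IsLocallyNoetherian X] :
    IsFinite (normalizationInHom X L) := by
  refine ⟨fun U hU ↦ ?_⟩
  by_cases hη : genericPoint X ∈ U
  · let π := normalizationInHom X L
    let i1 := (functionFieldMap π).hom.toAlgebra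
    let i2 := ((functionFieldMap π).hom.comp (ffGerm U hη).hom).toAlgebra
    let i3 := (ffGerm (π ⁻¹ᵁ U) (genericPoint_mem_preimage π hη)).hom.toAlgebra
    let i4 := (π.app U).hom.toAlgebra
    have : Nonempty U := ⟨⟨_, hη⟩⟩
    have := functionField_isFractionRing_of_isAffineOpen X U hU
    have := isIntegrallyClosed_section hU
    have : IsNoetherianRing Γ(X, U) := IsLocallyNoetherian.component_noetherian ⟨U, hU⟩
    have := isIntegralClosure_normalization X L hU hη
    have : IsScalarTower Γ(X, U) X.functionField (normalizationIn X L).functionField :=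
      .of_algebraMap_eq' rfl
    have : IsScalarTower Γ(X, U) Γ(normalizationIn X L, π ⁻¹ᵁ U)
        (normalizationIn X L).functionField := .of_algebraMap_eq fun s ↦
      functionFieldMap_ffGerm π hη s
    let e := normalizationFieldEquiv X L
    have : FiniteDimensional X.functionField (normalizationIn X L).functionField :=
      e.symm.toLinearEquiv.finiteDimensional
    have : Algebra.IsSeparable X.functionField (normalizationIn X L).functionField :=
      AlgEquiv.Algebra.isSeparable e.symm
    -- Separability enters here: the integral closure of a noetherian normal domain in a finite
    -- separable extension is a finite module.
    exact IsIntegralClosure.finite Γ(X, U) X.functionField (normalizationIn X L).functionField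
      Γ(normalizationIn X L, π ⁻¹ᵁ U)
  · obtain rfl := eq_bot_of_genericPoint_notMem hη
    have : Subsingleton Γ(normalizationIn X L, normalizationInHom X L ⁻¹ᵁ ⊥) :=
      inferInstanceAs (Subsingleton Γ(normalizationIn X L, ⊥))
    apply RingHom.Finite.of_surjective
    exact Function.surjective_to_subsingleton _

instance : IsNormalScheme (normalizationIn X L) where
  isDomain_stalk _ := inferInstance
  isIntegrallyClosed_stalk w := by
    let π := normalizationInHom X L
    obtain ⟨_, ⟨U, hU, rfl⟩, hw, -⟩ := X.isBasis_affineOpens.exists_subset_of_mem_open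
      (Set.mem_univ (π w)) isOpen_univ
    have hη := genericPoint_mem hw
    have hV : IsAffineOpen (π ⁻¹ᵁ U) := hU.preimage π
    let i1 := (functionFieldMap π).hom.toAlgebra
    let i2 := ((functionFieldMap π).hom.comp (ffGerm U hη).hom).toAlgebra
    have : Nonempty (π ⁻¹ᵁ U) := ⟨⟨w, hw⟩⟩
    have := functionField_isFractionRing_of_isAffineOpen (normalizationIn X L) _ hV
    have := isIntegralClosure_normalization X L hU hη
    have h1 : IsIntegrallyClosed Γ(normalizationIn X L, π ⁻¹ᵁ U) := by
      let i4 := (π.app U).hom.toAlgebra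
      have : IsScalarTower Γ(X, U) Γ(normalizationIn X L, π ⁻¹ᵁ U)
        (normalizationIn X L).functionField := .of_algebraMap_eq fun s ↦
          functionFieldMap_ffGerm π hη s
      have : Algebra.IsIntegral Γ(X, U) Γ(normalizationIn X L, π ⁻¹ᵁ U) :=
        ⟨π.isIntegral_app U hU⟩
      rw [isIntegrallyClosed_iff (normalizationIn X L).functionField]
      intro z hz
      -- Transitivity of integrality: an integral closure is integrally closed, and normality passes
      -- to its localizations.
      exact IsIntegralClosure.isIntegral_iff.1 (isIntegral_trans (R := Γ(X, U)) z hz)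
    let := (normalizationIn X L).presheaf.algebra_section_stalk (⟨w, hw⟩ : (π ⁻¹ᵁ U : Opens _))
    have := hV.isLocalization_stalk ⟨w, hw⟩
    exact isIntegrallyClosed_of_isLocalization _ _ (Ideal.primeCompl_le_nonZeroDivisors
      (hV.primeIdealOf ⟨w, hw⟩).asIdeal)

end NormalizationProperties

/-! ### Codimension one under integral morphisms -/

section Codim

/-- Going down, valid because `R` is integrally closed, makes the height of `P` the height of its
contraction plus the height of `P` in the quotient by the extended contraction. The second term is
zero, as integrality makes `P` minimal over the extended ideal. -/
lemma height_eq_of_isIntegral {R S : Type*} [CommRing R] [CommRing S] [IsDomain S] [Algebra R S]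
    [IsNoetherianRing R] [IsNoetherianRing S] [FaithfulSMul R S] [Algebra.IsIntegral R S]
    [IsIntegrallyClosed R] (P : Ideal S) [P.IsPrime] :
    P.height = (P.comap (algebraMap R S)).height := by
  have : P.LiesOver (P.comap (algebraMap R S)) := ⟨rfl⟩
  rw [Ideal.height_eq_height_add_of_liesOver_of_hasGoingDown (P.comap (algebraMap R S)) P]
  have h := Ideal.IsIntegral.mem_minimalPrimes_map_under (R := R) P
  have : (P.map (Ideal.Quotient.mk ((P.comap (algebraMap R S)).map (algebraMap R S)))).IsPrime :=
    Ideal.map_isPrime_of_surjective Ideal.Quotient.mk_surjective (by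
      rw [Ideal.mk_ker]; exact Ideal.map_comap_le)
  suffices H : (P.map (Ideal.Quotient.mk
      ((P.comap (algebraMap R S)).map (algebraMap R S)))).height = 0 by rw [H, add_zero]
  rw [Ideal.height_eq_zero_iff]
  refine ⟨⟨this, bot_le⟩, fun Q hQ0 hQP ↦ ?_⟩
  have hQ := hQ0.1
  rw [Ideal.map_le_iff_le_comap]
  refine h.2 ⟨hQ.comap _, ?_⟩ ?_
  · exact (Ideal.mk_ker (I := (P.comap (algebraMap R S)).map (algebraMap R S))).ge.trans
      (Ideal.comap_mono bot_le)
  · intro x hx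
    have := hQP hx
    rwa [Ideal.mem_quotient_iff_mem Ideal.map_comap_le] at this

/-- For an integral dominant morphism to a normal scheme, codimension one is preserved. -/
lemma isCodimOne_iff {X W : Scheme.{u}} [IsIntegral X] [IsIntegral W] [IsNormalScheme X]
    [IsLocallyNoetherian X] [IsLocallyNoetherian W] (π : W ⟶ X) [IsDominant π] [IsIntegralHom π]
    (w : W) : IsCodimOne w ↔ IsCodimOne (π w) := by
  obtain ⟨_, ⟨U, hU, rfl⟩, hw, -⟩ := X.isBasis_affineOpens.exists_subset_of_mem_open
    (Set.mem_univ (π w)) isOpen_univ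
  have hη := genericPoint_mem hw
  have hV : IsAffineOpen (π ⁻¹ᵁ U) := hU.preimage π
  let := (π.app U).hom.toAlgebra
  have : Nonempty U := ⟨⟨π w, hw⟩⟩
  have : Nonempty (π ⁻¹ᵁ U) := ⟨⟨w, hw⟩⟩
  have := isIntegrallyClosed_section hU
  have : IsNoetherianRing Γ(X, U) := IsLocallyNoetherian.component_noetherian ⟨U, hU⟩
  have : IsNoetherianRing Γ(W, π ⁻¹ᵁ U) := IsLocallyNoetherian.component_noetherian ⟨_, hV⟩
  have : Algebra.IsIntegral Γ(X, U) Γ(W, π ⁻¹ᵁ U) := ⟨π.isIntegral_app U hU⟩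
  have : FaithfulSMul Γ(X, U) Γ(W, π ⁻¹ᵁ U) := by
    rw [faithfulSMul_iff_algebraMap_injective]
    intro s t hst
    apply ffGerm_injective U hη
    apply (functionFieldMap π).hom.injective
    refine (functionFieldMap_ffGerm π hη s).trans (.trans ?_ (functionFieldMap_ffGerm π hη t).symm)
    exact congrArg _ hst
  rw [IsCodimOne, IsCodimOne, ringKrullDim_stalk_eq_height hU hw,
    ringKrullDim_stalk_eq_height hV (x := w) hw, height_eq_of_isIntegral (R := Γ(X, U))]
  have h := IsAffineOpen.comap_primeIdealOf_appLE (f := π) (x := w) U hU (π ⁻¹ᵁ U) hV le_rfl hw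
  rw [← h, Scheme.Hom.appLE_eq_app]
  rfl

end Codim
end ZariskiForms

namespace ZariskiForms

/-! ### Tame descent at points of codimension one -/

section TameDescent

variable {X : Scheme.{u}} [IsIntegral X]

lemma isDiscreteValuationRing_stalk [IsNormalScheme X] [IsLocallyNoetherian X] {x : X}
    (hx : IsCodimOne x) : IsDiscreteValuationRing (X.presheaf.stalk x) :=
  have := isDiscreteValuationRing_stalkSubring hx
  IsDiscreteValuationRing.RingEquivClass.isDiscreteValuationRing (stalkEquiv x).symm

/-- In a valuation ring the inverse of a non-integral element is integral; it is not a unit, hence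
divisible by the uniformizer. -/
lemma inv_eq_mul_of_notMem_stalkSubring {x : X} [IsDiscreteValuationRing (X.presheaf.stalk x)]
    {s : X.presheaf.stalk x} (hs : Irreducible s) {a : X.functionField} (ha : a ∉ stalkSubring x) :
    ∃ c ∈ stalkSubring x, a⁻¹ = stalkEquiv x s * c := by
  have h : a⁻¹ ∈ stalkSubring x := by
    rcases ValuationRing.isInteger_or_isInteger (X.presheaf.stalk x) a with ⟨c, hc⟩ | ⟨c, hc⟩
    · exact absurd ⟨c, hc⟩ ha
    · exact ⟨c, hc⟩
  obtain ⟨c, hc⟩ := (stalkEquiv x).surjective ⟨_, h⟩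
  have h1 : ¬ IsUnit c := fun h2 ↦ ha (by
    have := inv_mem_stalkSubring h2
    rw [hc] at this
    rwa [inv_inv] at this)
  have h2 : c ∈ IsLocalRing.maximalIdeal (X.presheaf.stalk x) := h1
  rw [hs.maximalIdeal_eq, Ideal.mem_span_singleton] at h2
  obtain ⟨d, rfl⟩ := h2
  refine ⟨stalkEquiv x d, Subtype.property _, ?_⟩
  rw [map_mul] at hc
  exact (congrArg Subtype.val hc).symm

/-- Lift the minimal polynomial of the residue of `b`: its root becomes a zero modulo the maximal
ideal, and separability makes the derivative nonzero there, hence a unit. -/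
lemma residue_isSeparable_lift {X W : Scheme.{u}} (π : W ⟶ X) (w : W)
    (hsep : letI := (π.residueFieldMap w).hom.toAlgebra
      Algebra.IsSeparable (X.residueField (π w)) (W.residueField w))
    (b : W.presheaf.stalk w) : ∃ f : Polynomial (X.presheaf.stalk (π w)),
      f.eval₂ (π.stalkMap w).hom b ∈ IsLocalRing.maximalIdeal (W.presheaf.stalk w) ∧
      IsUnit (f.derivative.eval₂ (π.stalkMap w).hom b) := by
  let := (π.residueFieldMap w).hom.toAlgebra
  let β : W.residueField w := IsLocalRing.residue _ b
  have h1 := Algebra.IsSeparable.isSeparable (X.residueField (π w)) β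
  have h2 : (minpoly (X.residueField (π w)) β).Separable := h1
  let r : X.presheaf.stalk (π w) →+* X.residueField (π w) := IsLocalRing.residue _
  obtain ⟨f, hf⟩ := Polynomial.map_surjective r IsLocalRing.residue_surjective (minpoly (X.residueField (π w)) β)
  have key : ∀ g : Polynomial (X.presheaf.stalk (π w)),
      IsLocalRing.residue _ (g.eval₂ (π.stalkMap w).hom b) =
        Polynomial.aeval β (g.map r) := by
    intro g
    rw [Polynomial.hom_eval₂, Polynomial.aeval_def, Polynomial.eval₂_map]
    rfl
  have h3 : Polynomial.aeval β (minpoly (X.residueField (π w)) β).derivative ≠ 0 :=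
    h2.aeval_derivative_ne_zero (minpoly.aeval _ β)
  refine ⟨f, ?_, ?_⟩
  · rw [← IsLocalRing.residue_eq_zero_iff, key, hf, minpoly.aeval]
    rfl
  · rw [← IsLocalRing.residue_ne_zero_iff_isUnit, key, ← Polynomial.derivative_map, hf]
    exact h3

variable {k : Type u} [Field k]

lemma mem_formsLattice_of_tame {W : Scheme.{u}} [IsIntegral W] [IsNormalScheme X] [IsLocallyNoetherian X] [IsNormalScheme W]
    [IsLocallyNoetherian W] (π : W ⟶ X) [IsDominant π] (htame : IsTamelyRamified π)
    {a : X ⟶ Spec (.of k)} {b : W ⟶ Spec (.of k)} [LocallyOfFiniteType a] [LocallyOfFiniteType b]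
    (h : π ≫ a = b)
    (het : (functionFieldMap π).hom.FormallyEtale) (p : ℕ) (w : W) (hw : IsCodimOne w)
    (hπw : IsCodimOne (π w))
    (v : ⋀[X.functionField]^p (CommRingCat.KaehlerDifferential (ffStructure a)))
    (hv : formsMap p (functionFieldMap π) (ffStructure_comp π h) v ∈
      formsLattice (kaehlerD (ffStructure b)) p (stalkSubring w)) :
    v ∈ formsLattice (kaehlerD (ffStructure a)) p (stalkSubring (π w)) := by
  have := isDiscreteValuationRing_stalk hw
  have := isDiscreteValuationRing_stalk hπw
  have := isDiscreteValuationRing_stalkSubring hπw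
  obtain ⟨⟨e, he, hmap⟩, hsep⟩ := htame w hπw
  obtain ⟨s, hs⟩ := IsDiscreteValuationRing.exists_irreducible (X.presheaf.stalk (π w))
  obtain ⟨t, ht⟩ := IsDiscreteValuationRing.exists_irreducible (W.presheaf.stalk w)
  -- With uniformizers `s` and `t`, the equality of ideals says that the image of `s` is `t^e` times
  -- a unit `u`.
  rw [hs.maximalIdeal_eq, ht.maximalIdeal_eq, Ideal.map_span, Set.image_singleton,
    Ideal.span_singleton_pow, Ideal.span_singleton_eq_span_singleton] at hmap
  obtain ⟨u, hu⟩ := hmap.symm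
  have hinj : Function.Injective fun c ↦ (stalkEquiv w c : W.functionField) :=
    Subtype.val_injective.comp (stalkEquiv w).injective
  have hne : ∀ c, c ≠ 0 → (stalkEquiv w c : W.functionField) ≠ 0 := fun c hc h ↦
    hc (hinj (h.trans (by simp)))
  have heu : IsUnit (e : W.presheaf.stalk w) := by
    rw [← IsLocalRing.residue_ne_zero_iff_isUnit, map_natCast]
    exact he
  have hecast : (e : W.functionField) = stalkEquiv w (e : W.presheaf.stalk w) := by simp
  have hcomm : ∀ c, functionFieldMap π (stalkEquiv (π w) c) = stalkEquiv w (π.stalkMap w c) :=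
    functionFieldMap_stalk π w
  have := finite_kaehler a
  let bas := Module.finBasis X.functionField (CommRingCat.KaehlerDifferential (ffStructure a))
  obtain ⟨bas', hbas⟩ := exists_basis_kaehlerMap (functionFieldMap π) (ffStructure_comp π h) het bas
  refine tame_descent (functionFieldMap π).hom (kaehlerD (ffStructure a))
    (kaehlerD (ffStructure b)) (kaehlerMap (functionFieldMap π) (ffStructure_comp π h))
    (kaehlerMap_kaehlerD _ _) bas bas' hbas (span_kaehlerD _) (stalkSubring (π w)) (stalkSubring w)
    (fun c hc ↦ functionFieldMap_mem π w hc) (stalkEquiv (π w) s) (Subtype.property _)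
    (fun c hc ↦ inv_eq_mul_of_notMem_stalkSubring hs hc) (stalkEquiv w t) (Subtype.property _)
    (fun h ↦ ht.not_isUnit (isUnit_of_inv_mem_stalkSubring ht.ne_zero h)) (hne _ ht.ne_zero)
    e ?_ ?_ (stalkEquiv w u) (hne _ u.ne_zero) (Subtype.property _)
    (inv_mem_stalkSubring u.isUnit) ?_ ?_ (stalk_derivation_fg b w) p (stalk_lattice_fg a p _) v hv
  · rw [hecast]; exact hne _ heu.ne_zero
  · rw [hecast]; exact inv_mem_stalkSubring heu
  · refine (hcomm s).trans ?_
    rw [← hu]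
    simp
  · intro c hc
    obtain ⟨c, rfl⟩ : ∃ d, (stalkEquiv w d : W.functionField) = c := by
      obtain ⟨d, hd⟩ := (stalkEquiv w).surjective ⟨c, hc⟩
      exact ⟨d, congrArg Subtype.val hd⟩
    obtain ⟨f, hf, hf'⟩ := residue_isSeparable_lift π w hsep c
    -- Evaluating a polynomial in the stalks or in the subrings of the function fields gives the
    -- same element.
    have key : ∀ g : Polynomial (X.presheaf.stalk (π w)),
        (g.map (stalkEquiv (π w)).toRingHom).eval₂
          ((functionFieldMap π).hom.comp (stalkSubring (π w)).subtype) (stalkEquiv w c) =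
        stalkEquiv w (g.eval₂ (π.stalkMap w).hom c) := by
      intro g
      rw [Polynomial.eval₂_map]
      refine Eq.trans ?_ (Polynomial.hom_eval₂ g (π.stalkMap w).hom
        ((stalkSubring w).subtype.comp (stalkEquiv w).toRingHom) c).symm
      congr 1
      ext d
      exact hcomm d
    rw [ht.maximalIdeal_eq, Ideal.mem_span_singleton] at hf
    obtain ⟨d, hd⟩ := hf
    refine ⟨f.map (stalkEquiv (π w)).toRingHom, ⟨stalkEquiv w d, Subtype.property _, ?_⟩, ?_, ?_⟩
    · rw [key, hd, map_mul]; rfl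
    · rw [Polynomial.derivative_map, key]
      exact hne _ hf'.ne_zero
    · rw [Polynomial.derivative_map, key]
      exact inv_mem_stalkSubring hf'

end TameDescent
end ZariskiForms

namespace ZariskiForms

/-! ### Generic stalks of a sheaf of modules and of its dual -/

section GenericModel

variable {X : Scheme.{u}} [IsIntegral X]

/-- A model of the generic stalk of a sheaf of modules `M` on an integral scheme: a vector space
over the function field with evaluation maps from the sections of `M` over all nonempty opens, such
that every section with value zero vanishes on a nonempty open and every vector is a value. -/
structure GenericModel (M : X.Modules) (V : Type u) [AddCommGroup V] [Module X.functionField V] where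
  ev (U : X.Opens) (hU : genericPoint X ∈ U) : Γ(M, U) →ₛₗ[(ffGerm U hU).hom] V
  ev_map {U U' : X.Opens} (hU' : genericPoint X ∈ U') (h : U' ≤ U) (s : Γ(M, U)) :
    ev U' hU' (M.presheaf.map (homOfLE h).op s) = ev U (h hU') s
  exists_map_eq_zero (U : X.Opens) (hU : genericPoint X ∈ U) (s : Γ(M, U)) (hs : ev U hU s = 0) :
    ∃ (U' : X.Opens) (h : U' ≤ U), genericPoint X ∈ U' ∧ M.presheaf.map (homOfLE h).op s = 0
  exists_ev (v : V) : ∃ (U : X.Opens) (hU : genericPoint X ∈ U) (s : Γ(M, U)), ev U hU s = v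

namespace GenericModel

variable {M : X.Modules} {V : Type u} [AddCommGroup V] [Module X.functionField V]
  (E : GenericModel M V)

lemma exists_ev_le (v : V) {U : X.Opens} (hU : genericPoint X ∈ U) :
    ∃ (U' : X.Opens) (_ : U' ≤ U) (hU' : genericPoint X ∈ U') (s : Γ(M, U')), E.ev U' hU' s = v := by
  obtain ⟨U', hU', s, rfl⟩ := E.exists_ev v
  exact ⟨U' ⊓ U, inf_le_right, ⟨hU', hU⟩, M.presheaf.map (homOfLE inf_le_left).op s,
    E.ev_map _ _ _⟩

lemma exists_map_eq {U : X.Opens} (hU : genericPoint X ∈ U) {s t : Γ(M, U)}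
    (h : E.ev U hU s = E.ev U hU t) : ∃ (U' : X.Opens) (h : U' ≤ U), genericPoint X ∈ U' ∧
      M.presheaf.map (homOfLE h).op s = M.presheaf.map (homOfLE h).op t := by
  obtain ⟨U', h', hU', h0⟩ := E.exists_map_eq_zero U hU (s - t) (by rw [map_sub, h, sub_self])
  refine ⟨U', h', hU', ?_⟩
  rwa [map_sub, sub_eq_zero] at h0

/-- The vectors that are values of sections near `x`. -/
def stalk (x : X) : Set V :=
  {v | ∃ (U : X.Opens) (hx : x ∈ U) (s : Γ(M, U)), E.ev U (genericPoint_mem hx) s = v}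

/-- Sections with equal generic value agree on a smaller nonempty open, and generic germs of
functions do not change under restriction. Hence a section of the dual induces a well-defined
functional on the generic stalk. -/
lemma ffGerm_dualEval_congr {U : X.Opens} (φ : dualSections M U) {U₁ U₂ : X.Opens} (h₁ : U₁ ≤ U)
    (h₂ : U₂ ≤ U) (hU₁ : genericPoint X ∈ U₁) (hU₂ : genericPoint X ∈ U₂) (s₁ : Γ(M, U₁))
    (s₂ : Γ(M, U₂)) (h : E.ev U₁ hU₁ s₁ = E.ev U₂ hU₂ s₂) :
    ffGerm U₁ hU₁ (dualEval φ h₁ s₁) = ffGerm U₂ hU₂ (dualEval φ h₂ s₂) := by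
  have hU₁₂ : genericPoint X ∈ U₁ ⊓ U₂ := ⟨hU₁, hU₂⟩
  obtain ⟨W, hW, hη, h0⟩ := E.exists_map_eq hU₁₂
    (s := M.presheaf.map (homOfLE inf_le_left).op s₁)
    (t := M.presheaf.map (homOfLE inf_le_right).op s₂) (by rw [E.ev_map, E.ev_map, h])
  rw [map_map_mod, map_map_mod] at h0
  rw [← ffGerm_map hη (hW.trans inf_le_left), ← ffGerm_map hη (hW.trans inf_le_right),
    ← dualEval_map, ← dualEval_map, h0]

lemma exists_dual {U : X.Opens} (hU : genericPoint X ∈ U) (φ : dualSections M U) :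
    ∃ f : Module.Dual X.functionField V, ∀ (U' : X.Opens) (h : U' ≤ U) (hU' : genericPoint X ∈ U')
      (s : Γ(M, U')), f (E.ev U' hU' s) = ffGerm U' hU' (dualEval φ h s) := by
  choose W hW hη s hs using fun v : V ↦ E.exists_ev_le v hU
  have key : ∀ (v : V) (U' : X.Opens) (h : U' ≤ U) (hU' : genericPoint X ∈ U') (t : Γ(M, U')),
      E.ev U' hU' t = v → ffGerm (W v) (hη v) (dualEval φ (hW v) (s v)) =
        ffGerm U' hU' (dualEval φ h t) := fun v U' h hU' t ht ↦
    E.ffGerm_dualEval_congr φ _ _ _ _ _ _ ((hs v).trans ht.symm)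
  refine ⟨{ toFun := fun v ↦ ffGerm (W v) (hη v) (dualEval φ (hW v) (s v))
            map_add' := fun v w ↦ ?_
            map_smul' := fun c v ↦ ?_ }, fun U' h hU' t ↦ key _ U' h hU' t rfl⟩
  · have h1 : genericPoint X ∈ W v ⊓ W w := ⟨hη v, hη w⟩
    rw [key (v + w) (W v ⊓ W w) (inf_le_left.trans (hW v)) h1
      (M.presheaf.map (homOfLE inf_le_left).op (s v) +
        M.presheaf.map (homOfLE inf_le_right).op (s w))
      (by rw [map_add, E.ev_map, E.ev_map, hs, hs]), map_add, map_add, dualEval_map _ _ (hW v),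
      dualEval_map _ _ (hW w), ffGerm_map, ffGerm_map]
  · obtain ⟨U₀, hU₀, r, rfl⟩ := X.presheaf.exists_germ_eq c
    have h1 : genericPoint X ∈ U₀ ⊓ W v := ⟨hU₀, hη v⟩
    have h2 : ffGerm (U₀ ⊓ W v) h1 (X.presheaf.map (homOfLE inf_le_left).op r) =
        ffGerm U₀ hU₀ r := ffGerm_map _ _ _
    rw [key _ (U₀ ⊓ W v) (inf_le_right.trans (hW v)) h1
      (X.presheaf.map (homOfLE inf_le_left).op r • M.presheaf.map (homOfLE inf_le_right).op (s v))
      (by rw [map_smulₛₗ, E.ev_map, hs]; exact congrArg (· • v) h2), map_smul, smul_eq_mul, map_mul,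
      h2, dualEval_map _ _ (hW v), ffGerm_map]
    rfl

/-- The functional on the generic stalk induced by a section of the dual. -/
noncomputable def dualEv {U : X.Opens} (hU : genericPoint X ∈ U) (φ : dualSections M U) :
    Module.Dual X.functionField V := (E.exists_dual hU φ).choose

lemma dualEv_ev {U : X.Opens} (hU : genericPoint X ∈ U) (φ : dualSections M U) {U' : X.Opens}
    (h : U' ≤ U) (hU' : genericPoint X ∈ U') (s : Γ(M, U')) :
    E.dualEv hU φ (E.ev U' hU' s) = ffGerm U' hU' (dualEval φ h s) :=
  (E.exists_dual hU φ).choose_spec U' h hU' s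

lemma dual_ext_ev {U : X.Opens} (hU : genericPoint X ∈ U) {f g : Module.Dual X.functionField V}
    (h : ∀ (U' : X.Opens) (_ : U' ≤ U) (hU' : genericPoint X ∈ U') (s : Γ(M, U')),
      f (E.ev U' hU' s) = g (E.ev U' hU' s)) : f = g := by
  ext v
  obtain ⟨U', h', hU', s, rfl⟩ := E.exists_ev_le v hU
  exact h U' h' hU' s

lemma dualEv_add {U : X.Opens} (hU : genericPoint X ∈ U) (φ ψ : dualSections M U) :
    E.dualEv hU (φ + ψ) = E.dualEv hU φ + E.dualEv hU ψ :=
  E.dual_ext_ev hU fun U' h hU' s ↦ by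
    rw [E.dualEv_ev hU _ h, LinearMap.add_apply, E.dualEv_ev hU _ h, E.dualEv_ev hU _ h]
    exact map_add (ffGerm U' hU').hom _ _

lemma dualEv_smul {U : X.Opens} (hU : genericPoint X ∈ U) (r : Γ(X, U)) (φ : dualSections M U) :
    E.dualEv hU (r • φ) = ffGerm U hU r • E.dualEv hU φ :=
  E.dual_ext_ev hU fun U' h hU' s ↦ by
    rw [E.dualEv_ev hU _ h, LinearMap.smul_apply, E.dualEv_ev hU _ h]
    refine (map_mul (ffGerm U' hU').hom _ _).trans ?_
    exact congrArg (· * _) (ffGerm_map hU' h r)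

lemma dualEv_res {U U' : X.Opens} (hU' : genericPoint X ∈ U') (h : U' ≤ U)
    (φ : dualSections M U) : E.dualEv hU' (dualRes M U U' h φ) = E.dualEv (h hU') φ :=
  E.dual_ext_ev hU' fun W hW hη s ↦ by
    rw [E.dualEv_ev _ _ hW, E.dualEv_ev _ _ (hW.trans h)]
    rfl

lemma subsingleton_section {U : X.Opens} (hU : genericPoint X ∉ U) : Subsingleton Γ(X, U) := by
  obtain rfl := eq_bot_of_genericPoint_notMem hU
  infer_instance

/-- Functions on an integral scheme are determined by their generic germ; this holds even if `M` has
torsion, since only the values of functionals matter. -/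
lemma dualEv_injective {U : X.Opens} (hU : genericPoint X ∈ U) :
    Function.Injective (E.dualEv (M := M) hU) := by
  intro φ ψ h
  refine dual_ext fun W hW s ↦ ?_
  by_cases hη : genericPoint X ∈ W
  · apply ffGerm_injective W hη
    rw [← E.dualEv_ev hU, ← E.dualEv_ev hU, h]
  · have := subsingleton_section hη
    exact Subsingleton.elim _ _

lemma dualEv_mem {U : X.Opens} (hU : genericPoint X ∈ U) (φ : dualSections M U) {x : X}
    (hx : x ∈ U) {v : V} (hv : v ∈ E.stalk x) : E.dualEv hU φ v ∈ stalkSubring x := by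
  obtain ⟨U', hx', s, rfl⟩ := hv
  have h1 : x ∈ U' ⊓ U := ⟨hx', hx⟩
  rw [← E.ev_map (U' := U' ⊓ U) (genericPoint_mem h1) inf_le_left, E.dualEv_ev _ _ inf_le_right]
  exact ffGerm_mem_stalkSubring h1 _

/-- A functional that is regular on all stalks sends the generic value of a section of `M` to a
rational function regular on the same open, hence to a section of `𝒪_X`. -/
lemma exists_dualEv_eq {U : X.Opens} (hU : genericPoint X ∈ U) (f : Module.Dual X.functionField V)
    (hf : ∀ x ∈ U, ∀ v ∈ E.stalk x, f v ∈ stalkSubring x) : ∃ φ, E.dualEv hU φ = f := by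
  have key : ∀ (W : X.Opens) (_ : W ≤ U) (s : Γ(M, W)), ∃ r : Γ(X, W),
      ∀ hη : genericPoint X ∈ W, ffGerm W hη r = f (E.ev W hη s) := by
    intro W hW s
    by_cases hη : genericPoint X ∈ W
    · obtain ⟨r, hr⟩ := exists_ffGerm_eq_of_forall_mem hη (c := f (E.ev W hη s))
        fun x hx ↦ hf x (hW hx) _ ⟨W, hx, s, rfl⟩
      exact ⟨r, fun _ ↦ hr⟩
    -- Over the empty open any value will do, since the ring of sections is zero.
    · exact ⟨0, fun h ↦ absurd h hη⟩
  choose g hg using key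
  have hext : ∀ (W : X.Opens) (r r' : Γ(X, W)),
      (∀ hη : genericPoint X ∈ W, ffGerm W hη r = ffGerm W hη r') → r = r' := by
    intro W r r' h
    by_cases hη : genericPoint X ∈ W
    · exact ffGerm_injective W hη (h hη)
    · have := subsingleton_section hη
      exact Subsingleton.elim _ _
  refine ⟨dualMk M g (fun W hW s t ↦ hext W _ _ fun hη ↦ ?_)
    (fun W hW r s ↦ hext W _ _ fun hη ↦ ?_) (fun W W' hW h s ↦ hext W' _ _ fun hη ↦ ?_),
    E.dual_ext_ev hU fun W hW hη s ↦ ?_⟩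
  · rw [map_add, hg, hg, hg, map_add, map_add]
  · rw [map_mul, hg, hg, map_smulₛₗ, map_smul]; rfl
  · rw [hg, ffGerm_map, hg, E.ev_map]
  · rw [E.dualEv_ev hU _ hW]
    exact hg W hW s hη

/-- The dual of a generic model, provided every functional is regular on some nonempty open. -/
noncomputable def dualModel (hE : ∀ f : Module.Dual X.functionField V, ∃ U : X.Opens,
      genericPoint X ∈ U ∧ ∀ x ∈ U, ∀ v ∈ E.stalk x, f v ∈ stalkSubring x) :
    GenericModel (dual M) (Module.Dual X.functionField V) where
  ev U hU :=
    { toFun := fun φ : dualSections M U ↦ E.dualEv hU φ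
      map_add' := E.dualEv_add hU
      map_smul' := E.dualEv_smul hU }
  ev_map hU' h φ := E.dualEv_res hU' h φ
  exists_map_eq_zero U hU φ hφ := by
    -- No shrinking is needed: the dual has no torsion.
    refine ⟨U, le_rfl, hU, ?_⟩
    have h0 : E.dualEv hU (φ : dualSections M U) = E.dualEv hU (0 : dualSections M U) := by
      refine Eq.trans hφ (E.dual_ext_ev hU fun U' h hU' s ↦ ?_)
      rw [E.dualEv_ev hU _ h]
      exact (map_zero (ffGerm U' hU').hom).symm
    have : φ = (0 : dualSections M U) := E.dualEv_injective hU h0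
    rw [this]
    exact map_zero _
  exists_ev f := by
    obtain ⟨U, hU, hf⟩ := hE f
    obtain ⟨φ, hφ⟩ := E.exists_dualEv_eq hU f hf
    exact ⟨U, hU, φ, hφ⟩

end GenericModel
end GenericModel
end ZariskiForms

namespace ZariskiForms
-- Sections of a sheafification, locally
section Sheafify
variable {X : Scheme.{u}} (P : X.PresheafOfModules)

lemma exists_toSheafify_eq {U : X.Opens} (s : Γ(sheafify P, U)) {x : X} (hx : x ∈ U) :
    ∃ (V : X.Opens) (h : V ≤ U) (_ : x ∈ V) (t : P.obj (op V)),
      (toSheafify P).app (op V) t = (sheafify P).presheaf.map (homOfLE h).op s := by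
  have : Presheaf.IsLocallySurjective (Opens.grothendieckTopology X)
    (CategoryTheory.toSheafify (Opens.grothendieckTopology X) P.presheaf) := inferInstance
  obtain ⟨V, f, ⟨t, ht⟩, hxV⟩ := this.imageSieve_mem (U := U) s x hx
  exact ⟨V, f.le, hxV, t, ht⟩

lemma exists_map_eq_zero_of_toSheafify {U : X.Opens} (t : P.obj (op U))
    (ht : (toSheafify P).app (op U) t = 0) {x : X} (hx : x ∈ U) :
    ∃ (V : X.Opens) (h : V ≤ U) (_ : x ∈ V), P.map (homOfLE h).op t = 0 := by
  have : Presheaf.IsLocallyInjective (Opens.grothendieckTopology X)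
    (CategoryTheory.toSheafify (Opens.grothendieckTopology X) P.presheaf) := inferInstance
  obtain ⟨V, f, hf, hxV⟩ := this.equalizerSieve_mem (X := op U) t 0 (ht.trans (map_zero _).symm) x hx
  refine ⟨V, f.le, hxV, ?_⟩
  exact Eq.trans hf (map_zero _)

lemma toSheafify_map {U V : X.Opens} (h : V ≤ U) (t : P.obj (op U)) :
    (toSheafify P).app (op V) (P.map (homOfLE h).op t) =
      (sheafify P).presheaf.map (homOfLE h).op ((toSheafify P).app (op U) t) :=
  PresheafOfModules.naturality_apply (toSheafify P) (homOfLE h).op t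

lemma sheafifyDesc_toSheafify {P : X.PresheafOfModules} {M : X.Modules}
    (f : P ⟶ M.val) (U : X.Opens) (t : P.obj (op U)) :
    (sheafifyDesc f).app U ((toSheafify P).app (op U) t) = f.app (op U) t := by
  have h : toSheafify P ≫ (sheafifyDesc f).val = f := by
    have := (PresheafOfModules.sheafificationAdjunction (𝟙 X.ringCatSheaf.obj)).homEquiv_unit P M
      (sheafifyDesc f)
    exact this.symm.trans (Equiv.apply_symm_apply _ f)
  exact congr($(congr($(h).app (op U))) t)

end Sheafify

/-! ### The rational form attached to a section of the sheaf of forms -/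

section FormsModel

variable {k : Type u} [Field k] {X : Scheme.{u}} [IsIntegral X] (a : X ⟶ Spec (.of k)) (p : ℕ)

/-- The space of rational `p`-forms. -/
noncomputable abbrev RatForms := ⋀[X.functionField]^p (CommRingCat.KaehlerDifferential (ffStructure a))

/-- The rational form defined by a form over the sections on a nonempty open. -/
noncomputable def ratForm (U : X.Opens) (hU : genericPoint X ∈ U) :
    ⋀[Γ(X, U)]^p (CommRingCat.KaehlerDifferential (structureMap a U)) →ₛₗ[(ffGerm U hU).hom]
      RatForms a p :=
  formsMap p (ffGerm U hU) (structureMap_ffGerm a hU)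

variable {a p} in
lemma ratForm_map {U V : X.Opens} (hV : genericPoint X ∈ V) (h : V ≤ U)
    (t : (formsPresheaf a p).obj (op U)) :
    ratForm a p V hV ((formsPresheaf a p).map (homOfLE h).op t) = ratForm a p U (h hV) t :=
  (formsMap_comp p (X.presheaf.map (homOfLE h).op) (structureMap_map a h) (ffGerm V hV)
    (structureMap_ffGerm a hV) (ffGerm U (h hV)) (structureMap_ffGerm a (h hV))
    (X.presheaf.germ_res (homOfLE h) _ hV) t).symm

variable {a p} in
-- Shrink to an affine open, where the function field is the fraction field of the sections. There
-- the kernel of the map to rational forms is torsion, and a form killed by `r ≠ 0` vanishes where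
-- `r` is invertible.
lemma exists_map_eq_zero_of_ratForm {U : X.Opens} (hU : genericPoint X ∈ U)
    (t : (formsPresheaf a p).obj (op U)) (ht : ratForm a p U hU t = 0) :
    ∃ (V : X.Opens) (h : V ≤ U) (_ : genericPoint X ∈ V),
      (formsPresheaf a p).map (homOfLE h).op t = 0 := by
  obtain ⟨_, ⟨V, hV, rfl⟩, hηV, hVU⟩ :=
    X.isBasis_affineOpens.exists_subset_of_mem_open hU U.isOpen
  have : Nonempty V := ⟨⟨_, hηV⟩⟩
  have hfr := functionField_isFractionRing_of_isAffineOpen X V hV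
  have hVU' : V ≤ U := hVU
  let t' : ⋀[Γ(X, V)]^p (CommRingCat.KaehlerDifferential (structureMap a V)) :=
    (formsPresheaf a p).map (homOfLE hVU').op t
  have ht' : extMap p (kaehlerMap (ffGerm V hηV) (structureMap_ffGerm a hηV)) t' = 0 :=
    (ratForm_map hηV hVU' t).trans ht
  have hdiv : ∀ x : X.functionField, ∃ r s : Γ(X, V), s ≠ 0 ∧ ffGerm V hηV s * x = ffGerm V hηV r := by
    intro x
    obtain ⟨r, s, hs, rfl⟩ := IsFractionRing.div_surjective (A := Γ(X, V)) x
    have hs0 := nonZeroDivisors.ne_zero hs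
    refine ⟨r, s, hs0, ?_⟩
    rw [mul_comm]
    refine div_mul_cancel₀ _ fun h ↦ hs0 (ffGerm_injective V hηV (h.trans (map_zero _).symm))
  have hspan : Submodule.span X.functionField (Set.range
      (kaehlerMap (ffGerm V hηV) (structureMap_ffGerm a hηV))) = ⊤ := by
    rw [eq_top_iff, ← span_kaehlerD, Submodule.span_le]
    rintro _ ⟨c, rfl⟩
    obtain ⟨r, s, hs, rfl⟩ := IsFractionRing.div_surjective (A := Γ(X, V)) c
    have h1 : ∀ r : Γ(X, V), kaehlerD (ffStructure a) (algebraMap Γ(X, V) X.functionField r) ∈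
        Submodule.span X.functionField (Set.range
          (kaehlerMap (ffGerm V hηV) (structureMap_ffGerm a hηV))) := fun r ↦
      Submodule.subset_span ⟨_, kaehlerMap_d _ _ r⟩
    rw [SetLike.mem_coe, derivation_div]
    exact Submodule.smul_mem _ _ (sub_mem (Submodule.smul_mem _ _ (h1 _))
      (Submodule.smul_mem _ _ (h1 _)))
  obtain ⟨r, hr, hrt⟩ := exists_smul_eq_zero_of_extMap hdiv (ffGerm_injective V hηV) _ hspan
    (fun m hm ↦ exists_smul_eq_zero_of_kaehlerMap _ _ hfr m hm) p t' ht'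
  have hle : X.basicOpen r ≤ V := X.basicOpen_le r
  have hη : genericPoint X ∈ X.basicOpen r := by
    rw [Scheme.mem_basicOpen _ _ _ hηV, isUnit_iff_ne_zero]
    exact fun h ↦ hr (ffGerm_injective V hηV (h.trans (map_zero _).symm))
  refine ⟨X.basicOpen r, hle.trans hVU', hη, ?_⟩
  have hu : IsUnit (X.presheaf.map (homOfLE hle).op r) :=
    RingedSpace.isUnit_res_basicOpen X.toRingedSpace r
  let t'' : ⋀[Γ(X, X.basicOpen r)]^p
      (CommRingCat.KaehlerDifferential (structureMap a (X.basicOpen r))) :=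
    formsMap p (X.presheaf.map (homOfLE hle).op) (structureMap_map a hle) t'
  have h1 : X.presheaf.map (homOfLE hle).op r • t'' = 0 := by
    refine ((formsMap p (X.presheaf.map (homOfLE hle).op) (structureMap_map a hle)).map_smulₛₗ
      r t').symm.trans ?_
    rw [hrt, map_zero]
  have h2 : t'' = 0 := (hu.smul_eq_zero).1 h1
  refine Eq.trans ?_ h2
  exact (formsMap_comp p _ _ _ _ _ _ (X.presheaf.map_comp (homOfLE hVU').op
    (homOfLE hle).op).symm t)

variable {a p} in
lemma ratForm_congr {U : X.Opens} (s : Γ(forms a p, U)) {V₁ V₂ : X.Opens} (h₁ : V₁ ≤ U)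
    (h₂ : V₂ ≤ U) (hV₁ : genericPoint X ∈ V₁) (hV₂ : genericPoint X ∈ V₂)
    (t₁ : (formsPresheaf a p).obj (op V₁)) (t₂ : (formsPresheaf a p).obj (op V₂))
    (ht₁ : (toSheafify (formsPresheaf a p)).app (op V₁) t₁ =
      (forms a p).presheaf.map (homOfLE h₁).op s)
    (ht₂ : (toSheafify (formsPresheaf a p)).app (op V₂) t₂ =
      (forms a p).presheaf.map (homOfLE h₂).op s) :
    ratForm a p V₁ hV₁ t₁ = ratForm a p V₂ hV₂ t₂ := by
  have hη : genericPoint X ∈ V₁ ⊓ V₂ := ⟨hV₁, hV₂⟩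
  have hle₁ : V₁ ⊓ V₂ ≤ V₁ := inf_le_left
  have hle₂ : V₁ ⊓ V₂ ≤ V₂ := inf_le_right
  let x₁ : (formsPresheaf a p).obj (op (V₁ ⊓ V₂)) := (formsPresheaf a p).map (homOfLE hle₁).op t₁
  let x₂ : (formsPresheaf a p).obj (op (V₁ ⊓ V₂)) := (formsPresheaf a p).map (homOfLE hle₂).op t₂
  let u := x₁ - x₂
  have hu : (toSheafify (formsPresheaf a p)).app (op (V₁ ⊓ V₂)) u = 0 := by
    have e₁ := (toSheafify_map (formsPresheaf a p) hle₁ t₁).trans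
      ((congrArg _ ht₁).trans (map_map_mod h₁ hle₁ s))
    have e₂ := (toSheafify_map (formsPresheaf a p) hle₂ t₂).trans
      ((congrArg _ ht₂).trans (map_map_mod h₂ hle₂ s))
    refine (map_sub ((toSheafify (formsPresheaf a p)).app (op (V₁ ⊓ V₂))).hom x₁ x₂).trans ?_
    exact sub_eq_zero.2 (e₁.trans e₂.symm)
  obtain ⟨W, hW, hηW, h0⟩ := exists_map_eq_zero_of_toSheafify _ u hu hη
  have h1 : ratForm a p (V₁ ⊓ V₂) hη u = 0 := by
    rw [← ratForm_map hηW hW, h0]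
    exact map_zero (ratForm a p W hηW)
  rw [← ratForm_map hη hle₁, ← ratForm_map hη hle₂]
  refine sub_eq_zero.1 (Eq.trans ?_ h1)
  exact (map_sub (ratForm a p (V₁ ⊓ V₂) hη) x₁ x₂).symm

variable {a p} in
lemma exists_formsEv {U : X.Opens} (hU : genericPoint X ∈ U) (s : Γ(forms a p, U)) :
    ∃ v : RatForms a p, ∀ (V : X.Opens) (h : V ≤ U) (hV : genericPoint X ∈ V)
      (t : (formsPresheaf a p).obj (op V)), (toSheafify (formsPresheaf a p)).app (op V) t =
        (forms a p).presheaf.map (homOfLE h).op s → ratForm a p V hV t = v := by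
  obtain ⟨V₀, h₀, hV₀, t₀, ht₀⟩ := exists_toSheafify_eq (formsPresheaf a p) s hU
  exact ⟨ratForm a p V₀ hV₀ t₀, fun V h hV t ht ↦ ratForm_congr s h h₀ hV hV₀ t t₀ ht ht₀⟩

/-- The rational form defined by a section of the sheaf of forms. -/
noncomputable def formsEv (U : X.Opens) (hU : genericPoint X ∈ U) (s : Γ(forms a p, U)) :
    RatForms a p := (exists_formsEv hU s).choose

variable {a p} in
lemma formsEv_eq {U : X.Opens} (hU : genericPoint X ∈ U) (s : Γ(forms a p, U)) {V : X.Opens}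
    (h : V ≤ U) (hV : genericPoint X ∈ V) (t : (formsPresheaf a p).obj (op V))
    (ht : (toSheafify (formsPresheaf a p)).app (op V) t =
      (forms a p).presheaf.map (homOfLE h).op s) : formsEv a p U hU s = ratForm a p V hV t :=
  ((exists_formsEv hU s).choose_spec V h hV t ht).symm

variable {a p} in
lemma formsEv_toSheafify {U : X.Opens} (hU : genericPoint X ∈ U)
    (t : (formsPresheaf a p).obj (op U)) :
    formsEv a p U hU ((toSheafify (formsPresheaf a p)).app (op U) t) = ratForm a p U hU t :=
  formsEv_eq hU _ le_rfl hU t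
    (congr($((forms a p).presheaf.map_id (op U)) ((toSheafify (formsPresheaf a p)).app (op U) t))).symm

variable {a p} in
lemma formsEv_map {U U' : X.Opens} (hU' : genericPoint X ∈ U') (h : U' ≤ U) (s : Γ(forms a p, U)) :
    formsEv a p U' hU' ((forms a p).presheaf.map (homOfLE h).op s) = formsEv a p U (h hU') s := by
  obtain ⟨V, hV, hη, t, ht⟩ := exists_toSheafify_eq (formsPresheaf a p)
    ((forms a p).presheaf.map (homOfLE h).op s) hU'
  rw [formsEv_eq hU' _ hV hη t ht]
  exact (formsEv_eq (h hU') s (hV.trans h) hη t (ht.trans (map_map_mod h hV s))).symm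

variable {a p} in
lemma formsEv_add {U : X.Opens} (hU : genericPoint X ∈ U) (s t : Γ(forms a p, U)) :
    formsEv a p U hU (s + t) = formsEv a p U hU s + formsEv a p U hU t := by
  obtain ⟨V, hV, hη, x, hx⟩ := exists_toSheafify_eq (formsPresheaf a p) s hU
  obtain ⟨V', hV', hη', y, hy⟩ := exists_toSheafify_eq (formsPresheaf a p)
    ((forms a p).presheaf.map (homOfLE hV).op t) hη
  rw [← formsEv_map hη' (hV'.trans hV) s, ← formsEv_map hη' (hV'.trans hV) t,
    ← formsEv_map hη' (hV'.trans hV) (s + t), map_add]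
  have hx' := (toSheafify_map _ hV' x).trans ((congrArg _ hx).trans (map_map_mod hV hV' s))
  have hy' := hy.trans (map_map_mod hV hV' t)
  refine (congrArg (formsEv a p V' hη') (congrArg₂ (· + ·) hx'.symm hy'.symm)).trans ?_
  refine (congrArg (formsEv a p V' hη')
    (map_add ((toSheafify (formsPresheaf a p)).app (op V')).hom _ y).symm).trans ?_
  refine (formsEv_toSheafify hη' _).trans ?_
  refine (map_add (ratForm a p V' hη') _ y).trans ?_
  exact congrArg₂ (· + ·) ((formsEv_toSheafify hη' _).symm.trans (congrArg _ hx'))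
    ((formsEv_toSheafify hη' _).symm.trans (congrArg _ hy'))

variable {a p} in
lemma formsEv_smul {U : X.Opens} (hU : genericPoint X ∈ U) (r : Γ(X, U)) (s : Γ(forms a p, U)) :
    formsEv a p U hU (r • s) = ffGerm U hU r • formsEv a p U hU s := by
  obtain ⟨V, hV, hη, x, hx⟩ := exists_toSheafify_eq (formsPresheaf a p) s hU
  rw [← formsEv_map hη hV s, ← formsEv_map hη hV (r • s), Scheme.Modules.map_smul]
  refine (congrArg (formsEv a p V hη)
    (congrArg (fun y : Γ(forms a p, V) ↦ X.presheaf.map (homOfLE hV).op r • y) hx.symm)).trans ?_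
  refine (congrArg (formsEv a p V hη)
    (((toSheafify (formsPresheaf a p)).app (op V)).hom.map_smul
      (X.presheaf.map (homOfLE hV).op r) x).symm).trans ?_
  refine (formsEv_toSheafify hη _).trans ?_
  refine ((ratForm a p V hη).map_smulₛₗ (X.presheaf.map (homOfLE hV).op r) x).trans ?_
  exact congrArg₂ (fun (c : X.functionField) (v : RatForms a p) ↦ c • v) (ffGerm_map hη hV r)
    ((formsEv_toSheafify hη _).symm.trans (congrArg _ hx))

variable {a p} in
lemma exists_map_eq_zero_of_formsEv {U : X.Opens} (hU : genericPoint X ∈ U) (s : Γ(forms a p, U))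
    (hs : formsEv a p U hU s = 0) : ∃ (V : X.Opens) (h : V ≤ U), genericPoint X ∈ V ∧
      (forms a p).presheaf.map (homOfLE h).op s = 0 := by
  obtain ⟨V, hV, hη, x, hx⟩ := exists_toSheafify_eq (formsPresheaf a p) s hU
  obtain ⟨W, hW, hηW, h0⟩ := exists_map_eq_zero_of_ratForm hη x
    ((formsEv_eq hU s hV hη x hx).symm.trans hs)
  refine ⟨W, hW.trans hV, hηW, ?_⟩
  rw [← map_map_mod hV hW]
  refine (congrArg _ hx.symm).trans ((toSheafify_map (formsPresheaf a p) hW x).symm.trans ?_)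
  rw [h0]
  exact map_zero _

end FormsModel
end ZariskiForms

namespace ZariskiForms

/-! ### Stalks of the sheaf of forms as lattices of rational forms -/

section FormsStalk

lemma smul_mem_of_mem_subring {K V : Type*} [Field K] [AddCommGroup V] [Module K V] {O : Subring K}
    {N : Submodule O V} {c : K} (hc : c ∈ O) {v : V} (hv : v ∈ N) : c • v ∈ N :=
  N.smul_mem ⟨c, hc⟩ hv

lemma exists_opens_of_eventually {X : Scheme.{u}} {x : X} {q : X → Prop} (h : ∀ᶠ y in nhds x, q y) :
    ∃ U : X.Opens, x ∈ U ∧ ∀ y ∈ U, q y := by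
  obtain ⟨U, hU, hUo, hx⟩ := mem_nhds_iff.1 h
  exact ⟨⟨U, hUo⟩, hx, hU⟩

variable {k : Type u} [Field k] {X : Scheme.{u}} [IsIntegral X] (a : X ⟶ Spec (.of k)) (p : ℕ)

lemma eventually_mem_stalkSubring {x : X} {c : X.functionField} (hc : c ∈ stalkSubring x) :
    ∀ᶠ y in nhds x, c ∈ stalkSubring y := by
  obtain ⟨U, hx, s, rfl⟩ := exists_ffGerm_eq hc
  exact Filter.eventually_of_mem (U.isOpen.mem_nhds hx) fun y hy ↦ ffGerm_mem_stalkSubring hy s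

lemma mem_stalkSubring_genericPoint (c : X.functionField) : c ∈ stalkSubring (genericPoint X) := by
  obtain ⟨U, hU, s, rfl⟩ := X.presheaf.exists_germ_eq c
  exact ffGerm_mem_stalkSubring hU s

/-- The lattice of rational forms that are regular at `x`. -/
noncomputable abbrev stalkForms (x : X) : Submodule (stalkSubring x) (RatForms a p) :=
  formsLattice (kaehlerD (ffStructure a)) p (stalkSubring x)

variable {a p}

lemma ratForm_mem_stalkForms {U : X.Opens} {x : X} (hx : x ∈ U)
    (t : ⋀[Γ(X, U)]^p (CommRingCat.KaehlerDifferential (structureMap a U))) :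
    ratForm a p U (genericPoint_mem hx) t ∈ stalkForms a p x := by
  let η := genericPoint_mem hx
  have hr : ∀ r : Γ(X, U), ffGerm U η r ∈ stalkSubring x := ffGerm_mem_stalkSubring hx
  have h1 : ∀ m, kaehlerMap (ffGerm U η) (structureMap_ffGerm a η) m ∈
      Submodule.span (stalkSubring x) (kaehlerD (ffStructure a) '' stalkSubring x) := by
    intro m
    have hm : m ∈ Submodule.span Γ(X, U) (Set.range (kaehlerD (structureMap a U))) := by
      let := (structureMap a U).hom.toAlgebra
      have := KaehlerDifferential.span_range_derivation k Γ(X, U)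
      exact this.ge trivial
    induction hm using Submodule.span_induction with
    | mem m hm =>
      obtain ⟨r, rfl⟩ := hm
      rw [kaehlerMap_kaehlerD]
      exact Submodule.subset_span ⟨_, hr r, rfl⟩
    | zero => rw [map_zero]; exact zero_mem _
    | add m n _ _ hm hn => rw [map_add]; exact add_mem hm hn
    | smul r m _ hm => rw [map_smulₛₗ]; exact smul_mem_of_mem_subring (hr r) hm
  have ht : t ∈ Submodule.span Γ(X, U) (Set.range (exteriorPower.ιMulti Γ(X, U) p)) := by
    rw [exteriorPower.ιMulti_span]; trivial
  induction ht using Submodule.span_induction with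
  | mem t ht =>
    obtain ⟨m, rfl⟩ := ht
    have : ratForm a p U η (exteriorPower.ιMulti Γ(X, U) p m) = exteriorPower.ιMulti _ p
      fun i ↦ kaehlerMap (ffGerm U η) (structureMap_ffGerm a η) (m i) := extMap_ιMulti p _ m
    rw [this]
    exact ιMulti_mem_span p _ _ _ fun i ↦ h1 (m i)
  | zero => rw [map_zero]; exact zero_mem _
  | add m n _ _ hm hn => rw [map_add]; exact add_mem hm hn
  | smul r m _ hm => rw [map_smulₛₗ]; exact smul_mem_of_mem_subring (hr r) hm

lemma formsEv_mem_stalkForms {U : X.Opens} {x : X} (hx : x ∈ U) (s : Γ(forms a p, U)) :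
    formsEv a p U (genericPoint_mem hx) s ∈ stalkForms a p x := by
  obtain ⟨V, hV, hxV, t, ht⟩ := exists_toSheafify_eq (formsPresheaf a p) s hx
  rw [formsEv_eq _ s hV (genericPoint_mem hxV) t ht]
  exact ratForm_mem_stalkForms hxV t

/-- A generator involves finitely many functions regular at `x`; they are sections of one
neighbourhood, and so is the wedge of their differentials. -/
lemma exists_formsEv_eq {x : X} {v : RatForms a p} (hv : v ∈ stalkForms a p x) :
    ∃ (U : X.Opens) (hx : x ∈ U) (s : Γ(forms a p, U)),
      formsEv a p U (genericPoint_mem hx) s = v := by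
  induction hv using Submodule.span_induction with
  | mem v hv =>
    obtain ⟨m, hm, rfl⟩ := hv
    choose c hc hc' using hm
    obtain ⟨U, hx, hU⟩ := exists_opens_of_eventually
      (Filter.eventually_all.2 fun i ↦ eventually_mem_stalkSubring (hc i))
    choose r hr using fun i ↦ exists_ffGerm_eq_of_forall_mem (genericPoint_mem hx)
      fun y hy ↦ hU y hy i
    let t : (formsPresheaf a p).obj (op U) :=
      (exteriorPower.ιMulti Γ(X, U) p fun i ↦ kaehlerD (structureMap a U) (r i) :
        ⋀[Γ(X, U)]^p (CommRingCat.KaehlerDifferential (structureMap a U)))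
    refine ⟨U, hx, (toSheafify (formsPresheaf a p)).app (op U) t, ?_⟩
    rw [formsEv_toSheafify]
    refine (extMap_ιMulti p _ _).trans ?_
    simp only [kaehlerMap_kaehlerD, hr, hc']
  | zero =>
    refine ⟨⊤, trivial, 0, ?_⟩
    have := formsEv_smul (a := a) (p := p) (U := ⊤) trivial 0 0
    rw [smul_zero, map_zero, zero_smul] at this
    exact this
  | add v w _ _ hv hw =>
    obtain ⟨U, hx, s, rfl⟩ := hv
    obtain ⟨U', hx', t, rfl⟩ := hw
    have hx'' : x ∈ U ⊓ U' := ⟨hx, hx'⟩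
    refine ⟨U ⊓ U', hx'', (forms a p).presheaf.map (homOfLE inf_le_left).op s +
      (forms a p).presheaf.map (homOfLE inf_le_right).op t, ?_⟩
    rw [formsEv_add, formsEv_map, formsEv_map]
  | smul c v _ hv =>
    obtain ⟨U, hx, s, rfl⟩ := hv
    obtain ⟨U', hx', r, hr⟩ := exists_ffGerm_eq c.2
    have hx'' : x ∈ U ⊓ U' := ⟨hx, hx'⟩
    have h₁ : U ⊓ U' ≤ U := inf_le_left
    have h₂ : U ⊓ U' ≤ U' := inf_le_right
    refine ⟨U ⊓ U', hx'', X.presheaf.map (homOfLE h₂).op r •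
      (forms a p).presheaf.map (homOfLE h₁).op s, ?_⟩
    rw [formsEv_smul, formsEv_map, ffGerm_map, hr]
    rfl

variable (a p)

/-- The generic stalk of the sheaf of forms is the space of rational forms. -/
noncomputable def formsModel : GenericModel (forms a p) (RatForms a p) where
  ev U hU :=
    { toFun := formsEv a p U hU
      map_add' := formsEv_add hU
      map_smul' := formsEv_smul hU }
  ev_map hU' h s := formsEv_map hU' h s
  exists_map_eq_zero U hU s hs := exists_map_eq_zero_of_formsEv hU s hs
  exists_ev v := by
    have hv : v ∈ Submodule.span X.functionField
        (stalkForms a p (genericPoint X) : Set (RatForms a p)) := by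
      rw [span_stalk_lattice]; trivial
    have h : v ∈ stalkForms a p (genericPoint X) := by
      induction hv using Submodule.span_induction with
      | mem v hv => exact hv
      | zero => exact zero_mem _
      | add v w _ _ hv hw => exact add_mem hv hw
      | smul c v _ hv => exact smul_mem_of_mem_subring (mem_stalkSubring_genericPoint c) hv
    obtain ⟨U, hU, s, hs⟩ := exists_formsEv_eq h
    exact ⟨U, hU, s, hs⟩

lemma mem_stalk_formsModel {x : X} {v : RatForms a p} :
    v ∈ (formsModel a p).stalk x ↔ v ∈ stalkForms a p x := by
  refine ⟨?_, fun h ↦ exists_formsEv_eq h⟩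
  rintro ⟨U, hx, s, rfl⟩
  exact formsEv_mem_stalkForms hx s

variable {a p}

/-- Near `x` all the lattices are generated by the same finitely many forms, so regularity of `f`
amounts to regularity of finitely many rational functions, an open condition. -/
lemma exists_opens_forall_stalkForms [LocallyOfFiniteType a] {x : X}
    (f : Module.Dual X.functionField (RatForms a p))
    (hf : ∀ v ∈ stalkForms a p x, f v ∈ stalkSubring x) :
    ∃ U : X.Opens, x ∈ U ∧ ∀ y ∈ U, ∀ v ∈ stalkForms a p y, f v ∈ stalkSubring y := by
  obtain ⟨U₀, hx, T, hT, h⟩ := exists_generators a x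
  let S : Set (Fin p → CommRingCat.KaehlerDifferential (ffStructure a)) :=
    {s | ∀ i, s i ∈ kaehlerD (ffStructure a) '' T}
  have hS : S.Finite := Set.Finite.pi' fun i ↦ hT.image _
  have hΛ : ∀ y ∈ U₀, stalkForms a p y = Submodule.span (stalkSubring y)
      (exteriorPower.ιMulti X.functionField p '' S) :=
    fun y hy ↦ formsLattice_eq_span _ p _ T (h y hy).1 (h y hy).2
  have h1 : ∀ᶠ y in nhds x, ∀ s ∈ S, f (exteriorPower.ιMulti X.functionField p s) ∈
      stalkSubring y := by
    rw [Filter.eventually_all_finite hS]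
    intro s hs
    refine eventually_mem_stalkSubring (hf _ ?_)
    rw [hΛ x hx]
    exact Submodule.subset_span ⟨s, hs, rfl⟩
  obtain ⟨U, hxU, hU⟩ := exists_opens_of_eventually
    (h1.and (Filter.eventually_of_mem (U₀.isOpen.mem_nhds hx) fun y hy ↦ hy))
  refine ⟨U, hxU, fun y hy v hv ↦ ?_⟩
  rw [hΛ y (hU y hy).2] at hv
  induction hv using Submodule.span_induction with
  | mem v hv =>
    obtain ⟨s, hs, rfl⟩ := hv
    exact (hU y hy).1 s hs
  | zero => rw [map_zero]; exact zero_mem _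
  | add v w _ _ hv hw => rw [map_add]; exact add_mem hv hw
  | smul c v _ hv =>
    change f ((c : X.functionField) • v) ∈ _
    rw [map_smul]
    exact mul_mem c.2 hv

end FormsStalk

/-! ### Sections of the bidual as rational forms regular in codimension one -/

section FormsBidual

variable {k : Type u} [Field k] {X : Scheme.{u}} [IsIntegral X] (a : X ⟶ Spec (.of k)) (p : ℕ)
  [LocallyOfFiniteType a]

/-- The generic stalk of the dual of the sheaf of forms. -/
noncomputable def formsDualModel :
    GenericModel (dual (forms a p)) (Module.Dual X.functionField (RatForms a p)) :=
  (formsModel a p).dualModel fun f ↦ by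
    obtain ⟨U, hU, h⟩ := exists_opens_forall_stalkForms f fun v _ ↦
      mem_stalkSubring_genericPoint (f v)
    exact ⟨U, hU, fun x hx v hv ↦ h x hx v ((mem_stalk_formsModel a p).1 hv)⟩

instance : Module.Finite X.functionField (RatForms a p) := by
  have := finite_kaehler a
  infer_instance

/-- The rational form defined by a section of the bidual of the sheaf of forms. -/
noncomputable def bidualEv (U : X.Opens) (hU : genericPoint X ∈ U) (m : Γ(formsBidual a p, U)) :
    RatForms a p :=
  (Module.evalEquiv X.functionField (RatForms a p)).symm ((formsDualModel a p).dualEv hU m)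

variable {a p}

lemma apply_bidualEv {U : X.Opens} (hU : genericPoint X ∈ U) (m : Γ(formsBidual a p, U))
    (f : Module.Dual X.functionField (RatForms a p)) :
    f (bidualEv a p U hU m) = (formsDualModel a p).dualEv hU m f :=
  Module.apply_evalEquiv_symm_apply X.functionField (RatForms a p) f _

lemma dualEv_bidualEv {U V : X.Opens} (hU : genericPoint X ∈ U) (m : Γ(formsBidual a p, U))
    (h : V ≤ U) (hV : genericPoint X ∈ V) (φ : Γ(dual (forms a p), V)) :
    (formsModel a p).dualEv hV φ (bidualEv a p U hU m) =
      ffGerm V hV (dualEval (M := dual (forms a p)) m h φ) := by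
  rw [apply_bidualEv]
  exact (formsDualModel a p).dualEv_ev hU m h hV φ

lemma bidualEv_eq_iff {U : X.Opens} (hU : genericPoint X ∈ U) (m : Γ(formsBidual a p, U))
    (v : RatForms a p) : bidualEv a p U hU m = v ↔ ∀ (V : X.Opens) (h : V ≤ U)
      (hV : genericPoint X ∈ V) (φ : Γ(dual (forms a p), V)),
      (formsModel a p).dualEv hV φ v = ffGerm V hV (dualEval (M := dual (forms a p)) m h φ) := by
  refine ⟨?_, fun H ↦ ?_⟩
  · rintro rfl V h hV φ
    exact dualEv_bidualEv hU m h hV φ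
  · rw [bidualEv, LinearEquiv.symm_apply_eq]
    refine (formsDualModel a p).dual_ext_ev hU fun V h hV φ ↦ ?_
    refine ((formsDualModel a p).dualEv_ev hU m h hV φ).trans ?_
    exact (H V h hV φ).symm

lemma bidualEv_injective {U : X.Opens} (hU : genericPoint X ∈ U) :
    Function.Injective (bidualEv a p U hU) := fun _ _ h ↦
  (formsDualModel a p).dualEv_injective hU (LinearEquiv.injective _ h)

lemma bidualEv_add {U : X.Opens} (hU : genericPoint X ∈ U) (m n : Γ(formsBidual a p, U)) :
    bidualEv a p U hU (m + n) = bidualEv a p U hU m + bidualEv a p U hU n :=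
  (congrArg _ ((formsDualModel a p).dualEv_add hU m n)).trans (map_add _ _ _)

lemma bidualEv_smul {U : X.Opens} (hU : genericPoint X ∈ U) (r : Γ(X, U))
    (m : Γ(formsBidual a p, U)) :
    bidualEv a p U hU (r • m) = ffGerm U hU r • bidualEv a p U hU m :=
  (congrArg _ ((formsDualModel a p).dualEv_smul hU r m)).trans (map_smul _ _ _)

lemma bidualEv_map {U U' : X.Opens} (hU' : genericPoint X ∈ U') (h : U' ≤ U)
    (m : Γ(formsBidual a p, U)) : bidualEv a p U' hU' ((formsBidual a p).presheaf.map
      (homOfLE h).op m) = bidualEv a p U (h hU') m :=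
  congrArg _ ((formsDualModel a p).dualEv_res hU' h m)

lemma bidualEv_toBidual {U : X.Opens} (hU : genericPoint X ∈ U) (s : Γ(forms a p, U)) :
    bidualEv a p U hU ((toBidual (forms a p)).app U s) = formsEv a p U hU s := by
  refine (bidualEv_eq_iff hU _ _).2 fun V h hV φ ↦ ?_
  rw [toBidual_eval]
  refine Eq.trans ?_ ((formsModel a p).dualEv_ev hV φ le_rfl hV _)
  exact congrArg _ ((formsModel a p).ev_map hV h s).symm

/-- On a normal scheme, the sections of the bidual of the sheaf of forms are the rational forms that
are regular in codimension one. -/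
lemma mem_range_bidualEv [IsNormalScheme X] [IsLocallyNoetherian X] {U : X.Opens}
    (hU : genericPoint X ∈ U) (v : RatForms a p) : v ∈ Set.range (bidualEv a p U hU) ↔
      ∀ x ∈ U, IsCodimOne x → v ∈ stalkForms a p x := by
  constructor
  · rintro ⟨m, rfl⟩ x hx hx1
    have := isDiscreteValuationRing_stalkSubring hx1
    -- Reflexivity over the discrete valuation ring: test the value of `m` against functionals
    -- integral on the lattice. Each of them is a section of the dual near `x`, on which `m` takes a
    -- regular value.
    refine mem_of_forall_dual (stalkSubring x) _ (stalk_lattice_fg a p x)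
      (span_stalk_lattice a p x) _ fun f hf ↦ ?_
    obtain ⟨U', hx', hU'⟩ := exists_opens_forall_stalkForms f hf
    obtain ⟨φ, rfl⟩ := (formsModel a p).exists_dualEv_eq (genericPoint_mem hx') f
      fun y hy v hv ↦ hU' y hy v ((mem_stalk_formsModel a p).1 hv)
    rw [apply_bidualEv]
    exact (formsDualModel a p).dualEv_mem hU m hx ⟨U', hx', φ, rfl⟩
  · intro hv
    obtain ⟨m, hm⟩ := (formsDualModel a p).exists_dualEv_eq hU
      (Module.evalEquiv X.functionField (RatForms a p) v) fun x hx f ⟨U', hx', φ, hφ⟩ ↦ by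
        have hφ' : (formsModel a p).dualEv (genericPoint_mem hx') φ = f := hφ
        subst hφ'
        -- A local section of the dual takes on `v` a value that is regular at the nearby points of
        -- codimension one, hence regular at `x`.
        refine mem_stalkSubring_of_codimOne (U := U ⊓ U') (fun y hy hy1 ↦ ?_) ⟨hx, hx'⟩
        exact (formsModel a p).dualEv_mem (genericPoint_mem hx') φ hy.2
          ((mem_stalk_formsModel a p).2 (hv y hy.1 hy1))
    exact ⟨m, (congrArg _ hm).trans (LinearEquiv.symm_apply_apply _ _)⟩

end FormsBidual
end ZariskiForms

namespace ZariskiForms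

/-! ### Morphisms of sheaves of modules on sections -/

section Modules

variable {X : Scheme.{u}}

lemma modules_app_map {M N : X.Modules} (α : M ⟶ N) {U V : X.Opens} (i : V ≤ U) (s : Γ(M, U)) :
    α.app V (M.presheaf.map (homOfLE i).op s) = N.presheaf.map (homOfLE i).op (α.app U s) :=
  PresheafOfModules.naturality_apply α.val (homOfLE i).op s

lemma modules_hom_ext {M N : X.Modules} {α β : M ⟶ N}
    (H : ∀ (U : X.Opens) (s : Γ(M, U)), α.app U s = β.app U s) : α = β := by
  ext U s
  exact H U s

lemma formsPullback_toSheafify {k : Type u} [Field k] {X Y : Scheme.{u}} {a : X ⟶ Spec (.of k)}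
    {b : Y ⟶ Spec (.of k)} (f : Y ⟶ X) (h : f ≫ a = b) (p : ℕ) {U : X.Opens} (t : (formsPresheaf a p).obj (op U)) :
    (formsPullback f h p).app U ((toSheafify (formsPresheaf a p)).app (op U) t) =
      (toSheafify (formsPresheaf b p)).app (op (f ⁻¹ᵁ U))
        (formsMap p (f.app U) (structureMap_app f h U) t) :=
  sheafifyDesc_toSheafify _ U t

end Modules

/-! ### Pullback of rational forms and the morphism of biduals -/

section PullbackRational

variable {k : Type u} [Field k] {X Y : Scheme.{u}} [IsIntegral X] [IsIntegral Y]
  {a : X ⟶ Spec (.of k)} {b : Y ⟶ Spec (.of k)} (f : Y ⟶ X) [IsDominant f] (h : f ≫ a = b) (p : ℕ)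

/-- The pullback of rational forms along a dominant morphism. -/
noncomputable def ratPullback : RatForms a p →ₛₗ[(functionFieldMap f).hom] RatForms b p :=
  formsMap p (functionFieldMap f) (ffStructure_comp f h)

lemma ratPullback_mem_stalkForms (y : Y) {v : RatForms a p} (hv : v ∈ stalkForms a p (f y)) :
    ratPullback f h p v ∈ stalkForms b p y := by
  induction hv using Submodule.span_induction with
  | mem v hv =>
    obtain ⟨m, hm, rfl⟩ := hv
    choose c hc hc' using hm
    have : ratPullback f h p (exteriorPower.ιMulti X.functionField p m) =
        exteriorPower.ιMulti Y.functionField p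
          fun i ↦ kaehlerD (ffStructure b) (functionFieldMap f (c i)) := by
      refine (extMap_ιMulti p _ m).trans ?_
      simp only [← hc', kaehlerMap_kaehlerD]
    rw [this]
    exact ιMulti_mem_formsLattice _ fun i ↦ functionFieldMap_mem f y (hc i)
  | zero => rw [map_zero]; exact zero_mem _
  | add v w _ _ hv hw => rw [map_add]; exact add_mem hv hw
  | smul c v _ hv =>
    change ratPullback f h p ((c : X.functionField) • v) ∈ _
    rw [map_smulₛₗ]
    exact smul_mem_of_mem_subring (functionFieldMap_mem f y c.2) hv

lemma formsEv_formsPullback {U : X.Opens} (hU : genericPoint X ∈ U) (s : Γ(forms a p, U)) :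
    formsEv b p (f ⁻¹ᵁ U) (genericPoint_mem_preimage f hU) ((formsPullback f h p).app U s) =
      ratPullback f h p (formsEv a p U hU s) := by
  obtain ⟨V, hV, hη, t, ht⟩ := exists_toSheafify_eq (formsPresheaf a p) s hU
  rw [formsEv_eq hU s hV hη t ht]
  have h1 := modules_app_map (formsPullback f h p) hV s
  have h2 := (formsPullback_toSheafify f h p t).symm.trans (congrArg _ ht)
  rw [formsEv_eq (genericPoint_mem_preimage f hU) _ (f.preimage_mono hV)
    (genericPoint_mem_preimage f hη) _ (h2.trans h1)]
  have e : f.app V ≫ ffGerm (f ⁻¹ᵁ V) (genericPoint_mem_preimage f hη) =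
      ffGerm V hη ≫ functionFieldMap f := by
    ext x
    exact (functionFieldMap_ffGerm f hη x).symm
  have hs : structureMap a V ≫ ffGerm V hη ≫ functionFieldMap f = ffStructure b := by
    rw [← Category.assoc, structureMap_ffGerm, ffStructure_comp f h]
  exact (formsMap_comp p (f.app V) (structureMap_app f h V) (ffGerm (f ⁻¹ᵁ V)
    (genericPoint_mem_preimage f hη)) (structureMap_ffGerm b _) _ hs e t).symm.trans
    (formsMap_comp p (ffGerm V hη) (structureMap_ffGerm a hη) (functionFieldMap f)
      (ffStructure_comp f h) _ hs rfl t)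

variable {p}

/-- On some nonempty open the section `m` comes from an honest form, where the compatibility forces
the value of `α`. This is the source of uniqueness. -/
lemma bidualEv_app_of_extendsPullback [LocallyOfFiniteType a] [LocallyOfFiniteType b]
    {α : formsBidual a p ⟶ (Scheme.Modules.pushforward f).obj (formsBidual b p)}
    (hα : ExtendsPullback f h p α) {U : X.Opens} (hU : genericPoint X ∈ U)
    (m : Γ(formsBidual a p, U)) :
    bidualEv b p (f ⁻¹ᵁ U) (genericPoint_mem_preimage f hU) (α.app U m) =
      ratPullback f h p (bidualEv a p U hU m) := by
  obtain ⟨V, hV, hη, s, hs⟩ := (formsModel a p).exists_ev_le (bidualEv a p U hU m) hU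
  have h1 : (toBidual (forms a p)).app V s = (formsBidual a p).presheaf.map (homOfLE hV).op m := by
    apply bidualEv_injective hη
    rw [bidualEv_map]
    exact (bidualEv_toBidual hη s).trans hs
  have h2 := modules_app_map α hV m
  have h3 : α.app V ((toBidual (forms a p)).app V s) =
      (toBidual (forms b p)).app (f ⁻¹ᵁ V) ((formsPullback f h p).app V s) :=
    congr(($hα).app V s)
  have hηY := genericPoint_mem_preimage f hη
  refine (bidualEv_map hηY (f.preimage_mono hV) (α.app U m)).symm.trans ?_
  refine (congrArg (bidualEv b p (f ⁻¹ᵁ V) hηY)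
    (h2.symm.trans ((congrArg (α.app V) h1.symm).trans h3))).trans ?_
  refine (bidualEv_toBidual hηY ((formsPullback f h p).app V s)).trans ?_
  refine (formsEv_formsPullback f h p hη s).trans ?_
  exact congrArg (ratPullback f h p) hs

lemma subsingleton_dual {M : X.Modules} {U : X.Opens} (hU : genericPoint X ∉ U) :
    Subsingleton Γ(dual M, U) := by
  refine ⟨fun φ ψ ↦ dual_ext (M := M) fun V hV s ↦ ?_⟩
  have := GenericModel.subsingleton_section fun hη ↦ hU (hV hη)
  exact Subsingleton.elim _ _

lemma genericPoint_notMem_preimage {X Y : Scheme.{u}} [IsIntegral X] [IsIntegral Y] (f : Y ⟶ X)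
    {U : X.Opens} (hU : genericPoint X ∉ U) :
    genericPoint Y ∉ f ⁻¹ᵁ U := by
  obtain rfl := eq_bot_of_genericPoint_notMem hU
  exact id

lemma extendsPullback_unique [LocallyOfFiniteType a] [LocallyOfFiniteType b]
    {α β : formsBidual a p ⟶ (Scheme.Modules.pushforward f).obj (formsBidual b p)}
    (hα : ExtendsPullback f h p α) (hβ : ExtendsPullback f h p β) : β = α := by
  refine modules_hom_ext fun U m ↦ ?_
  by_cases hU : genericPoint X ∈ U
  · apply bidualEv_injective (genericPoint_mem_preimage f hU)
    exact (bidualEv_app_of_extendsPullback f h hβ hU m).trans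
      (bidualEv_app_of_extendsPullback f h hα hU m).symm
  · have : Subsingleton Γ(formsBidual b p, f ⁻¹ᵁ U) :=
      subsingleton_dual (genericPoint_notMem_preimage f hU)
    exact this.elim _ _

lemma exists_extendsPullback [LocallyOfFiniteType a] [LocallyOfFiniteType b] [IsNormalScheme X]
    [IsLocallyNoetherian X] [IsNormalScheme Y] [IsLocallyNoetherian Y]
    (hcodim : ∀ y : Y, IsCodimOne y → IsCodimOne (f y)) :
    ∃ α : formsBidual a p ⟶ (Scheme.Modules.pushforward f).obj (formsBidual b p),
      ExtendsPullback f h p α := by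
  have key : ∀ (U : X.Opens) (m : Γ(formsBidual a p, U)), ∃ m' : Γ(formsBidual b p, f ⁻¹ᵁ U),
      ∀ hU : genericPoint X ∈ U, bidualEv b p (f ⁻¹ᵁ U) (genericPoint_mem_preimage f hU) m' =
        ratPullback f h p (bidualEv a p U hU m) := by
    intro U m
    by_cases hU : genericPoint X ∈ U
    -- The pulled back rational form is regular at each `y` of codimension one because `f y` again
    -- has codimension one.
    · obtain ⟨m', hm'⟩ := (mem_range_bidualEv (genericPoint_mem_preimage f hU)
        (ratPullback f h p (bidualEv a p U hU m))).2 fun y hy hy1 ↦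
          ratPullback_mem_stalkForms f h p y
            ((mem_range_bidualEv hU _).1 ⟨m, rfl⟩ (f y) hy (hcodim y hy1))
      exact ⟨m', fun _ ↦ hm'⟩
    · exact ⟨0, fun h ↦ absurd h hU⟩
  choose A hA using key
  have hext : ∀ (U : X.Opens) (m m' : Γ(formsBidual b p, f ⁻¹ᵁ U)), (∀ hU : genericPoint X ∈ U,
      bidualEv b p (f ⁻¹ᵁ U) (genericPoint_mem_preimage f hU) m =
        bidualEv b p (f ⁻¹ᵁ U) (genericPoint_mem_preimage f hU) m') → m = m' := by
    intro U m m' H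
    by_cases hU : genericPoint X ∈ U
    · exact bidualEv_injective _ (H hU)
    · have : Subsingleton Γ(formsBidual b p, f ⁻¹ᵁ U) :=
        subsingleton_dual (genericPoint_notMem_preimage f hU)
      exact Subsingleton.elim _ _
  have hadd : ∀ (U : X.Opens) (m n : Γ(formsBidual a p, U)), A U (m + n) = A U m + A U n := by
    refine fun U m n ↦ hext U _ _ fun hU ↦ ?_
    rw [hA U _ hU, bidualEv_add, map_add, ← hA U m hU, ← hA U n hU, bidualEv_add]
  have hsmul : ∀ (U : X.Opens) (r : Γ(X, U)) (m : Γ(formsBidual a p, U)),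
      A U (r • m) = f.app U r • A U m := by
    refine fun U r m ↦ hext U _ _ fun hU ↦ ?_
    rw [hA U _ hU, bidualEv_smul, map_smulₛₗ, ← hA U m hU, bidualEv_smul]
    exact congrArg (· • bidualEv b p (f ⁻¹ᵁ U) (genericPoint_mem_preimage f hU) (A U m))
      (functionFieldMap_ffGerm f hU r)
  have hmap : ∀ (U V : X.Opens) (hV : V ≤ U) (m : Γ(formsBidual a p, U)),
      A V ((formsBidual a p).presheaf.map (homOfLE hV).op m) =
        (formsBidual b p).presheaf.map (homOfLE (f.preimage_mono hV)).op (A U m) := by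
    refine fun U V hV m ↦ hext V _ _ fun hη ↦ ?_
    rw [hA V _ hη, bidualEv_map, ← hA U m (hV hη),
      bidualEv_map (genericPoint_mem_preimage f hη) (f.preimage_mono hV)]
  obtain ⟨α, hα⟩ : ∃ α : formsBidual a p ⟶ (Scheme.Modules.pushforward f).obj (formsBidual b p),
      ∀ (U : X.Opens) (m : Γ(formsBidual a p, U)), α.app U m = A U m := by
    exact ⟨homMk (N := (Scheme.Modules.pushforward f).obj (formsBidual b p)) (fun U ↦
      { toFun := A U
        map_add' := hadd U
        map_smul' := hsmul U }) fun U V hV m ↦ hmap U V hV m, fun U m ↦ rfl⟩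
  refine ⟨α, modules_hom_ext fun U s ↦ ?_⟩
  let n : Γ(formsBidual b p, f ⁻¹ᵁ U) :=
    (toBidual (forms b p)).app (f ⁻¹ᵁ U) ((formsPullback f h p).app U s)
  let m : Γ(formsBidual a p, U) := (toBidual (forms a p)).app U s
  have h1 : A U m = n := by
    refine hext U (A U m) n fun hU ↦ ?_
    refine (hA U m hU).trans ?_
    refine (congrArg (ratPullback f h p) (bidualEv_toBidual hU s)).trans ?_
    refine (formsEv_formsPullback f h p hU s).symm.trans ?_
    exact (bidualEv_toBidual (genericPoint_mem_preimage f hU) ((formsPullback f h p).app U s)).symm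
  have h2 : α.app U m = n := (hα U m).trans h1
  exact h2

end PullbackRational
end ZariskiForms

namespace ZariskiForms

/-! ### The action of automorphisms on the bidual, in terms of rational forms -/

section BidualPullback

variable {X Y : Scheme.{u}}

/-- The map `M^* → (e⁻¹)_* N^*` induced by an isomorphism `e : X ≅ Y` and a map `N → e_* M`. -/
noncomputable def dualPullback (e : X ≅ Y) {M : X.Modules} {N : Y.Modules}
    (a : N ⟶ (Scheme.Modules.pushforward e.hom).obj M) :
    dual M ⟶ (Scheme.Modules.pushforward e.inv).obj (dual N) :=
  (Scheme.Modules.pushforwardId X).inv.app (dual M) ≫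
      (Scheme.Modules.pushforwardCongr e.hom_inv_id.symm).hom.app (dual M) ≫
      (Scheme.Modules.pushforwardComp e.hom e.inv).inv.app (dual M) ≫
      (Scheme.Modules.pushforward e.inv).map (dualTransport e.hom a)

lemma preimage_hom_le (e : X ≅ Y) {V : X.Opens} {U : Y.Opens} (h : U ≤ e.inv ⁻¹ᵁ V) :
    e.hom ⁻¹ᵁ U ≤ V := by
  intro x hx
  have h1 : e.inv (e.hom x) ∈ V := h hx
  rwa [← Scheme.Hom.comp_apply, e.hom_inv_id] at h1

variable {k : Type u} [Field k] [IsIntegral X] [IsIntegral Y]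
  {a : Y ⟶ Spec (.of k)} {b : X ⟶ Spec (.of k)} (e : X ≅ Y) (h : e.hom ≫ a = b) (p : ℕ)

/-- Removes the inverse comorphism that occurs in `dualTransport`. -/
lemma functionFieldMap_inv_app (f : X ⟶ Y) [IsIso f] {U : Y.Opens} (hU : genericPoint Y ∈ U)
    (z : Γ(X, f ⁻¹ᵁ U)) : functionFieldMap f (ffGerm U hU (inv (f.app U) z)) =
      ffGerm (f ⁻¹ᵁ U) (genericPoint_mem_preimage f hU) z := by
  rw [functionFieldMap_ffGerm]
  exact congrArg (ffGerm (f ⁻¹ᵁ U) (genericPoint_mem_preimage f hU))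
    congr($(IsIso.inv_hom_id (f.app U)) z)

/-- Transport of functionals is adjoint to pullback of forms; it is enough to check this on generic
values of sections, where it is the definition of the transport. -/
lemma dualEv_ratPullback [LocallyOfFiniteType a] [LocallyOfFiniteType b] {V : X.Opens}
    (hV : genericPoint X ∈ V) (φ : Γ(dual (forms b p), V)) (v : RatForms a p) :
    (formsModel b p).dualEv hV φ (ratPullback e.hom h p v) =
      functionFieldMap e.hom ((formsModel a p).dualEv (genericPoint_mem_preimage e.inv hV)
        ((dualPullback e (formsPullback e.hom h p)).app V φ) v) := by
  obtain ⟨U, hU, hη, s, rfl⟩ :=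
    (formsModel a p).exists_ev_le v (genericPoint_mem_preimage e.inv hV)
  have h1 := (formsModel a p).dualEv_ev (genericPoint_mem_preimage e.inv hV)
    ((dualPullback e (formsPullback e.hom h p)).app V φ) hU hη s
  have h2 := functionFieldMap_inv_app e.hom hη (dualEval (M := forms b p) φ (preimage_hom_le e hU)
    ((formsPullback e.hom h p).app U s))
  have h3 := (formsModel b p).dualEv_ev hV φ (preimage_hom_le e hU)
    (genericPoint_mem_preimage e.hom hη) ((formsPullback e.hom h p).app U s)
  refine (congrArg ((formsModel b p).dualEv hV φ)
    (formsEv_formsPullback e.hom h p hη s).symm).trans (h3.trans ?_)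
  exact h2.symm.trans (congrArg (functionFieldMap e.hom) h1.symm)

lemma bidualEv_bidualPullback [LocallyOfFiniteType a] [LocallyOfFiniteType b]
    (m : Γ(formsBidual a p, ⊤)) :
    bidualEv b p ⊤ trivial (bidualPullback e (formsPullback e.hom h p) m) =
      ratPullback e.hom h p (bidualEv a p ⊤ trivial m) := by
  refine (bidualEv_eq_iff (U := ⊤) trivial _ _).2 fun V hV hη φ ↦ ?_
  rw [dualEv_ratPullback]
  have h1 := dualEv_bidualEv (a := a) (p := p) (U := ⊤) trivial m le_top
    (genericPoint_mem_preimage e.inv hη) ((dualPullback e (formsPullback e.hom h p)).app V φ)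
  refine (congrArg (functionFieldMap e.hom) h1).trans ?_
  -- Dualizing twice transports along `e.hom` and then along `e.inv`; on function fields the two
  -- maps cancel.
  have h2 := functionFieldMap_inv_app e.inv hη (dualEval (M := dual (forms a p)) m
    (le_top : e.inv ⁻¹ᵁ V ≤ ⊤) ((dualPullback e (formsPullback e.hom h p)).app V φ))
  refine (congrArg (functionFieldMap e.hom) h2.symm).trans ?_
  rw [← CommRingCat.comp_apply, ← functionFieldMap_comp, functionFieldMap_congr e.hom_inv_id,
    functionFieldMap_id]
  rfl

end BidualPullback
end ZariskiForms

namespace ZariskiForms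

/-! ### Galois invariance of rational forms -/

section Galois

lemma exists_basis_ratPullback {k : Type u} [Field k] {X Y : Scheme.{u}} [IsIntegral X]
    [IsIntegral Y] {a : X ⟶ Spec (.of k)} {b : Y ⟶ Spec (.of k)} [LocallyOfFiniteType a]
    (f : Y ⟶ X) [IsDominant f] (h : f ≫ a = b) (p : ℕ)
    (het : (functionFieldMap f).hom.FormallyEtale) :
    ∃ (ι : Type) (_ : Finite ι) (B : Module.Basis ι X.functionField (RatForms a p))
      (B' : Module.Basis ι Y.functionField (RatForms b p)), ∀ i, ratPullback f h p (B i) = B' i := by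
  have := finite_kaehler a
  let B := Module.finBasis X.functionField (CommRingCat.KaehlerDifferential (ffStructure a))
  obtain ⟨B', hB⟩ := exists_basis_kaehlerMap (functionFieldMap f) (ffStructure_comp f h) het B
  exact ⟨_, inferInstance, B.exteriorPower p, B'.exteriorPower p,
    fun s ↦ extMap_basis _ p B B' hB s⟩

lemma surjective_of_isIntegralHom {X Y : Scheme.{u}} (f : Y ⟶ X) [IsIntegralHom f]
    [IsDominant f] : Function.Surjective f :=
  (surjective_of_isDominant_of_isClosed_range f
    (f.isClosedMap.isClosed_range)).surj

variable {k : Type u} [Field k] {X : Scheme.{u}} [IsIntegral X] (a : X ⟶ Spec (.of k))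
  {L : Type u} [Field L] [Algebra X.functionField L] (p : ℕ)

/-- Holds because the automorphism induced by `g` commutes with the projection to `X`. -/
lemma ratPullback_galoisHom (g : L ≃ₐ[X.functionField] L) (v : RatForms a p) :
    ratPullback (galoisHom X g) (by rw [← Category.assoc, galoisHom_comp_hom]) p
      (ratPullback (normalizationInHom X L) rfl p v) =
        ratPullback (normalizationInHom X L) rfl p v := by
  refine (formsMap_comp p (functionFieldMap (normalizationInHom X L)) _
    (functionFieldMap (galoisHom X g)) _ _ (ffStructure_comp _ rfl) ?_ v).symm
  rw [← functionFieldMap_comp, functionFieldMap_congr (galoisHom_comp_hom X L g)]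

variable [LocallyOfFiniteType (normalizationInHom X L ≫ a)]

lemma bidualEv_galoisPullback (g : L ≃ₐ[X.functionField] L)
    (m : Γ(formsBidual (normalizationInHom X L ≫ a) p, ⊤)) :
    bidualEv (normalizationInHom X L ≫ a) p ⊤ trivial (galoisPullback a p g m) =
      ratPullback (galoisHom X g) (by rw [← Category.assoc, galoisHom_comp_hom]) p
        (bidualEv (normalizationInHom X L ≫ a) p ⊤ trivial m) :=
  bidualEv_bidualPullback (galoisIso X g) _ p m

end Galois
end ZariskiForms

/-! ### The comparison theorem -/

theorem mainTheorem2 {k : Type u} [Field k] {X : Scheme.{u}} [AlgebraicGeometry.IsIntegral X] [IsNormalScheme X]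
    (a : X ⟶ Spec (.of k)) [LocallyOfFiniteType a]
    (L : Type u) [Field L] [Algebra X.functionField L] [FiniteDimensional X.functionField L]
    [IsGalois X.functionField L] (htame : IsTamelyRamified (normalizationInHom X L)) (p : ℕ) :
    ∃ α : formsBidual a p ⟶ (Scheme.Modules.pushforward (normalizationInHom X L)).obj
        (formsBidual (normalizationInHom X L ≫ a) p),
      ExtendsPullback (normalizationInHom X L) rfl p α ∧
      (∀ β, ExtendsPullback (normalizationInHom X L) rfl p β → β = α) ∧
      Function.Injective (α.app ⊤) ∧
      Set.range (α.app ⊤) = {m | ∀ g : L ≃ₐ[X.functionField] L, galoisPullback a p g m = m} := by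
  have : IsLocallyNoetherian X := LocallyOfFiniteType.isLocallyNoetherian a
  have : LocallyOfFiniteType (normalizationInHom X L ≫ a) := inferInstance
  have : IsLocallyNoetherian (normalizationIn X L) :=
    LocallyOfFiniteType.isLocallyNoetherian (normalizationInHom X L ≫ a)
  have het := formallyEtale_functionFieldMap X L
  have hcodim := isCodimOne_iff (normalizationInHom X L)
  obtain ⟨α, hα⟩ := exists_extendsPullback (a := a) (p := p) (normalizationInHom X L) rfl
    fun w hw ↦ (hcodim w).1 hw
  obtain ⟨ι, _, B, B', hB⟩ := exists_basis_ratPullback (a := a) (normalizationInHom X L) rfl p het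
  have hαv : ∀ m, bidualEv (normalizationInHom X L ≫ a) p ⊤ trivial (α.app ⊤ m) =
      ratPullback (normalizationInHom X L) rfl p (bidualEv a p ⊤ trivial m) :=
    fun m ↦ bidualEv_app_of_extendsPullback (normalizationInHom X L) rfl hα (U := ⊤) trivial m
  refine ⟨α, hα, fun β hβ ↦ extendsPullback_unique _ rfl hα hβ, fun m n hmn ↦ ?_, ?_⟩
  · apply bidualEv_injective (U := ⊤) trivial
    -- Both biduals embed in rational forms, and there the pullback carries a basis to a basis.
    apply injective_of_basis_image _ B B' hB
    rw [← hαv, ← hαv, hmn]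
  · refine Set.Subset.antisymm ?_ fun m hm ↦ ?_
    · rintro _ ⟨m, rfl⟩ g
      apply bidualEv_injective (U := ⊤) trivial
      refine (bidualEv_galoisPullback a p g (α.app ⊤ m)).trans ?_
      refine Eq.trans (congrArg _ (hαv m)) (.trans ?_ (hαv m).symm)
      exact ratPullback_galoisHom a p g _
    -- Descent first ignores regularity: the invariant rational form of `m` comes from a rational
    -- form `v` on `X`.
    · obtain ⟨v, hv⟩ := exists_of_fixed _ B B' hB
        (fun g : L ≃ₐ[X.functionField] L ↦ (functionFieldMap (galoisHom X g)).hom)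
        (fun g ↦ ratPullback (galoisHom X g) (by rw [← Category.assoc, galoisHom_comp_hom]) p)
        (fun g v ↦ ratPullback_galoisHom a p g v) exists_functionFieldMap_eq
        (bidualEv (normalizationInHom X L ≫ a) p ⊤ trivial m) fun g ↦
          (bidualEv_galoisPullback a p g m).symm.trans (congrArg _ (hm g))
      -- Regularity of `v` is needed only in codimension one. Above such an `x` there is a point
      -- `w`, again of codimension one; the pullback of `v` is regular at `w`, and tameness brings
      -- this down to `x`.
      obtain ⟨m₀, rfl⟩ := (mem_range_bidualEv (U := ⊤) trivial v).2 fun x _ hx ↦ by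
        obtain ⟨w, rfl⟩ := surjective_of_isIntegralHom (normalizationInHom X L) x
        have hw := (hcodim w).2 hx
        refine mem_formsLattice_of_tame (normalizationInHom X L) htame rfl het p w hw hx v ?_
        exact hv ▸ (mem_range_bidualEv (U := ⊤) trivial _).1 ⟨m, rfl⟩ w trivial hw
      exact ⟨m₀, bidualEv_injective (U := ⊤) trivial ((hαv m₀).trans hv)⟩
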